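/- **Definitions.** A ($\mathbb Q$-)weighted automaton consists of a finite set $Q$ of states, an initial state $q_I$, a finite alphabet $\Sigma$, a set $\delta\subseteq Q\times\Sigma\times Q$ of transitions such that for all $q\in Q$, $\sigma\in\Sigma$ some $(q,\sigma,q')$ is in $\delta$, and a weight function $\mathsf{wt}:\delta\to\mathbb Q$. A run over a word $w=\sigma_1\sigma_2\dots\in\Sigma^\omega$ is a sequence $r=q_0q_1\dots$ with $q_0=q_I$ and $(q_i,\sigma_{i+1},q_{i+1})\in\delta$ for all $i\ge 0$; $\mathsf{wt}(r)$ is the sequence of its weights. For a real sequence $v_0v_1\dots$, $\mathsf{LimInfAvg}$ and $\mathsf{LimSupAvg}$ are the $\liminf$ and the $\limsup$ of $\frac1n\sum_{i<n}v_i$ as $n\to\infty$. Let $\mathsf{Val}\in\{\mathsf{LimInfAvg},\mathsf{LimSupAvg}\}$. A nondeterministic $\mathsf{Val}$-automaton $A$ is a weighted automaton with the quantitative language $L_A:\Sigma^\omega\to\mathbb R$, $L_A(w)=\sup\{\mathsf{Val}(\mathsf{wt}(r)) : r \text{ a run over } w\}$. An alternating $\mathsf{Val}$-automaton $A$ is a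 weighted automaton whose states are partitioned between players 1 and 2; over a fixed word $w$ the owner of the current state chooses, knowing the states visited so far, a transition on the current letter, and $L_A(w)=\sup_\sigma\inf_\tau \mathsf{Val}(\mathsf{wt}(r_w^{\sigma,\tau}))$, where $\sigma,\tau$ range over the strategies of players 1 and 2 and $r_w^{\sigma,\tau}$ is the resulting run. A mean-payoff automaton is a $\mathsf{LimInfAvg}$- or a $\mathsf{LimSupAvg}$-automaton. Automata are given as finite data: numbers of states and letters, initial state, table of the transitions with their weights, owners of the states; rationals are given as pairs of integers. A problem is decidable if some partial recursive function halts with the right answer on the code of every instance. Given $A$ and $\nu\in\mathbb Q$, quantitative emptiness asks whether $L_A(w)\ge\nu$ for some word $w$, and quantitative universality whether $L_A(w)\ge\nu$ for all words $w$. Given $A_1,A_2$ over the same alphabet, quantitative inclusion asks whether $L_{A_1}(w)\le L_{A_2}(w)$ for all words $w$, and quantitative equivalence whether $L_{A_1}(w)=L_{A_2}(w)$ for all words $w$. **Theorem.** 1. For nondeterministic mean-payoff automata, the quantitative universality, inclusion and equivalence problems are undecidable; in fact each of them is undecidable already for nondeterministic $\mathsf{LimInfAvg}$-automata, and also already for nondeterministic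 $\mathsf{LimSupAvg}$-automata. 2. For alternating mean-payoff automata (an instance names the kind of the automaton, $\mathsf{LimInfAvg}$ or $\mathsf{LimSupAvg}$), the quantitative emptiness problem is undecidable. The quantitative universality, inclusion and equivalence problems are undecidable for alternating mean-payoff automata as well, and again already for alternating $\mathsf{LimInfAvg}$-automata and also already for alternating $\mathsf{LimSupAvg}$-automata. -/

import Mathlib

open Filter

namespace MeanPayoff

/-! ### Mean-payoff values -/

/-- The two ways of taking the long-run average of a sequence. -/
inductive LimitKind : Type
  | limInfAvg
  | limSupAvg

/-- The average of the first `n` terms of a sequence. -/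
noncomputable def average (x : ℕ → ℝ) (n : ℕ) : ℝ :=
  (1 / (n : ℝ)) * ∑ i ∈ Finset.range n, x i

/-- `LimInfAvg` and `LimSupAvg` of a sequence of real numbers. -/
noncomputable def LimitKind.val : LimitKind → (ℕ → ℝ) → ℝ
  | .limInfAvg, x => liminf (average x) atTop
  | .limSupAvg, x => limsup (average x) atTop

/-! ### Nondeterministic automata -/

/-- A `ℚ`-weighted automaton with states `Q` over the alphabet `A`. `edge q a q'` is `none` if
`(q, a, q')` is not a transition, and `some c` if it is a transition of weight `c`. -/
structure WeightedAutomaton (Q A : Type) where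
  init : Q
  edge : Q → A → Q → Option ℚ
  total : ∀ q a, ∃ q', (edge q a q').isSome

namespace WeightedAutomaton

variable {Q A : Type}

/-- `(q, a, q')` is a transition. -/
def IsTrans (M : WeightedAutomaton Q A) (q : Q) (a : A) (q' : Q) : Prop :=
  (M.edge q a q').isSome

/-- The weight of `(q, a, q')` (only used for transitions). -/
def wt (M : WeightedAutomaton Q A) (q : Q) (a : A) (q' : Q) : ℚ :=
  (M.edge q a q').getD 0

/-- `r` is (the sequence of states of) a run of `M` over the infinite word `w`. -/
def IsRun (M : WeightedAutomaton Q A) (w : ℕ → A) (r : ℕ → Q) : Prop :=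
  r 0 = M.init ∧ ∀ i, M.IsTrans (r i) (w i) (r (i + 1))

/-- The sequence of weights along the run `r` over `w`. -/
def weights (M : WeightedAutomaton Q A) (w : ℕ → A) (r : ℕ → Q) (i : ℕ) : ℝ :=
  (M.wt (r i) (w i) (r (i + 1)) : ℝ)

/-- The quantitative language of a nondeterministic automaton: the supremum of the values of the
runs over the word. -/
noncomputable def lang (M : WeightedAutomaton Q A) (v : LimitKind) (w : ℕ → A) : ℝ :=
  sSup {x : ℝ | ∃ r, M.IsRun w r ∧ x = v.val (M.weights w r)}

end WeightedAutomaton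

/-! ### Alternating automata -/

/-- An alternating weighted automaton: each state belongs to player 1 (`isMax q = true`), who
maximizes the value of the run, or to player 2, who minimizes it. -/
structure AlternatingAutomaton (Q A : Type) extends WeightedAutomaton Q A where
  isMax : Q → Bool

namespace AlternatingAutomaton

variable {Q A : Type}

/-- A strategy over the word `w`: given the list `h` of the states visited before the current
state `q`, it picks the target of a transition from `q` on the current letter of `w`. -/
def IsStrategy (M : AlternatingAutomaton Q A) (w : ℕ → A) (s : List Q → Q → Q) : Prop :=
  ∀ h q, M.IsTrans q (w h.length) (s h q)

/-- `r` is the run over which the players play when player 1 uses `s` and player 2 uses `t`. -/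
def IsOutcome (M : AlternatingAutomaton Q A) (s t : List Q → Q → Q) (r : ℕ → Q) : Prop :=
  r 0 = M.init ∧
    ∀ i, r (i + 1) = (if M.isMax (r i) then s else t) ((List.range i).map r) (r i)

/-- The quantitative language of an alternating automaton: the supremum, over the strategies of
player 1, of the infimum, over the strategies of player 2, of the value of the outcome. -/
noncomputable def lang (M : AlternatingAutomaton Q A) (v : LimitKind) (w : ℕ → A) : ℝ :=
  sSup {x : ℝ | ∃ s, M.IsStrategy w s ∧
    x = sInf {y : ℝ | ∃ t, M.IsStrategy w t ∧
      ∃ r, M.IsOutcome s t r ∧ y = v.val (M.weights w r)}}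

end AlternatingAutomaton

/-! ### Decision problems for quantitative languages -/

/-- Some word has value at least `ν`. -/
def QuantNonempty {A : Type} (L : (ℕ → A) → ℝ) (ν : ℚ) : Prop := ∃ w, (ν : ℝ) ≤ L w

/-- Every word has value at least `ν`. -/
def QuantUniversal {A : Type} (L : (ℕ → A) → ℝ) (ν : ℚ) : Prop := ∀ w, (ν : ℝ) ≤ L w

def QuantIncluded {A : Type} (L₁ L₂ : (ℕ → A) → ℝ) : Prop := ∀ w, L₁ w ≤ L₂ w

def QuantEquivalent {A : Type} (L₁ L₂ : (ℕ → A) → ℝ) : Prop := ∀ w, L₁ w = L₂ w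

/-! ### Instances of the decision problems and their encoding as finite data -/

/-- A rational number is encoded as a pair of integers: numerator and denominator. -/
def encodeRat (c : ℚ) : ℤ × ℕ := (c.num, c.den)

/-- Number of states, number of letters, initial state, and the table of transitions with their
weights, indexed by source, letter and target. -/
abbrev AutomatonCode : Type := ℕ × ℕ × ℕ × List (List (List (Option (ℤ × ℕ))))

def WeightedAutomaton.encode {n k : ℕ} (M : WeightedAutomaton (Fin n) (Fin k)) :
    AutomatonCode :=
  (n, k, (M.init : ℕ),
    List.ofFn fun q => List.ofFn fun a => List.ofFn fun q' => (M.edge q a q').map encodeRat)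

/-- The code of the underlying weighted automaton together with the owners of the states. -/
def AlternatingAutomaton.encode {n k : ℕ} (M : AlternatingAutomaton (Fin n) (Fin k)) :
    AutomatonCode × List Bool :=
  (M.toWeightedAutomaton.encode, List.ofFn M.isMax)

def LimitKind.encode : LimitKind → Bool
  | .limInfAvg => false
  | .limSupAvg => true

/-- An automaton and a threshold. `Aut n k` is the type of automata with `n` states over an
alphabet with `k` letters. -/
structure ThresholdInstance (Aut : ℕ → ℕ → Type) where
  states : ℕ
  letters : ℕ
  aut : Aut states letters
  threshold : ℚ

/-- Two automata over the same alphabet. -/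
structure PairInstance (Aut : ℕ → ℕ → Type) where
  letters : ℕ
  states₁ : ℕ
  states₂ : ℕ
  aut₁ : Aut states₁ letters
  aut₂ : Aut states₂ letters

def ThresholdInstance.encode {Aut : ℕ → ℕ → Type} {C : Type} (enc : ∀ {n k}, Aut n k → C)
    (I : ThresholdInstance Aut) : C × (ℤ × ℕ) :=
  (enc I.aut, encodeRat I.threshold)

def PairInstance.encode {Aut : ℕ → ℕ → Type} {C : Type} (enc : ∀ {n k}, Aut n k → C)
    (I : PairInstance Aut) : C × C :=
  (enc I.aut₁, enc I.aut₂)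

/-- Nondeterministic automata with `n` states over `k` letters. -/
abbrev NAut (n k : ℕ) : Type := WeightedAutomaton (Fin n) (Fin k)

/-- Alternating automata with `n` states over `k` letters. -/
abbrev AAut (n k : ℕ) : Type := AlternatingAutomaton (Fin n) (Fin k)

/-- The decision problem "given an instance `i`, does `P i` hold?", whose instances are given to
an algorithm through their codes, is decidable: some partial recursive function halts with the
right answer on the code of every instance. Nothing is required on data that are not codes. -/
def DecidableProblem {I C : Type} [Primcodable C] (code : I → C) (P : I → Prop) : Prop :=
  ∃ f : C →. Bool, Partrec f ∧ ∀ i, ∃ b ∈ f (code i), (b = true ↔ P i)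

end MeanPayoff

/-! The halting problem is reduced to mean payoffs through counter systems. Register programs
compute all partial recursive functions (`Prog.computable_of_partrec'`), so one fixed program, read
as a finite counter system, halts exactly on the members of an undecidable set H
(`exists_undecidable_counterSystem`). On inputs in H the system reaches a final tag and its traces
have bounded length; on the other inputs it never does and has traces of every length.

A word is cut into blocks by the letter `mark`, and a block claims to be an execution. A
configuration consists of a tag, U letters `none` and, for each counter r, c_r * U letters `some r`;
the unit U is halved from one configuration to the next. Because of the halving, a block is at most
a constant times longer than its first unit, however many steps it describes. Hence each of the
first N units is at least a fixed fraction of the block length, and tests that tolerate an error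
proportional to that length still verify the first N steps.

The detector either passes a block idly and receives `price` at its end, or guesses one condition
(initial tag and counters, halved unit, counter update, zero test, compatible tags, accepted last
tag, bounded length) and receives in addition the amount by which the condition is violated, counted
in letters. If no path over a block gains much, the block begins with a genuine trace
(`Detector.exists_isTrace_of_blockPath_le`, which rests on the rounding argument
`CounterSystem.isTrace_of_approx`). Conversely each trace yields a block over which no path gains
much (`Detector.exists_block`).

With price -1 this gives universality. If the system accepts, repeating one accepting block of
period L forces average at most -1/L on every run (`Detector.exists_lang_neg`). Otherwise every
block has a path of weight at least 0, and combining these paths gives a run of nonnegative value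
(`Detector.lang_nonneg`); very long blocks are passed idly there, so that dips inside a test do not
spoil the liminf. Words with finitely many marks are handled by a sink that earns 1 forever.

With price 1, negated weights and the infimum over runs, this gives emptiness for automata owned by
player 2. If the system has traces of every length, slowly growing blocks, each of weight at most 2,
make all averages tend to a nonnegative limit or better (`Detector.exists_sInf_values_nonneg`). If
it has no trace of length N, every block has a path of weight proportional to its length, so some
run over each word has negative liminf (`Detector.sInf_values_neg`).

Inclusion and equivalence follow from universality, because max(0, L) is again the language of a
nondeterministic automaton, and max(0, L) ≤ L, as well as max(0, L) = L, says that L is nonnegative.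
Automata owned by player 1 are nondeterministic automata. -/

namespace MeanPayoff

/-! ### Programs over registers -/

/-- Programs over registers that hold natural numbers; `loop r p` repeats
"decrement `r`, then run `p`" as long as `r` is not zero. -/
inductive Prog : Type
  | nop
  | inc (r : ℕ)
  | seq (p q : Prog)
  | loop (r : ℕ) (p : Prog)

namespace Prog

/-- `Big p v v'`: started in `v`, the program `p` terminates in `v'`. -/
inductive Big : Prog → (ℕ → ℕ) → (ℕ → ℕ) → Prop
  | nop (v) : Big nop v v
  | inc (r v) : Big (inc r) v (Function.update v r (v r + 1))
  | seq {p q v v' v''} : Big p v v' → Big q v' v'' → Big (seq p q) v v''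
  | loop_zero {r p v} : v r = 0 → Big (loop r p) v v
  | loop_pos {r p v v' v''} : v r ≠ 0 → Big p (Function.update v r (v r - 1)) v' →
      Big (loop r p) v' v'' → Big (loop r p) v v''

theorem big_seq {p q v v''} : Big (seq p q) v v'' ↔ ∃ v', Big p v v' ∧ Big q v' v'' := by
  constructor
  · rintro (_ | _ | ⟨h₁, h₂⟩)
    exact ⟨_, h₁, h₂⟩
  · rintro ⟨v', h₁, h₂⟩
    exact .seq h₁ h₂

theorem big_nop {v v'} : Big nop v v' ↔ v' = v := by
  constructor
  · rintro ⟨⟩; rfl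
  · rintro rfl; exact .nop _

theorem big_inc {r v v'} : Big (inc r) v v' ↔ v' = Function.update v r (v r + 1) := by
  constructor
  · rintro ⟨⟩; rfl
  · rintro rfl; exact .inc _ _

theorem big_loop_zero {r p v v'} (h : v r = 0) : Big (loop r p) v v' ↔ v' = v := by
  constructor
  · rintro (_ | _ | _ | _ | ⟨h', _, _⟩)
    · rfl
    · exact absurd h h'
  · rintro rfl; exact .loop_zero h

theorem big_loop_pos {r p v v''} (h : v r ≠ 0) : Big (loop r p) v v'' ↔
    ∃ v', Big p (Function.update v r (v r - 1)) v' ∧ Big (loop r p) v' v'' := by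
  constructor
  · rintro (_ | _ | _ | h' | ⟨_, h₁, h₂⟩)
    · exact absurd h' h
    · exact ⟨_, h₁, h₂⟩
  · rintro ⟨v', h₁, h₂⟩
    exact .loop_pos h h₁ h₂

/-- Set register `r` to zero. -/
def clear (r : ℕ) : Prog := loop r nop

theorem big_clear {r v v'} : Big (clear r) v v' ↔ v' = Function.update v r 0 := by
  unfold clear
  induction hm : v r generalizing v with
  | zero => rw [big_loop_zero hm, ← hm, Function.update_eq_self]
  | succ m ih =>
    rw [big_loop_pos (by omega)]
    simp only [big_nop, exists_eq_left]
    rw [ih (by simp [hm])]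
    simp

/-- Add the content of register `a` to register `b` and clear `a`. -/
def move (a b : ℕ) : Prog := loop a (inc b)

theorem big_move {a b v v'} (hab : a ≠ b) :
    Big (move a b) v v' ↔ v' = Function.update (Function.update v b (v b + v a)) a 0 := by
  unfold move
  induction hm : v a generalizing v with
  | zero =>
    rw [big_loop_zero hm]
    have : Function.update (Function.update v b (v b + 0)) a 0 = v := by
      rw [add_zero, Function.update_eq_self, ← hm, Function.update_eq_self]
    rw [this]
  | succ m ih =>
    rw [big_loop_pos (by omega)]
    simp only [big_inc, exists_eq_left]
    rw [ih (by simp [hm, hab])]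
    have : ∀ x y : ℕ → ℕ, x = y → (v' = x ↔ v' = y) := by rintro x _ rfl; rfl
    apply this
    funext r
    by_cases h1 : r = a
    · subst h1; simp
    · by_cases h2 : r = b
      · subst h2; simp [h1]; omega
      · simp [h1, h2]

/-- Copy register `a` to register `b`, using the auxiliary register `t`. -/
def copy (a b t : ℕ) : Prog :=
  seq (clear b) (seq (clear t) (seq (loop a (seq (inc b) (inc t))) (move t a)))

theorem big_copy {a b t v v'} (hab : a ≠ b) (hat : a ≠ t) (hbt : b ≠ t) :
    Big (copy a b t) v v' ↔ v' = Function.update (Function.update v b (v a)) t 0 := by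
  have key : ∀ (m : ℕ) (v v' : ℕ → ℕ), v a = m → (Big (loop a (seq (inc b) (inc t))) v v' ↔
      v' = Function.update (Function.update (Function.update v b (v b + m)) t (v t + m)) a 0) := by
    intro m
    induction m with
    | zero =>
      intro v v' hm
      rw [big_loop_zero hm]
      have : Function.update (Function.update (Function.update v b (v b + 0)) t (v t + 0)) a 0
          = v := by
        simp only [add_zero, Function.update_eq_self]
        rw [← hm, Function.update_eq_self]
      rw [this]
    | succ m ih =>
      intro v v' hm
      rw [big_loop_pos (by omega)]
      simp only [big_seq, big_inc, exists_eq_left]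
      rw [ih _ _ (by simp [hm, hab, hat])]
      have : ∀ x y : ℕ → ℕ, x = y → (v' = x ↔ v' = y) := by rintro x _ rfl; rfl
      apply this
      funext r
      by_cases h1 : r = a
      · subst h1; simp
      · by_cases h2 : r = b
        · subst h2; simp [h1, hbt]; omega
        · by_cases h3 : r = t
          · subst h3; simp [h1, h2]; omega
          · simp [h1, h2, h3]
  simp only [copy, big_seq, big_clear, exists_eq_left, key _ _ _ rfl, big_move hat.symm]
  have : ∀ x y : ℕ → ℕ, x = y → (v' = x ↔ v' = y) := by rintro x _ rfl; rfl
  apply this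
  funext r
  by_cases h1 : r = a
  · subst h1; simp [hab, hat, hat.symm]
  · by_cases h2 : r = b
    · subst h2; simp [h1, hbt, hab, hat]
    · by_cases h3 : r = t
      · subst h3; simp
      · simp [h1, h2, h3]

/-- `p` computes the partial function `f` of the registers `ins` into register `base`, and does not
change the registers below `base`. -/
def Computes {n : ℕ} (p : Prog) (f : List.Vector ℕ n →. ℕ) (ins : Fin n → ℕ) (base : ℕ) : Prop :=
  ∀ v, (∀ v', Big p v v' → v' base ∈ f (List.Vector.ofFn fun i => v (ins i)) ∧
      ∀ r < base, v' r = v r) ∧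
    ((f (List.Vector.ofFn fun i => v (ins i))).Dom → ∃ v', Big p v v')

/-- `f` is computed by programs, wherever its arguments are placed. -/
def Computable {n : ℕ} (f : List.Vector ℕ n →. ℕ) : Prop :=
  ∀ (ins : Fin n → ℕ) (base : ℕ), (∀ i, ins i < base) → ∃ p, Computes p f ins base

theorem computable_zero : Computable (n := 0) (fun _ => Part.some 0) := by
  intro ins base _
  refine ⟨clear base, fun v => ⟨fun v' h => ?_, fun _ => ⟨_, big_clear.2 rfl⟩⟩⟩
  obtain rfl := big_clear.1 h
  simp +contextual [ne_of_lt]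

theorem computable_get {n : ℕ} (i : Fin n) : Computable (fun v => Part.some (v.get i)) := by
  intro ins base hins
  have h1 := hins i
  have h := @big_copy (ins i) base (base + 1)
  refine ⟨copy (ins i) base (base + 1), fun v => ⟨fun v' hb => ?_,
    fun _ => ⟨_, (h (by omega) (by omega) (by omega)).2 rfl⟩⟩⟩
  obtain rfl := (h (by omega) (by omega) (by omega)).1 hb
  refine ⟨by simp, fun r hr => ?_⟩
  rw [Function.update_of_ne (by omega), Function.update_of_ne (by omega)]

theorem computable_succ : Computable (n := 1) (fun v => Part.some v.head.succ) := by
  intro ins base hins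
  have h1 := hins 0
  have h := @big_copy (ins 0) base (base + 1)
  have h' : ∀ v v', Big (seq (copy (ins 0) base (base + 1)) (inc base)) v v' ↔
      v' = Function.update (Function.update (Function.update v base (v (ins 0))) (base + 1) 0) base
        (v (ins 0) + 1) := fun v v' => by
    rw [big_seq]
    simp only [h (by omega : ins 0 ≠ base) (by omega) (by omega : base ≠ base + 1), big_inc,
      exists_eq_left]
    simp
  refine ⟨seq (copy (ins 0) base (base + 1)) (inc base), fun v => ⟨fun v' hb => ?_,
    fun _ => ⟨_, (h' _ _).2 rfl⟩⟩⟩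
  obtain rfl := (h' _ _).1 hb
  refine ⟨by simp [← List.Vector.get_zero], fun r hr => ?_⟩
  rw [Function.update_of_ne (by omega), Function.update_of_ne (by omega),
    Function.update_of_ne (by omega)]

theorem mem_mOfFn {n : ℕ} (g : Fin n → Part ℕ) (y : List.Vector ℕ n) :
    y ∈ List.Vector.mOfFn g ↔ ∀ i, y.get i ∈ g i := by
  induction n with
  | zero =>
    simp only [List.Vector.mOfFn, IsEmpty.forall_iff, iff_true]
    exact Part.mem_some_iff.2 (List.Vector.eq_nil _)
  | succ n ih =>
    simp only [List.Vector.mOfFn, Part.bind_eq_bind, Part.mem_bind_iff, ih, Part.pure_eq_some,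
      Part.mem_some_iff]
    constructor
    · rintro ⟨a, ha, b, hb, rfl⟩ i
      refine Fin.cases ?_ ?_ i
      · simpa using ha
      · intro j; simpa using hb j
    · intro h
      refine ⟨y.head, by simpa using h 0, y.tail, fun i => ?_, by simp⟩
      simpa using h i.succ

/-- The value with index i is computed with all scratch space from `base + i` upwards, so neither
the inputs nor the earlier values are destroyed. -/
theorem exists_prog_of_forall {m : ℕ} {n : ℕ} (g : Fin n → List.Vector ℕ m →. ℕ)
    (hg : ∀ i, Computable (g i)) (ins : Fin m → ℕ) (base : ℕ) (hins : ∀ i, ins i < base) :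
    ∃ p, ∀ v, (∀ v', Big p v v' →
        (∀ i : Fin n, v' (base + i) ∈ g i (List.Vector.ofFn fun i => v (ins i))) ∧
        ∀ r < base, v' r = v r) ∧
      ((∀ i, (g i (List.Vector.ofFn fun i => v (ins i))).Dom) → ∃ v', Big p v v') := by
  induction n with
  | zero => exact ⟨nop, fun v => ⟨fun v' h => by simp [big_nop.1 h], fun _ => ⟨v, .nop v⟩⟩⟩
  | succ n ih =>
    obtain ⟨p, hp⟩ := ih (fun i => g i.castSucc) (fun i => hg _)
    obtain ⟨q, hq⟩ := hg (Fin.last n) ins (base + n) (fun i => by have := hins i; omega)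
    have hv : ∀ v v' : ℕ → ℕ, (∀ r < base, v' r = v r) →
        (List.Vector.ofFn fun i => v' (ins i)) = List.Vector.ofFn fun i => v (ins i) := by
      intro v v' h
      congr 1
      funext i
      exact h _ (hins i)
    refine ⟨seq p q, fun v => ⟨fun v'' h => ?_, fun h => ?_⟩⟩
    · obtain ⟨v', h1, h2⟩ := big_seq.1 h
      have hp' := (hp v).1 v' h1
      have hq' := (hq v').1 v'' h2
      refine ⟨fun i => ?_, fun r hr => by rw [hq'.2 r (by omega), hp'.2 r hr]⟩
      refine Fin.lastCases ?_ (fun j => ?_) i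
      · have := hq'.1
        rw [hv _ _ hp'.2] at this
        simpa using this
      · have := hp'.1 j
        rw [Fin.val_castSucc, hq'.2 _ (by omega)]
        exact this
    · obtain ⟨v', h1⟩ := (hp v).2 fun i => h _
      obtain ⟨v'', h2⟩ := (hq v').2 (by rw [hv _ _ ((hp v).1 v' h1).2]; exact h _)
      exact ⟨v'', .seq h1 h2⟩

/-- The inner values occupy `base + 1`, ..., `base + n`; `f` is computed into `base + 1 + n` and
only then moved to the cleared register `base`. -/
theorem Computable.comp {m n : ℕ} {f : List.Vector ℕ n →. ℕ} (g : Fin n → List.Vector ℕ m →. ℕ)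
    (hf : Computable f) (hg : ∀ i, Computable (g i)) :
    Computable (fun v => (List.Vector.mOfFn fun i => g i v) >>= f) := by
  intro ins base hins
  obtain ⟨p, hp⟩ := exists_prog_of_forall g hg ins (base + 1) (fun i => by have := hins i; omega)
  obtain ⟨q, hq⟩ := hf (fun i => base + 1 + i) (base + 1 + n) (fun i => by omega)
  have hm := @big_move (base + 1 + n) base
  refine ⟨seq p (seq q (seq (clear base) (move (base + 1 + n) base))),
    fun v => ⟨fun v₄ h => ?_, fun h => ?_⟩⟩
  · simp only [big_seq, big_clear, exists_eq_left] at h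
    obtain ⟨v₁, h1, v₂, h2, h3⟩ := h
    obtain rfl := (hm (by omega)).1 h3
    have hp' := (hp v).1 v₁ h1
    have hq' := (hq v₁).1 v₂ h2
    refine ⟨?_, fun r hr => ?_⟩
    · refine Part.mem_bind_iff.2
        ⟨List.Vector.ofFn fun i : Fin n => v₁ (base + 1 + i), (mem_mOfFn _ _).2 fun i => ?_, ?_⟩
      · simpa using hp'.1 i
      · have h0 : base ≠ base + 1 + n := by omega
        simpa [h0, h0.symm] using hq'.1
    · rw [Function.update_of_ne (by omega), Function.update_of_ne (by omega),
        Function.update_of_ne (by omega), hq'.2 r (by omega), hp'.2 r (by omega)]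
  · obtain ⟨z, hz⟩ := Part.dom_iff_mem.1 h
    obtain ⟨y, hy, hz⟩ := Part.mem_bind_iff.1 hz
    rw [mem_mOfFn] at hy
    obtain ⟨v₁, h1⟩ := (hp v).2 fun i => Part.dom_iff_mem.2 ⟨_, hy i⟩
    have hp' := (hp v).1 v₁ h1
    have : (List.Vector.ofFn fun i : Fin n => v₁ (base + 1 + i)) = y := by
      ext i
      rw [List.Vector.get_ofFn]
      exact Part.mem_unique (hp'.1 i) (hy i)
    obtain ⟨v₂, h2⟩ := (hq v₁).2 (by rw [this]; exact Part.dom_iff_mem.2 ⟨z, hz⟩)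
    refine ⟨_, .seq h1 (.seq h2 (.seq (big_clear.2 rfl) ((hm (by omega)).2 rfl)))⟩

/-- Register `base` holds the current value of the recursion, `base + 1` its index, `base + 2` the
number of rounds left, and `base + 3` receives the results of the subprograms. -/
theorem Computable.prec {n : ℕ} {f : List.Vector ℕ n → ℕ} {g : List.Vector ℕ (n + 2) → ℕ}
    (hf : Computable fun v => Part.some (f v)) (hg : Computable fun v => Part.some (g v)) :
    Computable (fun v : List.Vector ℕ (n + 1) => Part.some
      (v.head.rec (f v.tail) fun y IH => g (y ::ᵥ IH ::ᵥ v.tail))) := by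
  intro ins base hins
  have h0 := hins 0
  have hins' : ∀ i : Fin n, ins i.succ < base := fun i => hins _
  obtain ⟨p, hp⟩ := hf (fun i => ins i.succ) (base + 3) (fun i => by have := hins' i; omega)
  obtain ⟨q, hq⟩ := hg (Fin.cons (base + 1) (Fin.cons base fun i => ins i.succ)) (base + 3)
    (fun i => by
      refine Fin.cases (by simp) (fun i => Fin.cases (by simp) (fun i => ?_) i) i
      have := hins' i
      simp only [Fin.cons_succ]
      omega)
  set body : Prog := seq q (seq (clear base) (seq (move (base + 3) base) (inc (base + 1))))
  have hm := @big_move (base + 3) base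
  have hc := @big_copy (ins 0) (base + 2) (base + 3)
  -- Loop invariant: `base` contains the recursion evaluated at the index in `base + 1`. Induction
  -- on the number m of rounds left.
  have hloop : ∀ (m : ℕ) (a : List.Vector ℕ n) (v : ℕ → ℕ), v (base + 2) = m →
      (List.Vector.ofFn fun i => v (ins i.succ)) = a →
      v base = Nat.rec (f a) (fun y IH => g (y ::ᵥ IH ::ᵥ a)) (v (base + 1)) →
      (∃ v', Big (loop (base + 2) body) v v') ∧ ∀ v', Big (loop (base + 2) body) v v' →
        v' base = Nat.rec (f a) (fun y IH => g (y ::ᵥ IH ::ᵥ a)) (v (base + 1) + m) ∧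
        ∀ r < base, v' r = v r := by
    intro m
    induction m with
    | zero =>
      intro a v hv ha hb
      refine ⟨⟨v, .loop_zero hv⟩, fun v' h => ?_⟩
      obtain rfl := (big_loop_zero hv).1 h
      exact ⟨hb, fun _ _ => rfl⟩
    | succ m ih =>
      intro a v hv ha hb
      set u := Function.update v (base + 2) (v (base + 2) - 1)
      have hu : ∀ r, r ≠ base + 2 → u r = v r := fun r hr => Function.update_of_ne hr _ _
      have harg : (List.Vector.ofFn fun i => u (Fin.cons (α := fun _ => ℕ) (base + 1)
          (Fin.cons (α := fun _ => ℕ) base fun i : Fin n => ins i.succ) i))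
          = v (base + 1) ::ᵥ v base ::ᵥ a := by
        rw [← ha]
        simp only [List.Vector.ofFn, Fin.cons_zero, Fin.cons_succ]
        rw [hu _ (by omega), hu _ (by omega)]
        congr 3
        funext i
        exact hu _ (by have := hins' i; omega)
      have hbody : ∀ v', Big body u v' → v' (base + 2) = m ∧
          (∀ r < base, v' r = v r) ∧ v' (base + 1) = v (base + 1) + 1 ∧
          v' base = g (v (base + 1) ::ᵥ v base ::ᵥ a) := by
        intro v' h
        simp only [body, big_seq, big_clear, big_inc, hm (by omega), exists_eq_left] at h
        obtain ⟨u', h1, rfl⟩ := h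
        have hq' := (hq u).1 u' h1
        rw [harg, Part.mem_some_iff] at hq'
        refine ⟨?_, fun r hr => ?_, ?_, ?_⟩
        · simp [hq'.2, u, hv]
        · rw [Function.update_of_ne (by omega), Function.update_of_ne (by omega),
            Function.update_of_ne (by omega), Function.update_of_ne (by omega),
            hq'.2 r (by omega), hu _ (by omega)]
        · simp [hq'.2, u]
        · simp [hq'.1]
      have hex : ∃ v', Big body u v' := by
        obtain ⟨u', h1⟩ := (hq u).2 trivial
        exact ⟨_, .seq h1 (.seq (big_clear.2 rfl) (.seq ((hm (by omega)).2 rfl) (.inc _ _)))⟩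
      have hnext : ∀ v', Big body u v' →
          (List.Vector.ofFn fun i => v' (ins i.succ)) = a ∧
          v' base = Nat.rec (f a) (fun y IH => g (y ::ᵥ IH ::ᵥ a)) (v' (base + 1)) := by
        intro v' h
        obtain ⟨_, h2, h3, h4⟩ := hbody v' h
        refine ⟨?_, ?_⟩
        · rw [← ha]; congr 1; funext i; exact h2 _ (hins' i)
        · rw [h3, h4, hb]
      refine ⟨?_, fun v'' h => ?_⟩
      · obtain ⟨v', h1⟩ := hex
        obtain ⟨⟨v'', h2⟩, _⟩ := ih a v' (hbody v' h1).1 (hnext v' h1).1 (hnext v' h1).2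
        exact ⟨v'', .loop_pos (by omega) h1 h2⟩
      · obtain ⟨v', h1, h2⟩ := (big_loop_pos (by omega)).1 h
        obtain ⟨hb1, hb2, hb3, _⟩ := hbody v' h1
        obtain ⟨h5, h6⟩ := (ih a v' hb1 (hnext v' h1).1 (hnext v' h1).2).2 v'' h2
        refine ⟨?_, fun r hr => by rw [h6 r hr, hb2 r hr]⟩
        rw [h5, hb3, add_right_comm, add_assoc]
  refine ⟨seq p (seq (clear base) (seq (move (base + 3) base) (seq (clear (base + 1))
    (seq (copy (ins 0) (base + 2) (base + 3)) (loop (base + 2) body))))), fun v => ?_⟩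
  have hpre : ∀ u, Big p v u → ∀ w, w = Function.update (Function.update
      (Function.update (Function.update (Function.update (Function.update u base 0) base
      (u (base + 3))) (base + 3) 0) (base + 1) 0) (base + 2) (u (ins 0))) (base + 3) 0 →
      (∀ r < base, w r = v r) ∧ w (base + 1) = 0 ∧ w (base + 2) = v (ins 0) ∧
      w base = f (List.Vector.ofFn fun i => v (ins i.succ)) := by
    rintro u hu w rfl
    have hp' := (hp v).1 u hu
    rw [Part.mem_some_iff] at hp'
    refine ⟨fun r hr => ?_, by simp, by simp [hp'.2 _ (by omega : ins 0 < base + 3)],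
      by simp [hp'.1]⟩
    rw [Function.update_of_ne (by omega), Function.update_of_ne (by omega),
      Function.update_of_ne (by omega), Function.update_of_ne (by omega),
      Function.update_of_ne (by omega), Function.update_of_ne (by omega), hp'.2 r (by omega)]
  have hpre' : ∀ u, Big p v u → ∃ w, (∀ w', Big (seq (clear base) (seq (move (base + 3) base)
      (seq (clear (base + 1)) (copy (ins 0) (base + 2) (base + 3))))) u w' ↔ w' = w) ∧
      (∀ r < base, w r = v r) ∧ w (base + 1) = 0 ∧ w (base + 2) = v (ins 0) ∧
      w base = f (List.Vector.ofFn fun i => v (ins i.succ)) := by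
    intro u hu
    refine ⟨_, fun w' => ?_, hpre u hu _ rfl⟩
    simp only [big_seq, big_clear, hm (by omega : base + 3 ≠ base),
      hc (by omega : ins 0 ≠ base + 2) (by omega) (by omega : base + 2 ≠ base + 3),
      exists_eq_left]
    rw [Function.update_of_ne (by omega : ins 0 ≠ base + 1),
      Function.update_of_ne (by omega : ins 0 ≠ base + 3),
      Function.update_of_ne (by omega : ins 0 ≠ base),
      Function.update_of_ne (by omega : ins 0 ≠ base)]
    simp
  have hl : ∀ w : ℕ → ℕ, (∀ r < base, w r = v r) →
      (List.Vector.ofFn fun i => w (ins i.succ)) = List.Vector.ofFn fun i => v (ins i.succ) := by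
    intro w h
    congr 1
    funext i
    exact h _ (hins' i)
  constructor
  · intro v' h
    simp only [big_seq] at h
    obtain ⟨u, hu, u1, h1, u2, h2, u3, h3, u4, h4, h5⟩ := h
    obtain ⟨w, hw, hw1, hw2, hw3, hw4⟩ := hpre' u hu
    obtain rfl := (hw u4).1 (.seq h1 (.seq h2 (.seq h3 h4)))
    obtain ⟨_, hres⟩ := hloop _ _ u4 hw3 (hl u4 hw1) (hw4.trans (by rw [hw2]; rfl))
    obtain ⟨hr1, hr2⟩ := hres v' h5
    refine ⟨?_, fun r hr => by rw [hr2 r hr, hw1 r hr]⟩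
    rw [Part.mem_some_iff, hr1, hw2, zero_add]
    rfl
  · intro _
    obtain ⟨u, hu⟩ := (hp v).2 trivial
    obtain ⟨w, hw, hw1, hw2, hw3, hw4⟩ := hpre' u hu
    obtain ⟨⟨v', hv'⟩, _⟩ := hloop _ _ w hw3 (hl w hw1) (hw4.trans (by rw [hw2]; rfl))
    have := (hw w).2 rfl
    simp only [big_seq] at this ⊢
    obtain ⟨u1, h1, u2, h2, u3, h3, h4⟩ := this
    exact ⟨v', u, hu, u1, h1, u2, h2, u3, h3, w, h4, hv'⟩

/-- Register `base` holds the candidate and `base + 1` the value of `f` there, which serves as the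
loop condition. The decrement made by the loop is harmless because the body recomputes this value.
-/
theorem Computable.rfind {n : ℕ} {f : List.Vector ℕ (n + 1) → ℕ}
    (hf : Computable fun v => Part.some (f v)) :
    Computable (fun v => Nat.rfind fun n => Part.some (decide (f (n ::ᵥ v) = 0))) := by
  intro ins base hins
  obtain ⟨p, hp⟩ := hf (Fin.cons base ins) (base + 1) (fun i => by
    refine Fin.cases (by simp) (fun i => ?_) i
    have := hins i
    simp only [Fin.cons_succ]
    omega)
  set body : Prog := seq (inc base) p
  have harg : ∀ u : ℕ → ℕ, (List.Vector.ofFn fun i => u (Fin.cons (α := fun _ => ℕ) base ins i))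
      = u base ::ᵥ List.Vector.ofFn fun i => u (ins i) := by
    intro u
    simp [List.Vector.ofFn]
  have hl : ∀ (v w : ℕ → ℕ), (∀ r < base, w r = v r) →
      (List.Vector.ofFn fun i => w (ins i)) = List.Vector.ofFn fun i => v (ins i) := by
    intro v w h
    congr 1
    funext i
    exact h _ (hins i)
  have hp1 : ∀ u u', Big p u u' →
      u' (base + 1) = f (u base ::ᵥ List.Vector.ofFn fun i => u (ins i)) ∧
      u' base = u base ∧ ∀ r < base, u' r = u r := by
    intro u u' h
    have := (hp u).1 u' h
    rw [harg, Part.mem_some_iff] at this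
    exact ⟨this.1, this.2 _ (by omega), fun r hr => this.2 r (by omega)⟩
  have hbody : ∀ v v', Big body (Function.update v (base + 1) (v (base + 1) - 1)) v' →
      v' (base + 1) = f ((v base + 1) ::ᵥ List.Vector.ofFn fun i => v (ins i)) ∧
      v' base = v base + 1 ∧ ∀ r < base, v' r = v r := by
    intro v v' h
    simp only [body, big_seq, big_inc, exists_eq_left] at h
    obtain ⟨h1, h2, h3⟩ := hp1 _ _ h
    have h4 : ∀ r < base, v' r = v r := fun r hr => by
      rw [h3 r hr, Function.update_of_ne (by omega), Function.update_of_ne (by omega)]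
    have h5 : v' base = v base + 1 := by rw [h2]; simp
    refine ⟨?_, h5, h4⟩
    rw [h1, ← h2, h5]
    rw [hl v]
    intro r hr
    rw [← h3 r hr, h4 r hr]
  refine ⟨seq (clear base) (seq p (loop (base + 1) body)), fun v => ?_⟩
  set a := List.Vector.ofFn fun i => v (ins i) with ha
  -- The program is a variable `q` with an equation, so that induction on the derivation of `Big`
  -- applies. The invariant is that no smaller candidate is a root.
  have hsound : ∀ q u u', Big q u u' → q = loop (base + 1) body → (∀ r < base, u r = v r) →
      u (base + 1) = f (u base ::ᵥ a) → (∀ j < u base, f (j ::ᵥ a) ≠ 0) →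
      (f (u' base ::ᵥ a) = 0 ∧ (∀ j < u' base, f (j ::ᵥ a) ≠ 0) ∧ ∀ r < base, u' r = v r) := by
    intro q u u' h
    induction h with
    | nop | inc | seq => intro h; cases h
    | loop_zero h0 =>
      intro h hr h1 h2
      cases h
      exact ⟨by rw [← h1, h0], h2, hr⟩
    | @loop_pos r p' u u1 u2 h0 hb _ _ ih =>
      intro h hr h1 h2
      cases h
      obtain ⟨h3, h4, h5⟩ := hbody u u1 hb
      have h6 : ∀ r < base, u1 r = v r := fun r hr' => by rw [h5 r hr', hr r hr']
      refine ih rfl h6 ?_ ?_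
      · rw [h3, h4, hl v u hr]
      · intro j hj
        rw [h4] at hj
        rcases Nat.lt_succ_iff_lt_or_eq.1 hj with hj | rfl
        · exact h2 j hj
        · rw [← h1]; exact h0
  -- Here d is the distance from the current candidate to a known root; the loop may also stop
  -- earlier.
  have hterm : ∀ (d : ℕ) (u : ℕ → ℕ), (∀ r < base, u r = v r) →
      u (base + 1) = f (u base ::ᵥ a) → f ((u base + d) ::ᵥ a) = 0 →
      ∃ u', Big (loop (base + 1) body) u u' := by
    intro d
    induction d with
    | zero =>
      intro u hr h1 h2
      exact ⟨u, .loop_zero (by rw [h1]; exact h2)⟩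
    | succ d ih =>
      intro u hr h1 h2
      by_cases h0 : u (base + 1) = 0
      · exact ⟨u, .loop_zero h0⟩
      · obtain ⟨u1, hu1⟩ : ∃ u1, Big body (Function.update u (base + 1) (u (base + 1) - 1)) u1 := by
          obtain ⟨u1, h⟩ := (hp _).2 trivial
          exact ⟨u1, .seq (.inc _ _) h⟩
        obtain ⟨h3, h4, h5⟩ := hbody u u1 hu1
        have h6 : ∀ r < base, u1 r = v r := fun r hr' => by rw [h5 r hr', hr r hr']
        obtain ⟨u', hu'⟩ := ih u1 h6 (by rw [h3, h4, hl v u hr])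
          (by rw [h4, add_assoc, add_comm 1 d]; exact h2)
        exact ⟨u', .loop_pos h0 hu1 hu'⟩
  have hstart : ∀ u, Big p (Function.update v base 0) u → (∀ r < base, u r = v r) ∧
      u base = 0 ∧ u (base + 1) = f (u base ::ᵥ a) := by
    intro u hu
    obtain ⟨h1, h2, h3⟩ := hp1 _ _ hu
    have h4 : ∀ r < base, u r = v r := fun r hr => by
      rw [h3 r hr, Function.update_of_ne (by omega)]
    refine ⟨h4, by simpa using h2, ?_⟩
    rw [h1, ← h2]
    rw [hl v]
    intro r hr
    rw [← h3 r hr, h4 r hr]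
  constructor
  · intro v' h
    simp only [big_seq, big_clear, exists_eq_left] at h
    obtain ⟨u, hu, h⟩ := h
    obtain ⟨h1, h2, h3⟩ := hstart u hu
    obtain ⟨h4, h5, h6⟩ := hsound _ _ _ h rfl h1 h3 (by simp [h2])
    refine ⟨Nat.mem_rfind.2 ⟨?_, fun {m} hm => ?_⟩, h6⟩
    · simp [h4]
    · simpa using h5 m hm
  · intro h
    obtain ⟨y, hy⟩ := Part.dom_iff_mem.1 h
    have hy0 := (Nat.mem_rfind.1 hy).1
    obtain ⟨u, hu⟩ := (hp (Function.update v base 0)).2 trivial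
    obtain ⟨h1, h2, h3⟩ := hstart u hu
    obtain ⟨u', hu'⟩ := hterm y u h1 h3 (by simpa [h2] using hy0)
    exact ⟨u', .seq (big_clear.2 rfl) (.seq hu hu')⟩

theorem computable_of_primrec' {n : ℕ} {f : List.Vector ℕ n → ℕ} (hf : Nat.Primrec' f) :
    Computable fun v => Part.some (f v) := by
  induction hf with
  | zero => exact computable_zero
  | succ => exact computable_succ
  | get i => exact computable_get i
  | @comp m n f g _ _ ihf ihg =>
    have := Computable.comp (fun i v => Part.some (g i v)) ihf ihg
    have h2 : ∀ v, (List.Vector.mOfFn fun i => Part.some (g i v))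
        = Part.some (List.Vector.ofFn fun i => g i v) := fun v => List.Vector.mOfFn_pure _
    simpa [h2] using this
  | prec _ _ ihf ihg => exact ihf.prec ihg

theorem computable_of_partrec' {n : ℕ} {f : List.Vector ℕ n →. ℕ} (hf : Nat.Partrec' f) :
    Computable f := by
  induction hf with
  | prim h => exact computable_of_primrec' h
  | comp g _ _ ihf ihg => exact Computable.comp g ihf ihg
  | rfind _ ih => exact Computable.rfind ih

end Prog

end MeanPayoff

namespace MeanPayoff

namespace Prog

/-! ### Small steps -/

/-- One step of the execution of a list of programs, which are run one after the other. -/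
def step : List Prog × (ℕ → ℕ) → List Prog × (ℕ → ℕ)
  | ([], v) => ([], v)
  | (nop :: l, v) => (l, v)
  | (inc r :: l, v) => (l, Function.update v r (v r + 1))
  | (seq p q :: l, v) => (p :: q :: l, v)
  | (loop r p :: l, v) =>
      if v r = 0 then (l, v) else (p :: loop r p :: l, Function.update v r (v r - 1))

theorem Big.exists_steps {p v v'} (h : Big p v v') (l : List Prog) :
    ∃ i, step^[i] (p :: l, v) = (l, v') := by
  induction h generalizing l with
  | nop | inc => exact ⟨1, rfl⟩
  | @seq p q _ _ _ _ _ ih₁ ih₂ =>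
    obtain ⟨i, hi⟩ := ih₁ (q :: l)
    obtain ⟨j, hj⟩ := ih₂ l
    refine ⟨j + (i + 1), ?_⟩
    rw [Function.iterate_add_apply, Function.iterate_succ_apply, step, hi, hj]
  | loop_zero h => exact ⟨1, by simp [step, h]⟩
  | @loop_pos r p _ _ _ h _ _ ih₁ ih₂ =>
    obtain ⟨i, hi⟩ := ih₁ (loop r p :: l)
    obtain ⟨j, hj⟩ := ih₂ l
    refine ⟨j + (i + 1), ?_⟩
    rw [Function.iterate_add_apply, Function.iterate_succ_apply, step, if_neg h, hi, hj]

/-- A terminating run of `p :: l` is cut where `p` is finished. For `seq` and `loop` it is cut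
twice, and the strict inequality on the number of remaining steps makes the second cut an instance
of the strong induction. -/
theorem exists_big_of_steps (i : ℕ) : ∀ p l v, (step^[i] (p :: l, v)).1 = [] →
    ∃ v', Big p v v' ∧ ∃ j < i, (step^[j] (l, v')).1 = [] := by
  induction i using Nat.strong_induction_on with
  | _ i ih =>
    intro p l v h
    obtain _ | i := i
    · simp at h
    rw [Function.iterate_succ_apply] at h
    cases p with
    | nop => exact ⟨v, .nop v, i, by omega, h⟩
    | inc r => exact ⟨_, .inc r v, i, by omega, h⟩
    | seq p q =>
      obtain ⟨v₁, hb₁, j₁, hj₁, h₁⟩ := ih i (by omega) _ _ _ h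
      obtain ⟨v₂, hb₂, j₂, hj₂, h₂⟩ := ih j₁ (by omega) _ _ _ h₁
      exact ⟨v₂, .seq hb₁ hb₂, j₂, by omega, h₂⟩
    | loop r p =>
      by_cases h0 : v r = 0
      · simp only [step, if_pos h0] at h
        exact ⟨v, .loop_zero h0, i, by omega, h⟩
      · simp only [step, if_neg h0] at h
        obtain ⟨v₁, hb₁, j₁, hj₁, h₁⟩ := ih i (by omega) _ _ _ h
        obtain ⟨v₂, hb₂, j₂, hj₂, h₂⟩ := ih j₁ (by omega) _ _ _ h₁
        exact ⟨v₂, .loop_pos h0 hb₁ hb₂, j₂, by omega, h₂⟩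

theorem halts_iff {p v} : (∃ i, (step^[i] ([p], v)).1 = []) ↔ ∃ v', Big p v v' := by
  constructor
  · rintro ⟨i, hi⟩
    obtain ⟨v', h, _⟩ := exists_big_of_steps i _ _ _ hi
    exact ⟨v', h⟩
  · rintro ⟨v', h⟩
    obtain ⟨i, hi⟩ := h.exists_steps []
    exact ⟨i, by rw [hi]⟩

/-- The lists of programs that occur while `p` is run before `l`. -/
def conts : Prog → List Prog → Set (List Prog)
  | nop, l => {nop :: l}
  | inc r, l => {inc r :: l}
  | seq p q, l => {seq p q :: l} ∪ (conts p (q :: l) ∪ conts q l)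
  | loop r p, l => {loop r p :: l} ∪ conts p (loop r p :: l)

/-- There is no recursion in programs, so the stack of pending programs is determined by a place in
the syntax tree; this gives finite control. -/
theorem finite_conts (p : Prog) (l : List Prog) : (conts p l).Finite := by
  induction p generalizing l with
  | nop | inc => exact Set.finite_singleton _
  | seq p q ihp ihq => exact (Set.finite_singleton _).union ((ihp _).union (ihq _))
  | loop r p ih => exact (Set.finite_singleton _).union (ih _)

theorem cons_mem_conts (p : Prog) (l : List Prog) : p :: l ∈ conts p l := by
  cases p <;> simp [conts]

/-- The list that follows a nonempty list of programs; `b` tells whether the register that is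
tested is positive. -/
def next : List Prog → Bool → List Prog
  | [], _ => []
  | nop :: l, _ => l
  | inc _ :: l, _ => l
  | seq p q :: l, _ => p :: q :: l
  | loop r p :: l, b => if b then p :: loop r p :: l else l

theorem next_mem_conts (p : Prog) (b : Bool) (l l' : List Prog) (h : l' ∈ conts p l) :
    next l' b ∈ conts p l ∨ next l' b = l := by
  induction p generalizing l l' with
  | nop | inc => simp only [conts, Set.mem_singleton_iff] at h; subst h; simp [next]
  | seq p q ihp ihq =>
    rcases h with h | h | h
    · rw [Set.mem_singleton_iff] at h
      subst h
      exact .inl (.inr (.inl (cons_mem_conts _ _)))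
    · rcases ihp _ _ h with h | h
      · exact .inl (.inr (.inl h))
      · exact .inl (.inr (.inr (h ▸ cons_mem_conts _ _)))
    · exact (ihq _ _ h).imp_left fun h => .inr (.inr h)
  | loop r p ih =>
    rcases h with h | h
    · rw [Set.mem_singleton_iff] at h
      subst h
      cases b
      · exact .inr rfl
      · exact .inl (.inr (cons_mem_conts _ _))
    · rcases ih _ _ h with h | h
      · exact .inl (.inr h)
      · exact .inl (.inl h)

/-- The register that the first program of a list uses. -/
def headReg : List Prog → ℕ
  | inc r :: _ => r
  | loop r _ :: _ => r
  | _ => 0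

/-- The change of register `r` in a step. -/
def change : List Prog → Bool → ℕ → ℤ
  | inc r₀ :: _, _, r => if r = r₀ then 1 else 0
  | loop r₀ _ :: _, b, r => if b ∧ r = r₀ then -1 else 0
  | _, _, _ => 0

/-- The first program of the list branches on the fact that the register `r` is zero. -/
def TestsZero : List Prog → Bool → ℕ → Prop
  | loop r₀ _ :: _, b, r => b = false ∧ r = r₀
  | _, _, _ => False

/-- Whether the register that is tested is positive. -/
def bit : List Prog × (ℕ → ℕ) → Bool
  | (loop r _ :: _, v) => decide (v r ≠ 0)
  | _ => false

theorem step_fst (x : List Prog × (ℕ → ℕ)) : (step x).1 = next x.1 (bit x) := by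
  rcases x with ⟨_ | ⟨_ | _ | _ | ⟨r, p⟩, l⟩, v⟩ <;> simp [step, next, bit]
  split_ifs <;> rfl

theorem step_snd (x : List Prog × (ℕ → ℕ)) (r : ℕ) :
    ((step x).2 r : ℤ) = x.2 r + change x.1 (bit x) r := by
  rcases x with ⟨_ | ⟨_ | r₀ | _ | ⟨r₀, p⟩, l⟩, v⟩ <;> simp [step, change, bit]
  · by_cases h : r = r₀
    · subst h; simp
    · simp [h]
  · by_cases h0 : v r₀ = 0
    · simp [h0]
    · by_cases h : r = r₀
      · subst h; simp [h0]; omega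
      · simp [h0, h]

theorem testsZero_bit {x : List Prog × (ℕ → ℕ)} {r : ℕ} (h : TestsZero x.1 (bit x) r) :
    x.2 r = 0 := by
  rcases x with ⟨_ | ⟨_ | r₀ | _ | ⟨r₀, p⟩, l⟩, v⟩ <;> simp [TestsZero, bit] at h
  obtain ⟨h, rfl⟩ := h
  exact h

/-- A guessed branch is forced to be the right one: guessing "zero" requires the register to be
zero, and guessing "positive" decrements it and would make it negative. Only the register tested by
the head matters. -/
theorem eq_bit {x : List Prog × (ℕ → ℕ)} {b : Bool}
    (h₀ : TestsZero x.1 b (headReg x.1) → x.2 (headReg x.1) = 0)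
    (h₁ : 0 ≤ (x.2 (headReg x.1) : ℤ) + change x.1 b (headReg x.1)) :
    next x.1 b = next x.1 (bit x) ∧ ∀ r, change x.1 b r = change x.1 (bit x) r := by
  rcases x with ⟨_ | ⟨_ | r₀ | _ | ⟨r₀, p⟩, l⟩, v⟩
  · simp [next, change]
  · simp [next, change]
  · simp [next, change]
  · simp [next, change]
  · have : b = bit (loop r₀ p :: l, v) := by
      cases b
      · simpa [TestsZero, headReg, bit] using h₀
      · simp [headReg, change] at h₁
        simp only [bit]
        rw [eq_comm, decide_eq_true_iff]
        omega
    subst this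
    exact ⟨rfl, fun _ => rfl⟩

end Prog

/-! ### Counter systems -/

/-- A system with counters `R` and tags `T`. A tag stands for a control state together with the
choice of a transition from it. -/
structure CounterSystem (T R : Type) where
  init : T → Prop
  final : T → Prop
  compat : T → T → Prop
  delta : T → R → ℤ
  zero : T → R → Prop
  input : R → ℤ
  abs_delta_le : ∀ τ r, |delta τ r| ≤ 1
  input_nonneg : ∀ r, 0 ≤ input r
  input_le : ∀ r, input r ≤ 1

namespace CounterSystem

variable {T R : Type}

/-- `τ` and `c` are the tags and the counters in the first `m` steps of an execution that starts
with `n` in the input counters. -/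
structure IsTrace (M : CounterSystem T R) (n : ℕ) (τ : ℕ → T) (c : ℕ → R → ℤ) (m : ℕ) : Prop where
  init : M.init (τ 0)
  start : ∀ r, c 0 r = n * M.input r
  compat : ∀ i < m, M.compat (τ i) (τ (i + 1))
  step : ∀ i < m, ∀ r, c (i + 1) r = c i r + M.delta (τ i) r
  nonneg : ∀ i ≤ m, ∀ r, 0 ≤ c i r
  zero : ∀ i ≤ m, ∀ r, M.zero (τ i) r → c i r = 0

def Accepts (M : CounterSystem T R) (n : ℕ) : Prop :=
  ∃ m τ c, M.IsTrace n τ c m ∧ M.final (τ m)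

def HasTrace (M : CounterSystem T R) (n m : ℕ) : Prop :=
  ∃ τ c, M.IsTrace n τ c m

end CounterSystem

namespace Prog

/-- The continuations of `p`, including the end of the program. -/
abbrev States (p : Prog) : Type := {l : List Prog // l ∈ conts p [] ∪ {[]}}

/-- The counter system that executes `p` on `k` registers. -/
def toSystem (p : Prog) (k : ℕ) : CounterSystem (States p × Bool) (Fin k) where
  init τ := τ.1.1 = [p]
  final τ := τ.1.1 = []
  compat τ τ' := τ.1.1 ≠ [] ∧ τ'.1.1 = next τ.1.1 τ.2
  delta τ r := change τ.1.1 τ.2 r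
  zero τ r := TestsZero τ.1.1 τ.2 r
  input r := if (r : ℕ) = 0 then 1 else 0
  abs_delta_le τ r := by
    rcases τ with ⟨⟨_ | ⟨_ | _ | _ | _, _⟩, _⟩, _⟩ <;> simp only [change] <;>
      first | (split_ifs <;> simp) | simp
  input_nonneg r := by split_ifs <;> simp
  input_le r := by split_ifs <;> simp

/-- The registers at the start, with input `n`. -/
def inputRegs (n : ℕ) : ℕ → ℕ := fun r => if r = 0 then n else 0

theorem steps_mem (p : Prog) (v : ℕ → ℕ) (i : ℕ) :
    (step^[i] ([p], v)).1 ∈ conts p [] ∪ {[]} := by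
  induction i with
  | zero => exact .inl (cons_mem_conts _ _)
  | succ i ih =>
    rw [Function.iterate_succ_apply', step_fst]
    rcases ih with h | h
    · exact next_mem_conts p _ _ _ h
    · rw [Set.mem_singleton_iff] at h
      rw [h]
      exact .inr rfl

/-- The real execution, tagged with the branches it takes, is a trace. It must not have ended before
step m, since `compat` forbids leaving the empty continuation. -/
theorem exists_isTrace (p : Prog) (k n m : ℕ)
    (hm : ∀ i < m, (step^[i] ([p], inputRegs n)).1 ≠ []) :
    ∃ τ c, (p.toSystem k).IsTrace n τ c m ∧
      ∀ i, (τ i).1.1 = (step^[i] ([p], inputRegs n)).1 := by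
  set x := fun i => step^[i] ([p], inputRegs n) with hx
  have hsucc : ∀ i, x (i + 1) = step (x i) := fun i => Function.iterate_succ_apply' _ _ _
  refine ⟨fun i => (⟨(x i).1, steps_mem p _ i⟩, bit (x i)), fun i r => ((x i).2 r : ℤ), ?_,
    fun i => rfl⟩
  constructor
  · rfl
  · intro r
    simp only [toSystem, x, inputRegs, Function.iterate_zero, id_eq]
    split_ifs <;> simp
  · exact fun i hi => ⟨hm i hi, by simp only [hsucc]; exact step_fst _⟩
  · intro i hi r
    simp only [hsucc]
    exact step_snd _ _
  · intro i hi r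
    positivity
  · intro i hi r h
    exact_mod_cast testsZero_bit h

/-- By `eq_bit` the system has no real choice. The bound on `headReg` ensures that every tested
register is among the k counters, so that the zero and sign conditions on it are available. -/
theorem IsTrace.eq_steps {p : Prog} {k n m : ℕ} (hk : ∀ l ∈ conts p [] ∪ {[]}, headReg l < k)
    {τ : ℕ → States p × Bool} {c : ℕ → Fin k → ℤ} (h : (p.toSystem k).IsTrace n τ c m) :
    ∀ i ≤ m, (τ i).1.1 = (step^[i] ([p], inputRegs n)).1 ∧
      ∀ r, c i r = (step^[i] ([p], inputRegs n)).2 r := by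
  intro i
  induction i with
  | zero =>
    refine fun _ => ⟨h.init, fun r => ?_⟩
    rw [h.start]
    simp only [toSystem, inputRegs, Function.iterate_zero, id_eq]
    split_ifs <;> simp
  | succ i ih =>
    intro hi
    obtain ⟨h1, h2⟩ := ih (by omega)
    set x := step^[i] ([p], inputRegs n)
    have hr : headReg x.1 < k := hk _ (steps_mem p _ i)
    have hstep := h.step i (by omega)
    obtain ⟨h3, h4⟩ := @eq_bit x (τ i).2 (fun h0 => by
        have := h.zero i (by omega) ⟨_, hr⟩ (by simpa [toSystem, h1] using h0)
        rw [h2] at this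
        exact_mod_cast this) (by
        have := h.nonneg (i + 1) hi ⟨_, hr⟩
        rw [hstep, h2] at this
        simpa [toSystem, h1] using this)
    rw [Function.iterate_succ_apply', step_fst]
    refine ⟨?_, fun r => ?_⟩
    · rw [(h.compat i (by omega)).2, h1, h3]
    · rw [hstep, h2, step_snd, ← h4]
      simp only [toSystem, h1]
      rfl

end Prog

open Prog in
/-- There is a finite counter system whose halting problem is undecidable. -/
theorem exists_undecidable_counterSystem :
    ∃ (T : Type) (_ : Finite T) (k : ℕ) (M : CounterSystem T (Fin k)) (H : ℕ → Prop),
      ¬ ComputablePred H ∧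
      (∀ n, H n → M.Accepts n ∧ ∃ m, ¬ M.HasTrace n m) ∧
      ∀ n, ¬ H n → ¬ M.Accepts n ∧ ∀ m, M.HasTrace n m := by
  -- A single partial recursive function with undecidable domain: the input is a code, which is run
  -- on 0.
  set f : ℕ →. ℕ := fun e => (Denumerable.ofNat Nat.Partrec.Code e).eval 0 with hf
  have hfp : Partrec f :=
    Nat.Partrec.Code.eval_part.comp (Computable.ofNat _) (Computable.const 0)
  obtain ⟨p, hp⟩ := computable_of_partrec' (Nat.Partrec'.part_iff₁.2 hfp) (fun _ => 0) 1
    (fun _ => Nat.one_pos)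
  have hfin : (conts p [] ∪ {[]}).Finite := (finite_conts p []).union (Set.finite_singleton _)
  obtain ⟨k, hk⟩ := (hfin.image headReg).bddAbove
  have hk' : ∀ l ∈ conts p [] ∪ {[]}, headReg l < k + 1 := fun l hl =>
    Nat.lt_succ_of_le (hk (Set.mem_image_of_mem _ hl))
  have hH : ∀ n, (∃ i, (step^[i] ([p], inputRegs n)).1 = []) ↔ (f n).Dom := by
    intro n
    rw [halts_iff]
    have h := hp (inputRegs n)
    have hv : (List.Vector.ofFn fun _ : Fin 1 => inputRegs n 0).head = n := by
      simp [inputRegs, List.Vector.ofFn]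
    change (∀ v', Big p (inputRegs n) v' →
        v' 1 ∈ f (List.Vector.ofFn fun _ : Fin 1 => inputRegs n 0).head ∧
          ∀ r < 1, v' r = inputRegs n r) ∧
      ((f (List.Vector.ofFn fun _ : Fin 1 => inputRegs n 0).head).Dom →
        ∃ v', Big p (inputRegs n) v') at h
    rw [hv] at h
    exact ⟨fun ⟨v', h'⟩ => Part.dom_iff_mem.2 ⟨_, (h.1 v' h').1⟩, h.2⟩
  refine ⟨States p × Bool, ?_, k + 1, p.toSystem (k + 1), fun n => (f n).Dom, ?_, ?_, ?_⟩
  · have : Finite (States p) := hfin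
    infer_instance
  · intro h
    refine ComputablePred.halting_problem 0 ?_
    obtain ⟨g, hg, hg'⟩ := ComputablePred.computable_iff.1 h
    refine ComputablePred.computable_iff.2 ⟨fun c => g (Encodable.encode c),
      hg.comp Computable.encode, ?_⟩
    funext c
    have := congrFun hg' (Encodable.encode c)
    simpa [f] using this
  · intro n h
    have hex := (hH n).2 h
    classical
    have h0 := Nat.find_spec hex
    refine ⟨?_, Nat.find hex + 1, ?_⟩
    · obtain ⟨τ, c, ht, hτ⟩ := exists_isTrace p (k + 1) n (Nat.find hex)
        (fun i hi => Nat.find_min hex hi)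
      exact ⟨_, τ, c, ht, (hτ _).trans h0⟩
    · rintro ⟨τ, c, ht⟩
      have h1 := (IsTrace.eq_steps hk' ht (Nat.find hex) (by omega)).1
      -- A trace one step longer would have to continue after the end of the program.
      exact (ht.compat (Nat.find hex) (by omega)).1 (h1.trans h0)
  · intro n h
    replace h := not_exists.1 (mt (hH n).1 h)
    refine ⟨?_, fun m => ?_⟩
    · rintro ⟨m, τ, c, ht, hf⟩
      exact h m ((IsTrace.eq_steps hk' ht m le_rfl).1.symm.trans hf)
    · obtain ⟨τ, c, ht, _⟩ := exists_isTrace p (k + 1) n m (fun i _ => h i)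
      exact ⟨τ, c, ht⟩

end MeanPayoff

namespace MeanPayoff

/-! ### The automaton that detects wrong executions -/

/-- Letters of the words that describe executions: each configuration is written as a letter
`start τ` followed by copies of the letters `sym none`, whose number is the unit of the
configuration, and `sym (some r)`, whose number is the value of the counter `r` times the unit. -/
inductive Letter (T R : Type) : Type
  | mark
  | start (τ : T)
  | sym (x : Option R)

/-- The conditions on a block that can be tested. -/
inductive Check (T R : Type) : Type
  | null
  | len
  | init (r : R) (s : Bool)
  | compat (τ : T)
  | ending (τ : T)
  | zero (r : R)
  | unit (s : Bool)
  | reg (τ : T) (r : R) (s : Bool)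
deriving Fintype

/-- States of the detector. In `first κ` and `second κ` it tests the condition `κ` and reads the
first or a later configuration that the condition is about. -/
inductive State (T R : Type) : Type
  | begin
  | idle
  | first (κ : Check T R)
  | second (κ : Check T R)
  | sink
  | dead
deriving Fintype

instance (T R : Type) [Fintype T] [Fintype R] : Finite (Letter T R) :=
  Finite.of_surjective (fun x : Option (T ⊕ Option R) => match x with
    | none => .mark
    | some (.inl τ) => .start τ
    | some (.inr x) => .sym x) (by
      rintro (_ | τ | x)
      · exact ⟨none, rfl⟩
      · exact ⟨some (.inl τ), rfl⟩
      · exact ⟨some (.inr x), rfl⟩)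

/-- The sign that is coded by a truth value. -/
def sgn (s : Bool) : ℤ := if s then 1 else -1

/-- A counter system with an input, the set `accept` of the tags with which a block may end, and the
weight `price` of the end of a block. -/
structure Detector (T R : Type) where
  sys : CounterSystem T R
  input : ℕ
  price : ℤ
  accept : T → Prop

namespace Detector

variable {T R : Type} (D : Detector T R)

/-- A bound for the ratio of the length of an execution to its first unit. -/
noncomputable def ratio (_ : Detector T R) (n : ℕ) : ℕ := 4 + 2 * Nat.card R * (n + 1)

open Classical in
/-- Weights in the first configuration of a test. -/
noncomputable def weight₁ : Check T R → Option R → ℤ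
  | .len, none => 1 - D.ratio D.input
  | .len, some _ => 1
  | .init r s, none => sgn s * (D.input * D.sys.input r)
  | .init r s, some r' => if r' = r then -sgn s else 0
  | .compat _, none => 1
  | .ending _, none => 1
  | .zero r, some r' => if r' = r then 1 else 0
  | .unit s, none => -sgn s
  | .reg τ r s, none => -sgn s * D.sys.delta τ r
  | .reg _ r s, some r' => if r' = r then -sgn s else 0
  | _, _ => 0

open Classical in
/-- Weights after the first configuration of a test. -/
noncomputable def weight₂ : Check T R → Option R → ℤ
  | .len, _ => 1
  | .unit s, none => 2 * sgn s
  | .reg _ r s, some r' => if r' = r then 2 * sgn s else 0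
  | _, _ => 0

/-- Weight of the letters `start` during a test. -/
def startWeight : Check T R → ℤ
  | .len => 1
  | _ => 0

/-- The test that follows the second configuration. -/
def after : Check T R → Check T R
  | .len => .len
  | _ => .null

/-- The test `κ` may begin at a configuration with tag `τ`. -/
def Enter : Check T R → T → (isFirst : Prop) → Prop
  | .null, _, _ => False
  | .len, _, b => b
  | .init _ _, _, b => b
  | .compat τ', τ, _ => τ' = τ
  | .ending τ', τ, _ => τ' = τ ∧ ¬ D.accept τ
  | .zero r, τ, _ => D.sys.zero τ r
  | .unit _, _, _ => True
  | .reg τ' _ _, τ, _ => τ' = τ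

/-- The test `κ` goes on if the next configuration has tag `τ`. -/
def NextOK : Check T R → T → Prop
  | .compat τ', τ => ¬ D.sys.compat τ' τ
  | .ending _, _ => False
  | _, _ => True

/-- The test `κ` is passed if the block ends after its first configuration. -/
def MarkOK : Check T R → Prop
  | .compat _ => False
  | .unit _ => False
  | .reg _ _ _ => False
  | _ => True

open State Letter in
open Classical in
/-- The usual transitions. -/
noncomputable def usual : State T R → Letter T R → State T R × ℤ
  | begin, mark => (begin, D.price + 1)
  | begin, _ => (idle, 0)
  | idle, mark => (begin, D.price)
  | idle, _ => (idle, 0)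
  | first κ, sym x => (first κ, D.weight₁ κ x)
  | first κ, start τ => if D.NextOK κ τ then (second κ, startWeight κ) else (dead, -1)
  | first κ, mark => if MarkOK κ then (begin, D.price) else (dead, -1)
  | second κ, sym x => (second κ, weight₂ κ x)
  | second κ, start _ => (second (after κ), startWeight κ)
  | second _, mark => (begin, D.price)
  | sink, mark => (dead, -1)
  | sink, _ => (sink, 1)
  | dead, _ => (dead, -1)

open State Letter in
/-- The transitions with their weights. -/
inductive Step : State T R → Letter T R → State T R → ℤ → Prop
  | usual (q a) : Step q a (D.usual q a).1 (D.usual q a).2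
  | sink_of_begin (a) : a ≠ mark → Step begin a sink 1
  | sink_of_idle (a) : a ≠ mark → Step idle a sink 1
  | enter_of_begin (κ τ) : D.Enter κ τ True → Step begin (start τ) (first κ) (startWeight κ)
  | enter_of_idle (κ τ) : D.Enter κ τ False → Step idle (start τ) (first κ) (startWeight κ)
  | bad_start (τ) : ¬ D.sys.init τ → Step begin (start τ) (second .len) 1
  | bad_sym (x) : Step begin (sym x) (second .len) 1

variable {D}

open State Letter

theorem step_begin_mark {q c} : D.Step begin mark q c ↔ q = begin ∧ c = D.price + 1 := by
  constructor
  · rintro (_ | ⟨_, h⟩); exacts [⟨rfl, rfl⟩, absurd rfl h]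
  · rintro ⟨rfl, rfl⟩; exact .usual _ _

theorem step_idle_mark {q c} : D.Step idle mark q c ↔ q = begin ∧ c = D.price := by
  constructor
  · rintro (_ | _ | ⟨_, h⟩); exacts [⟨rfl, rfl⟩, absurd rfl h]
  · rintro ⟨rfl, rfl⟩; exact .usual _ _

theorem step_first {κ a q c} :
    D.Step (first κ) a q c ↔ q = (D.usual (first κ) a).1 ∧ c = (D.usual (first κ) a).2 := by
  constructor
  · rintro ⟨⟩; exact ⟨rfl, rfl⟩
  · rintro ⟨rfl, rfl⟩; exact .usual _ _

theorem step_second {κ a q c} :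
    D.Step (second κ) a q c ↔ q = (D.usual (second κ) a).1 ∧ c = (D.usual (second κ) a).2 := by
  constructor
  · rintro ⟨⟩; exact ⟨rfl, rfl⟩
  · rintro ⟨rfl, rfl⟩; exact .usual _ _

theorem step_sink {a q c} :
    D.Step sink a q c ↔ q = (D.usual sink a).1 ∧ c = (D.usual sink a).2 := by
  constructor
  · rintro ⟨⟩; exact ⟨rfl, rfl⟩
  · rintro ⟨rfl, rfl⟩; exact .usual _ _

theorem step_dead {a q c} : D.Step dead a q c ↔ q = dead ∧ c = -1 := by
  constructor
  · rintro ⟨⟩; exact ⟨rfl, rfl⟩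
  · rintro ⟨rfl, rfl⟩; exact .usual _ _

theorem step_idle_sym {x q c} :
    D.Step idle (sym x) q c ↔ (q = idle ∧ c = 0) ∨ (q = sink ∧ c = 1) := by
  constructor
  · rintro (_ | _ | h); exacts [.inl ⟨rfl, rfl⟩, .inr ⟨rfl, rfl⟩]
  · rintro (⟨rfl, rfl⟩ | ⟨rfl, rfl⟩)
    exacts [.usual _ _, .sink_of_idle _ (by simp)]

theorem step_idle_start {τ q c} : D.Step idle (start τ) q c ↔ (q = idle ∧ c = 0) ∨
    (q = sink ∧ c = 1) ∨ ∃ κ, D.Enter κ τ False ∧ q = first κ ∧ c = startWeight κ := by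
  constructor
  · rintro (_ | _ | _ | _ | ⟨_, _, h⟩)
    exacts [.inl ⟨rfl, rfl⟩, .inr (.inl ⟨rfl, rfl⟩), .inr (.inr ⟨_, h, rfl, rfl⟩)]
  · rintro (⟨rfl, rfl⟩ | ⟨rfl, rfl⟩ | ⟨κ, h, rfl, rfl⟩)
    exacts [.usual _ _, .sink_of_idle _ (by simp), .enter_of_idle _ _ h]

theorem step_begin_start {τ q c} (hτ : D.sys.init τ) : D.Step begin (start τ) q c ↔
    (q = idle ∧ c = 0) ∨ (q = sink ∧ c = 1) ∨
      ∃ κ, D.Enter κ τ True ∧ q = first κ ∧ c = startWeight κ := by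
  constructor
  · rintro (_ | _ | _ | ⟨_, _, h⟩ | _ | ⟨_, h⟩)
    exacts [.inl ⟨rfl, rfl⟩, .inr (.inl ⟨rfl, rfl⟩), .inr (.inr ⟨_, h, rfl, rfl⟩), absurd hτ h]
  · rintro (⟨rfl, rfl⟩ | ⟨rfl, rfl⟩ | ⟨κ, h, rfl, rfl⟩)
    exacts [.usual _ _, .sink_of_begin _ (by simp), .enter_of_begin _ _ h]

theorem step_mark {q q' c} (h : D.Step q mark q' c) : q' = begin ∨ q' = dead := by
  rcases q with _ | _ | κ | κ | _ | _
  · exact .inl (step_begin_mark.1 h).1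
  · exact .inl (step_idle_mark.1 h).1
  · rw [(step_first.1 h).1]
    simp only [usual]
    split_ifs <;> simp
  · exact .inl (step_second.1 h).1
  · exact .inr (step_sink.1 h).1
  · exact .inr (step_dead.1 h).1

theorem Enter.startWeight {κ : Check T R} {τ : T} (h : D.Enter κ τ False) : startWeight κ = 0 := by
  cases κ <;> first | rfl | exact h.elim

/-- A transition of a weighted automaton carries one weight, so the relation `Step` must be
functional in its last argument before it can become one. -/
theorem Step.unique {q a q' c c'} (h : D.Step q a q' c) (h' : D.Step q a q' c') : c = c' := by
  rcases q with _ | _ | κ | κ | _ | _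
  · rcases a with _ | τ | x
    · rw [(step_begin_mark.1 h).2, (step_begin_mark.1 h').2]
    · generalize hq : (begin : State T R) = q at h h'
      generalize ha : start τ = a at h h'
      cases h <;> cases hq <;> cases ha <;> cases h' <;> rfl
    · generalize hq : (begin : State T R) = q at h h'
      generalize ha : sym x = a at h h'
      cases h <;> cases hq <;> cases ha <;> cases h' <;> rfl
  · rcases a with _ | τ | x
    · rw [(step_idle_mark.1 h).2, (step_idle_mark.1 h').2]
    · rcases step_idle_start.1 h with ⟨h1, h2⟩ | ⟨h1, h2⟩ | ⟨κ, _, h1, h2⟩ <;>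
      rcases step_idle_start.1 h' with ⟨h3, h4⟩ | ⟨h3, h4⟩ | ⟨κ', _, h3, h4⟩ <;> simp_all
    · rcases step_idle_sym.1 h with ⟨h1, h2⟩ | ⟨h1, h2⟩ <;>
      rcases step_idle_sym.1 h' with ⟨h3, h4⟩ | ⟨h3, h4⟩ <;> simp_all
  · rw [(step_first.1 h).2, (step_first.1 h').2]
  · rw [(step_second.1 h).2, (step_second.1 h').2]
  · rw [(step_sink.1 h).2, (step_sink.1 h').2]
  · rw [(step_dead.1 h).2, (step_dead.1 h').2]

end Detector

/-! ### Finite paths -/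

/-- `Path S m q l q' s`: some sequence of transitions of the relation `S`, of weights at least `m`
and of total weight `s`, leads from `q` to `q'` over the finite word `l`. -/
inductive Path {Q A : Type} (S : Q → A → Q → ℤ → Prop) (m : ℤ) : Q → List A → Q → ℤ → Prop
  | nil (q) : Path S m q [] q 0
  | cons {q a q' c l q'' s} : S q a q' c → m ≤ c → Path S m q' l q'' s →
      Path S m q (a :: l) q'' (c + s)

namespace Path

variable {Q A : Type} {S : Q → A → Q → ℤ → Prop} {m : ℤ}

theorem nil_iff {q q' s} : Path S m q [] q' s ↔ q' = q ∧ s = 0 := by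
  constructor
  · rintro ⟨⟩; exact ⟨rfl, rfl⟩
  · rintro ⟨rfl, rfl⟩; exact .nil _

theorem cons_iff {q a l q'' s} : Path S m q (a :: l) q'' s ↔
    ∃ q' c, S q a q' c ∧ m ≤ c ∧ Path S m q' l q'' (s - c) := by
  constructor
  · rintro (_ | ⟨h1, h2, h3⟩)
    exact ⟨_, _, h1, h2, by rwa [add_sub_cancel_left]⟩
  · rintro ⟨q', c, h1, h2, h3⟩
    have := Path.cons h1 h2 h3
    rwa [add_sub_cancel] at this

theorem append_iff {q l₁ l₂ q'' s} : Path S m q (l₁ ++ l₂) q'' s ↔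
    ∃ q' s₁, Path S m q l₁ q' s₁ ∧ Path S m q' l₂ q'' (s - s₁) := by
  induction l₁ generalizing q s with
  | nil =>
    simp only [List.nil_append, nil_iff]
    constructor
    · exact fun h => ⟨q, 0, ⟨rfl, rfl⟩, by rwa [sub_zero]⟩
    · rintro ⟨_, _, ⟨rfl, rfl⟩, h⟩
      rwa [sub_zero] at h
  | cons a l ih =>
    simp only [List.cons_append, cons_iff, ih]
    constructor
    · rintro ⟨q₁, c, h1, h2, q₂, s₁, h3, h4⟩
      exact ⟨q₂, c + s₁, ⟨q₁, c, h1, h2, by rwa [add_sub_cancel_left]⟩, by rwa [← sub_sub]⟩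
    · rintro ⟨q₂, s₁, ⟨q₁, c, h1, h2, h3⟩, h4⟩
      exact ⟨q₁, c, h1, h2, q₂, s₁ - c, h3, by rwa [sub_sub_sub_cancel_right]⟩

theorem append {q l₁ l₂ q' q'' s₁ s₂} (h₁ : Path S m q l₁ q' s₁) (h₂ : Path S m q' l₂ q'' s₂) :
    Path S m q (l₁ ++ l₂) q'' (s₁ + s₂) :=
  append_iff.2 ⟨q', s₁, h₁, by rwa [add_sub_cancel_left]⟩

/-- A path along which a single loop is taken at each letter. -/
theorem of_loop {q : Q} {l : List A} {w : A → ℤ} (h : ∀ a ∈ l, S q a q (w a) ∧ m ≤ w a) :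
    Path S m q l q (l.map w).sum := by
  induction l with
  | nil => exact .nil _
  | cons a l ih =>
    rw [List.map_cons, List.sum_cons]
    exact .cons (h a (by simp)).1 (h a (by simp)).2 (ih fun b hb => h b (by simp [hb]))

end Path

end MeanPayoff

namespace MeanPayoff

/-! ### Weights of blocks -/

/-- A configuration in a word: its tag and the letters that follow the tag. -/
abbrev Config (T R : Type) : Type := T × List (Option R)

namespace Config

variable {T R : Type}

open Classical in
/-- The unit of a configuration. -/
noncomputable def unit (x : Config T R) : ℤ := x.2.count none

open Classical in
/-- The value of a counter, times the unit. -/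
noncomputable def reg (x : Config T R) (r : R) : ℤ := x.2.count (some r)

/-- The word that describes a sequence of configurations. -/
def word (l : List (Config T R)) : List (Letter T R) :=
  l.flatMap fun x => .start x.1 :: x.2.map .sym

@[simp] theorem word_nil : word ([] : List (Config T R)) = [] := rfl

@[simp] theorem word_cons (x : Config T R) (l : List (Config T R)) :
    word (x :: l) = .start x.1 :: (x.2.map .sym ++ word l) := by
  simp [word]

@[simp] theorem word_append (l l' : List (Config T R)) : word (l ++ l') = word l ++ word l' := by
  simp [word]

theorem ne_mark_of_mem_sym {x : List (Option R)} {a : Letter T R}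
    (ha : a ∈ x.map Letter.sym) : a ≠ .mark := by
  obtain ⟨_, _, rfl⟩ := List.mem_map.1 ha
  simp

theorem ne_mark_of_mem_word {l : List (Config T R)} {a : Letter T R} (ha : a ∈ word l) :
    a ≠ .mark := by
  obtain ⟨x, _, h⟩ := List.mem_flatMap.1 ha
  rcases List.mem_cons.1 h with rfl | h
  · simp
  · exact ne_mark_of_mem_sym h

theorem reg_nonneg (x : Config T R) (r : R) : 0 ≤ x.reg r := Int.natCast_nonneg _

open Classical in
-- Weights that see only the unit letters and one counter measure a linear form in these two counts;
-- this is how a test evaluates its condition.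
theorem sum_map_eq {w : Option R → ℤ} {a b : ℤ} {r : R} (h₀ : w none = a) (h₁ : w (some r) = b)
    (h₂ : ∀ r', r' ≠ r → w (some r') = 0) (x : Config T R) :
    (x.2.map w).sum = a * x.unit + b * x.reg r := by
  obtain ⟨τ, l⟩ := x
  simp only [unit, reg]
  induction l with
  | nil => simp
  | cons y l ih =>
    rw [List.map_cons, List.sum_cons, ih, List.count_cons, List.count_cons]
    rcases y with _ | r'
    · simp [h₀]; ring
    · by_cases h : r' = r
      · subst h; simp [h₁]; ring
      · simp [h₂ r' h, h]

open Classical in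
theorem sum_map_eq_unit {w : Option R → ℤ} {a : ℤ} (h₀ : w none = a)
    (h₁ : ∀ r, w (some r) = 0) (x : Config T R) : (x.2.map w).sum = a * x.unit := by
  obtain ⟨τ, l⟩ := x
  simp only [unit]
  induction l with
  | nil => simp
  | cons y l ih =>
    rw [List.map_cons, List.sum_cons, ih, List.count_cons]
    rcases y with _ | r'
    · simp [h₀]; ring
    · simp [h₁]

end Config

namespace Detector

variable {T R : Type} (D : Detector T R)

open State Letter Config

/-- The result of following the default transitions. -/
noncomputable def run : State T R → List (Letter T R) → State T R × ℤ
  | q, [] => (q, 0)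
  | q, a :: l => ((run (D.usual q a).1 l).1, (D.usual q a).2 + (run (D.usual q a).1 l).2)

variable {D}

theorem run_append (q : State T R) (l₁ l₂ : List (Letter T R)) : D.run q (l₁ ++ l₂) =
    ((D.run (D.run q l₁).1 l₂).1, (D.run q l₁).2 + (D.run (D.run q l₁).1 l₂).2) := by
  induction l₁ generalizing q with
  | nil => simp [run]
  | cons a l ih => simp [run, ih, add_assoc]

/-- Nondeterminism occurs only in `begin` and `idle`, and neither is reached from the other states
without a `mark`. Once a test has started, the path and its weight are determined. -/
theorem path_iff_run {m : ℤ} (hm : ∀ q a q' c, D.Step q a q' c → m ≤ c) {q q' : State T R}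
    {l : List (Letter T R)} {s : ℤ} (hq : q ≠ begin ∧ q ≠ idle) (hl : ∀ a ∈ l, a ≠ mark) :
    Path D.Step m q l q' s ↔ q' = (D.run q l).1 ∧ s = (D.run q l).2 := by
  induction l generalizing q s with
  | nil => simp [Path.nil_iff, run]
  | cons a l ih =>
    have ha : a ≠ mark := hl a (by simp)
    have hstep : ∀ q' c, D.Step q a q' c ↔ q' = (D.usual q a).1 ∧ c = (D.usual q a).2 := by
      intro q' c
      rcases q with _ | _ | κ | κ | _ | _
      · exact absurd rfl hq.1
      · exact absurd rfl hq.2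
      · exact step_first
      · exact step_second
      · exact step_sink
      · exact step_dead
    have hq' : (D.usual q a).1 ≠ begin ∧ (D.usual q a).1 ≠ idle := by
      rcases q with _ | _ | κ | κ | _ | _ <;> rcases a with _ | τ | x <;> simp_all [usual]
      split_ifs <;> simp
    have hm' : m ≤ (D.usual q a).2 := hm _ _ _ _ (.usual _ _)
    rw [Path.cons_iff]
    simp only [hstep, run]
    constructor
    · rintro ⟨_, _, ⟨rfl, rfl⟩, _, h⟩
      obtain ⟨h1, h2⟩ := (ih hq' fun b hb => hl b (by simp [hb])).1 h
      exact ⟨h1, by linarith⟩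
    · rintro ⟨rfl, rfl⟩
      refine ⟨_, _, ⟨rfl, rfl⟩, hm', (ih hq' fun b hb => hl b (by simp [hb])).2 ⟨rfl, by ring⟩⟩

theorem run_first_sym (κ : Check T R) (x : List (Option R)) :
    D.run (first κ) (x.map sym) = (first κ, (x.map (D.weight₁ κ)).sum) := by
  induction x with
  | nil => rfl
  | cons y l ih => simp [run, usual, ih]

theorem run_second_sym (κ : Check T R) (x : List (Option R)) :
    D.run (second κ) (x.map sym) = (second κ, (x.map (weight₂ κ)).sum) := by
  induction x with
  | nil => rfl
  | cons y l ih => simp [run, usual, ih]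

theorem run_second_null {l : List (Letter T R)} (hl : ∀ a ∈ l, a ≠ mark) :
    D.run (second .null) l = (second .null, 0) := by
  induction l with
  | nil => rfl
  | cons a l ih =>
    have := ih fun b hb => hl b (by simp [hb])
    rcases a with _ | τ | x
    · exact absurd rfl (hl mark (by simp))
    · simp [run, usual, after, startWeight, this]
    · simp [run, usual, weight₂, this]

theorem run_second_len {l : List (Letter T R)} (hl : ∀ a ∈ l, a ≠ mark) :
    D.run (second .len) l = (second .len, (l.length : ℤ)) := by
  induction l with
  | nil => rfl
  | cons a l ih =>
    have := ih fun b hb => hl b (by simp [hb])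
    rcases a with _ | τ | x
    · exact absurd rfl (hl mark (by simp))
    · simp [run, usual, after, startWeight, this, add_comm]
    · simp [run, usual, weight₂, this, add_comm]

theorem run_dead (l : List (Letter T R)) : (D.run dead l).1 = dead := by
  induction l with
  | nil => rfl
  | cons a l ih => exact ih

theorem run_sink {l : List (Letter T R)} (hl : ∀ a ∈ l, a ≠ mark) : (D.run sink l).1 = sink := by
  induction l with
  | nil => rfl
  | cons a l ih =>
    have := ih fun b hb => hl b (by simp [hb])
    rcases a with _ | τ | x
    · exact absurd rfl (hl mark (by simp))
    · exact this
    · exact this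

open Classical in
-- All tests except `len` concern at most two configurations: at the next `start` the check becomes
-- `null` and collects nothing more.
theorem run_second_word (κ : Check T R) (l : List (Config T R)) : ∃ κ',
    D.run (second κ) (word l) = (second κ', if κ = .len then ((word l).length : ℤ) else 0) := by
  by_cases hκ : κ = .len
  · subst hκ
    exact ⟨.len, by rw [if_pos rfl]; exact run_second_len fun a => ne_mark_of_mem_word⟩
  · rw [if_neg hκ]
    rcases l with _ | ⟨x, l⟩
    · exact ⟨κ, rfl⟩
    · have h1 : after κ = .null := by cases κ <;> first | rfl | exact absurd rfl hκ
      have h2 : startWeight κ = 0 := by cases κ <;> first | rfl | exact absurd rfl hκ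
      refine ⟨.null, ?_⟩
      have : ∀ a ∈ x.2.map sym ++ word l, a ≠ (mark : Letter T R) := fun a ha => by
        rcases List.mem_append.1 ha with h | h
        exacts [ne_mark_of_mem_sym h, ne_mark_of_mem_word h]
      simp [run, usual, h1, h2, run_second_null this]

variable (D) in
open Classical in
/-- The weight of the test `κ` at a configuration `x` that is followed by the configurations
`l`. -/
noncomputable def gain (κ : Check T R) (x : Config T R) : List (Config T R) → ℤ
  | [] => (x.2.map (D.weight₁ κ)).sum
  | y :: l => (x.2.map (D.weight₁ κ)).sum + (startWeight κ + ((y.2.map (weight₂ κ)).sum +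
      if κ = .len then ((word l).length : ℤ) else 0))

variable (D) in
/-- The test `κ` at a configuration followed by the configurations `l` can be carried through. -/
def Passes (κ : Check T R) : List (Config T R) → Prop
  | [] => MarkOK κ
  | y :: _ => D.NextOK κ y.1

variable (D) in
/-- Some path from `q` over `l` followed by the letter `mark` has weight `s` and ends in the state
`begin`. -/
def BlockPath (m : ℤ) (q : State T R) (l : List (Letter T R)) (s : ℤ) : Prop :=
  ∃ q' s' c, Path D.Step m q l q' s' ∧ D.Step q' mark begin c ∧ s = s' + c

open Classical in
-- A started test leaves no choice: either it ends in `dead`, or it has exactly one possible weight,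
-- its gain plus the price.
theorem blockPath_first_iff {m : ℤ} (hm : ∀ q a q' c, D.Step q a q' c → m ≤ c) {κ : Check T R}
    {x : Config T R} {l : List (Config T R)} {s : ℤ} :
    D.BlockPath m (first κ) (x.2.map sym ++ word l) s ↔
      D.Passes κ l ∧ s = D.gain κ x l + D.price := by
  have hl : ∀ a ∈ x.2.map sym ++ word l, a ≠ (mark : Letter T R) := fun a ha => by
    rcases List.mem_append.1 ha with h | h
    exacts [ne_mark_of_mem_sym h, ne_mark_of_mem_word h]
  simp only [BlockPath, path_iff_run hm (q := first κ) (by simp) hl, run_append, run_first_sym]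
  rcases l with _ | ⟨y, l⟩
  · simp only [word_nil, run, add_zero, Passes, gain]
    constructor
    · rintro ⟨_, _, c, ⟨rfl, rfl⟩, h, rfl⟩
      obtain ⟨h1, h2⟩ := step_first.1 h
      simp only [usual] at h1 h2
      split_ifs at h1 h2 with h3
      exact ⟨h3, by rw [h2]⟩
    · rintro ⟨h, rfl⟩
      refine ⟨_, _, D.price, ⟨rfl, rfl⟩, step_first.2 ?_, rfl⟩
      simp [usual, h]
  · simp only [Passes]
    by_cases h : D.NextOK κ y.1
    · obtain ⟨κ', h'⟩ := run_second_word (D := D) κ l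
      have h1 : D.run (first κ) (word (y :: l)) = (second κ', startWeight κ +
          ((y.2.map (weight₂ κ)).sum + if κ = .len then ((word l).length : ℤ) else 0)) := by
        simp [run, usual, h, run_append, run_second_sym, h']
      simp only [h1, h, true_and, gain]
      constructor
      · rintro ⟨_, _, c, ⟨rfl, rfl⟩, h, rfl⟩
        rw [(step_second.1 h).2, usual]
      · rintro rfl
        exact ⟨_, _, D.price, ⟨rfl, rfl⟩, step_second.2 ⟨rfl, rfl⟩, rfl⟩
    · have h1 : (D.run (first κ) (word (y :: l))).1 = dead := by
        simp only [word_cons, run, usual, h, if_false]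
        exact run_dead _
      simp only [h1, h, false_and, iff_false]
      rintro ⟨_, _, c, ⟨rfl, rfl⟩, h, rfl⟩
      exact absurd (step_dead.1 h).1 (by simp)

/-- The sink pays only on words without further marks: the next `mark` kills the run. -/
theorem not_blockPath_sink {m : ℤ} (hm : ∀ q a q' c, D.Step q a q' c → m ≤ c)
    {l : List (Letter T R)} {s : ℤ} (hl : ∀ a ∈ l, a ≠ mark) : ¬ D.BlockPath m sink l s := by
  rintro ⟨q', s', c, h, h', _⟩
  rw [path_iff_run hm (by simp) hl, run_sink hl] at h
  rw [h.1, step_sink] at h'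
  exact absurd h'.1 (by simp [usual])

theorem blockPath_cons {m : ℤ} {q : State T R} {a : Letter T R} {l : List (Letter T R)} {s : ℤ} :
    D.BlockPath m q (a :: l) s ↔
      ∃ q' c, D.Step q a q' c ∧ m ≤ c ∧ D.BlockPath m q' l (s - c) := by
  constructor
  · rintro ⟨q₂, s', c', h, h', rfl⟩
    obtain ⟨q₁, c, h1, h2, h3⟩ := Path.cons_iff.1 h
    exact ⟨q₁, c, h1, h2, q₂, _, c', h3, h', by ring⟩
  · rintro ⟨q₁, c, h1, h2, q₂, s', c', h3, h', hs⟩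
    exact ⟨q₂, c + s', c', .cons h1 h2 h3, h', by linarith⟩

/-! #### Honest blocks -/

variable (D) in
/-- The configurations describe an execution, with units that are halved in each step. -/
inductive Honest (b : ℤ) : List (Config T R) → Prop
  | single (x) : (∀ r, D.sys.zero x.1 r → x.reg r = 0) → (¬ D.accept x.1 → x.unit ≤ b) →
      Honest b [x]
  | cons (x y l) : (∀ r, D.sys.zero x.1 r → x.reg r = 0) → D.sys.compat x.1 y.1 →
      2 * y.unit = x.unit → (∀ r, 2 * y.reg r = x.reg r + D.sys.delta x.1 r * x.unit) →
      Honest b (y :: l) → Honest b (x :: y :: l)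

theorem Honest.zero {b : ℤ} {x : Config T R} {l : List (Config T R)} (h : D.Honest b (x :: l)) :
    ∀ r, D.sys.zero x.1 r → x.reg r = 0 := by
  cases h <;> assumption

theorem sum_weight₁_init (r : R) (s : Bool) (x : Config T R) :
    (x.2.map (D.weight₁ (.init r s))).sum
      = sgn s * (D.input * D.sys.input r) * x.unit + -sgn s * x.reg r :=
  sum_map_eq rfl (by simp [weight₁]) (fun r' h => by simp [weight₁, h]) x

theorem sum_weight₁_compat (τ : T) (x : Config T R) :
    (x.2.map (D.weight₁ (.compat τ))).sum = x.unit := by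
  rw [sum_map_eq_unit rfl (fun _ => rfl) x, weight₁, one_mul]

theorem sum_weight₁_ending (τ : T) (x : Config T R) :
    (x.2.map (D.weight₁ (.ending τ))).sum = x.unit := by
  rw [sum_map_eq_unit rfl (fun _ => rfl) x, weight₁, one_mul]

theorem sum_weight₁_zero (r : R) (x : Config T R) :
    (x.2.map (D.weight₁ (.zero r))).sum = x.reg r := by
  rw [sum_map_eq (a := 0) (b := 1) (r := r) rfl (by simp [weight₁])
    (fun r' h => by simp [weight₁, h]) x]
  ring

theorem sum_weight₁_unit (s : Bool) (x : Config T R) :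
    (x.2.map (D.weight₁ (.unit s))).sum = -sgn s * x.unit :=
  sum_map_eq_unit rfl (fun _ => rfl) x

theorem sum_weight₁_reg (τ : T) (r : R) (s : Bool) (x : Config T R) :
    (x.2.map (D.weight₁ (.reg τ r s))).sum
      = -sgn s * D.sys.delta τ r * x.unit + -sgn s * x.reg r :=
  sum_map_eq rfl (by simp [weight₁]) (fun r' h => by simp [weight₁, h]) x

open Classical in
theorem sum_weight₁_len (x : Config T R) :
    (x.2.map (D.weight₁ .len)).sum = x.2.length - D.ratio D.input * x.unit := by
  obtain ⟨τ, l⟩ := x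
  simp only [unit]
  induction l with
  | nil => simp
  | cons y l ih =>
    rw [List.map_cons, List.sum_cons, ih, List.count_cons]
    rcases y with _ | r' <;> simp [weight₁] <;> ring

theorem sum_weight₂_unit (s : Bool) (x : Config T R) :
    (x.2.map (weight₂ (T := T) (.unit s))).sum = 2 * sgn s * x.unit :=
  sum_map_eq_unit rfl (fun _ => rfl) x

theorem sum_weight₂_reg (τ : T) (r : R) (s : Bool) (x : Config T R) :
    (x.2.map (weight₂ (.reg τ r s))).sum = 2 * sgn s * x.reg r := by
  rw [sum_map_eq (a := 0) (b := 2 * sgn s) (r := r) rfl (by simp [weight₂])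
    (fun r' h => by simp [weight₂, h]) x]
  ring

theorem sum_weight₂_len (x : Config T R) :
    (x.2.map (weight₂ (T := T) .len)).sum = x.2.length := by
  have : (weight₂ (.len : Check T R)) = fun _ => 1 := by funext x; cases x <;> rfl
  simp [this]

theorem gain_len (x : Config T R) (l : List (Config T R)) :
    D.gain .len x l = (word (x :: l)).length - 1 - D.ratio D.input * x.unit := by
  rcases l with _ | ⟨y, l⟩
  · simp only [gain, sum_weight₁_len]
    simp
  · simp only [gain, sum_weight₁_len, sum_weight₂_len, startWeight]
    simp
    ring

/-- On an honest block the equalities make the two sides of each linear test cancel, and the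
compatibility test cannot be passed. Only `ending` may gain something, namely the last unit, which
is at most b. The proposition `p` says that the configuration is the first one of its block, where
`len` and `init` are allowed. -/
theorem gain_le_of_honest {b : ℤ} (hb : 0 ≤ b) {x : Config T R} {l : List (Config T R)}
    (h : D.Honest b (x :: l)) {p : Prop} (hp : p → D.gain .len x l ≤ 0 ∧
      ∀ r, x.reg r = D.input * D.sys.input r * x.unit) {κ : Check T R} (hκ : D.Enter κ x.1 p)
    (hpass : D.Passes κ l) : D.gain κ x l ≤ b := by
  have hgain : ∀ κ : Check T R, κ ≠ .len → (∀ y : Config T R,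
      (y.2.map (weight₂ κ)).sum = 0) → D.gain κ x l = (x.2.map (D.weight₁ κ)).sum := by
    intro κ h0 h2
    have h1 : startWeight κ = 0 := by cases κ <;> first | rfl | exact absurd rfl h0
    rcases l with _ | ⟨y, l⟩ <;> simp [gain, h0, h1, h2]
  cases κ with
  | null => exact hκ.elim
  | len => exact (hp hκ).1.trans hb
  | init r s =>
    rw [hgain _ (by simp) (fun y => by rw [sum_map_eq_unit rfl (fun r => rfl) y]; simp [weight₂]),
      sum_weight₁_init, (hp hκ).2 r]
    linarith
  | compat τ =>
    obtain rfl : τ = x.1 := hκ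
    cases h with
    | single => exact absurd hpass (by simp [Passes, MarkOK])
    | cons _ y l h0 h1 => exact absurd h1 hpass
  | ending τ =>
    obtain ⟨rfl, hκ⟩ := hκ
    cases h with
    | single _ h0 h1 =>
      rw [hgain _ (by simp) (fun y => by rw [sum_map_eq_unit rfl (fun r => rfl) y]; simp [weight₂]),
        sum_weight₁_ending]
      exact h1 hκ
    | cons => exact hpass.elim
  | zero r =>
    rw [hgain _ (by simp) (fun y => by rw [sum_map_eq_unit rfl (fun r => rfl) y]; simp [weight₂]),
      sum_weight₁_zero, h.zero r hκ]
    exact hb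
  | unit s =>
    cases h with
    | single => exact absurd hpass (by simp [Passes, MarkOK])
    | cons _ y l _ _ h2 =>
      simp only [gain, sum_weight₁_unit, sum_weight₂_unit, startWeight]
      rw [← h2]
      simp
      linarith
  | reg τ r s =>
    obtain rfl : τ = x.1 := hκ
    cases h with
    | single => exact absurd hpass (by simp [Passes, MarkOK])
    | cons _ y l _ _ _ h3 =>
      simp only [gain, sum_weight₁_reg, sum_weight₂_reg, startWeight]
      have := h3 r
      have e : 2 * sgn s * y.reg r = sgn s * (2 * y.reg r) := by ring
      rw [e, this]
      simp
      linarith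

theorem blockPath_idle_sym {m : ℤ} (hm : ∀ q a q' c, D.Step q a q' c → m ≤ c)
    {x : List (Option R)} {l : List (Letter T R)} (hl : ∀ a ∈ l, a ≠ mark) {s : ℤ}
    (h : D.BlockPath m idle (x.map sym ++ l) s) : D.BlockPath m idle l s := by
  induction x generalizing s with
  | nil => exact h
  | cons y x ih =>
    obtain ⟨q', c, h1, h2, h3⟩ := blockPath_cons.1 h
    rcases step_idle_sym.1 h1 with ⟨rfl, rfl⟩ | ⟨rfl, rfl⟩
    · rw [sub_zero] at h3
      exact ih h3
    · refine absurd h3 (not_blockPath_sink hm fun a ha => ?_)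
      rcases List.mem_append.1 ha with h | h
      exacts [ne_mark_of_mem_sym h, hl a h]

theorem ne_mark_of_mem_sym_append_word {x : List (Option R)} {l : List (Config T R)}
    {a : Letter T R} (ha : a ∈ x.map sym ++ word l) : a ≠ mark := by
  rcases List.mem_append.1 ha with h | h
  exacts [ne_mark_of_mem_sym h, ne_mark_of_mem_word h]

/-- At each configuration the path stays idle, is lost in the sink, or starts its only test. The
induction therefore needs the honesty of all suffixes. -/
theorem blockPath_idle_le {m : ℤ} (hm : ∀ q a q' c, D.Step q a q' c → m ≤ c) {b : ℤ} (hb : 0 ≤ b)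
    {l : List (Config T R)} (hl : l ≠ [] → D.Honest b l) {s : ℤ}
    (h : D.BlockPath m idle (word l) s) : s ≤ D.price + b := by
  induction l generalizing s with
  | nil =>
    obtain ⟨q', s', c, h1, h2, rfl⟩ := h
    obtain ⟨rfl, rfl⟩ := Path.nil_iff.1 h1
    rw [(step_idle_mark.1 h2).2]
    linarith
  | cons x l ih =>
    rw [word_cons] at h
    obtain ⟨q', c, h1, h2, h3⟩ := blockPath_cons.1 h
    rcases step_idle_start.1 h1 with ⟨rfl, rfl⟩ | ⟨rfl, rfl⟩ | ⟨κ, hκ, rfl, rfl⟩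
    · rw [sub_zero] at h3
      refine ih (fun hne => ?_) (blockPath_idle_sym hm (fun a => ne_mark_of_mem_word) h3)
      cases hl (by simp) with
      | single => exact absurd rfl hne
      | cons => assumption
    · exact absurd h3 (not_blockPath_sink hm fun a => ne_mark_of_mem_sym_append_word)
    · obtain ⟨h4, h5⟩ := (blockPath_first_iff hm).1 h3
      rw [hκ.startWeight] at h5
      have := gain_le_of_honest hb (hl (by simp)) False.elim hκ h4
      linarith

/-- No path over a block that describes an execution has a large weight. -/
theorem blockPath_begin_le {m : ℤ} (hm : ∀ q a q' c, D.Step q a q' c → m ≤ c) {b : ℤ} (hb : 0 ≤ b)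
    {x : Config T R} {l : List (Config T R)} (hl : D.Honest b (x :: l)) (hinit : D.sys.init x.1)
    (hstart : ∀ r, x.reg r = D.input * D.sys.input r * x.unit)
    (hlen : ((word (x :: l)).length : ℤ) ≤ D.ratio D.input * x.unit) {s : ℤ}
    (h : D.BlockPath m begin (word (x :: l)) s) : s ≤ D.price + b := by
  have hgl := gain_len (D := D) x l
  rw [word_cons] at h
  obtain ⟨q', c, h1, h2, h3⟩ := blockPath_cons.1 h
  rcases (step_begin_start hinit).1 h1 with ⟨rfl, rfl⟩ | ⟨rfl, rfl⟩ | ⟨κ, hκ, rfl, rfl⟩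
  · rw [sub_zero] at h3
    refine blockPath_idle_le hm hb (fun hne => ?_)
      (blockPath_idle_sym hm (fun a => ne_mark_of_mem_word) h3)
    cases hl with
    | single => exact absurd rfl hne
    | cons => assumption
  · exact absurd h3 (not_blockPath_sink hm fun a => ne_mark_of_mem_sym_append_word)
  · obtain ⟨h4, h5⟩ := (blockPath_first_iff hm).1 h3
    by_cases hκ' : κ = .len
    · subst hκ'
      simp only [startWeight] at h5
      linarith
    · have h0 : startWeight κ = 0 := by cases κ <;> first | rfl | exact absurd rfl hκ'
      rw [h0] at h5
      have := gain_le_of_honest hb hl (p := True)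
        (fun _ => ⟨by rw [hgl]; linarith, hstart⟩) hκ h4
      linarith

end Detector

end MeanPayoff

/-! ### From approximately correct blocks to genuine traces. -/

namespace MeanPayoff

namespace CounterSystem

variable {T R : Type}

/-- The counters along a sequence of tags. -/
def counters (M : CounterSystem T R) (n : ℕ) (τ : ℕ → T) : ℕ → R → ℤ
  | 0, r => n * M.input r
  | i + 1, r => counters M n τ i r + M.delta (τ i) r

theorem abs_counters_le (M : CounterSystem T R) (n : ℕ) (τ : ℕ → T) (i : ℕ) (r : R) :
    |M.counters n τ i r| ≤ n + i := by
  induction i with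
  | zero =>
    have h1 := M.input_nonneg r
    have h2 := M.input_le r
    rw [counters, abs_of_nonneg (by positivity)]
    push_cast
    nlinarith
  | succ i ih =>
    have := abs_add_le (M.counters n τ i r) (M.delta (τ i) r)
    have := M.abs_delta_le (τ i) r
    rw [counters]
    push_cast
    linarith

/-- A sequence of configurations that satisfies the conditions on an execution up to an error that
is small compared to the units describes an execution. -/
theorem isTrace_of_approx (M : CounterSystem T R) {n : ℕ} {τ : ℕ → T} {U : ℕ → ℝ}
    {X : ℕ → R → ℝ} {m N : ℕ} {e : ℝ} (hmN : m ≤ N) (he : 0 ≤ e) (hinit : M.init (τ 0))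
    (hX : ∀ i ≤ m, ∀ r, 0 ≤ X i r)
    (hstart : ∀ r, |X 0 r - n * M.input r * U 0| ≤ e)
    (hunit : ∀ i < m, |2 * U (i + 1) - U i| ≤ e)
    (hreg : ∀ i < m, ∀ r, |2 * X (i + 1) r - X i r - M.delta (τ i) r * U i| ≤ e)
    (hzero : ∀ i ≤ m, ∀ r, M.zero (τ i) r → X i r ≤ e)
    (hcompat : ∀ i < m, ¬ M.compat (τ i) (τ (i + 1)) → U i ≤ e)
    (hU : (n + N + 3) * 2 ^ N * e < U 0) :
    M.IsTrace n τ (M.counters n τ) m ∧ e < U m := by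
  have hU' : ∀ i ≤ m, |2 ^ i * U i - U 0| ≤ 2 ^ i * e := by
    intro i
    induction i with
    | zero => simp [he]
    | succ i ih =>
      intro hi
      have h1 := abs_le.1 (ih (by omega))
      have h2 := abs_le.1 (hunit i (by omega))
      have h3 : (0 : ℝ) < 2 ^ i := by positivity
      rw [abs_le, pow_succ]
      constructor <;> nlinarith
  -- The units stay far above the error: U i differs from U 0 / 2 ^ i by at most e, which uses up
  -- one of the three spare multiples of e in `hU`.
  have hUe : ∀ i ≤ m, (n + i + 2) * e < U i := by
    intro i hi
    have h1 := abs_le.1 (hU' i hi)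
    have h3 : (0 : ℝ) < 2 ^ i := by positivity
    have h4 : (2 : ℝ) ^ i ≤ 2 ^ N := pow_le_pow_right₀ (by norm_num) (hi.trans hmN)
    have h5 : (i : ℝ) ≤ N := by exact_mod_cast hi.trans hmN
    have h6 : (n + i + 3) * 2 ^ i * e ≤ (n + N + 3) * 2 ^ N * e := by gcongr
    have h7 : 2 ^ i * ((n + i + 2) * e) < 2 ^ i * U i := by linarith
    exact lt_of_mul_lt_mul_left h7 h3.le
  have hbig : ∀ i ≤ m, e < U i := by
    intro i hi
    have := hUe i hi
    have h2 : 0 ≤ (n + i + 1 : ℝ) * e := by positivity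
    linarith
  -- Twice the new error is at most the old error, plus e from the update, plus the counter, of
  -- absolute value at most n + i + 1, times the error of the unit. Hence the error grows by at most
  -- e per step.
  have hc : ∀ i ≤ m, ∀ r, |X i r - M.counters n τ i r * U i| ≤ (n + i + 1) * e := by
    intro i
    induction i with
    | zero =>
      intro _ r
      refine (le_of_eq ?_).trans ((hstart r).trans ?_)
      · simp [counters]
      · have : 0 ≤ (n : ℝ) * e := by positivity
        push_cast
        linarith
    | succ i ih =>
      intro hi r
      have h1 := abs_le.1 (ih (by omega) r)
      have h2 := abs_le.1 (hreg i (by omega) r)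
      have h3 : |(M.counters n τ (i + 1) r : ℝ) * (2 * U (i + 1) - U i)| ≤ (n + (i + 1)) * e := by
        rw [abs_mul]
        have h4 := M.abs_counters_le n τ (i + 1) r
        have h5 : |(M.counters n τ (i + 1) r : ℝ)| ≤ n + (i + 1) := by exact_mod_cast h4
        exact mul_le_mul h5 (hunit i (by omega)) (abs_nonneg _) (by positivity)
      replace h3 := abs_le.1 h3
      have h6 : (M.counters n τ (i + 1) r : ℝ) = M.counters n τ i r + M.delta (τ i) r := by
        rw [counters]; push_cast; ring
      have h7 : 2 * (X (i + 1) r - M.counters n τ (i + 1) r * U (i + 1)) =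
          (2 * X (i + 1) r - X i r - M.delta (τ i) r * U i) +
          (X i r - M.counters n τ i r * U i)
          - (M.counters n τ (i + 1) r : ℝ) * (2 * U (i + 1) - U i) := by
        rw [h6]; ring
      rw [abs_le]
      push_cast
      constructor <;> linarith
  refine ⟨⟨hinit, fun r => rfl, fun i hi => ?_, fun i _ r => rfl, fun i hi r => ?_,
    fun i hi r h => ?_⟩, hbig m le_rfl⟩
  · by_contra h
    exact absurd (hcompat i hi h) (not_le.2 (hbig i hi.le))
  · have h1 := abs_le.1 (hc i hi r)
    have h2 := hX i hi r
    have h3 := hUe i hi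
    have h0 := hbig i hi
    -- The error is less than one unit, so the integer counter exceeds -1. For a zero test the same
    -- rounding, with one more e of slack, shows that it is below 1.
    have h4 : (-1 : ℝ) * U i < M.counters n τ i r * U i := by linarith
    have h5 : (-1 : ℝ) < M.counters n τ i r := lt_of_mul_lt_mul_right h4 (he.trans h0.le)
    have h6 : -1 < M.counters n τ i r := by exact_mod_cast h5
    omega
  · have h1 := abs_le.1 (hc i hi r)
    have h2 := hX i hi r
    have h3 := hUe i hi
    have h0 := hbig i hi
    have hz := hzero i hi r h
    have h4 : (-1 : ℝ) * U i < M.counters n τ i r * U i := by linarith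
    have h5 : (-1 : ℝ) < M.counters n τ i r := lt_of_mul_lt_mul_right h4 (he.trans h0.le)
    have h6 : -1 < M.counters n τ i r := by exact_mod_cast h5
    have h7 : M.counters n τ i r * U i < (1 : ℝ) * U i := by linarith
    have h8 : (M.counters n τ i r : ℝ) < 1 := lt_of_mul_lt_mul_right h7 (he.trans h0.le)
    have h9 : M.counters n τ i r < 1 := by exact_mod_cast h8
    omega

end CounterSystem

theorem Config.exists_eq_word {T R : Type} (l : List (Letter T R)) (hl : ∀ a ∈ l, a ≠ .mark) :
    ∃ (x : List (Option R)) (cs : List (Config T R)), l = x.map .sym ++ Config.word cs := by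
  induction l with
  | nil => exact ⟨[], [], rfl⟩
  | cons a l ih =>
    obtain ⟨x, cs, rfl⟩ := ih fun b hb => hl b (by simp [hb])
    rcases a with _ | τ | y
    · exact absurd rfl (hl .mark (by simp))
    · exact ⟨[], (τ, x) :: cs, by simp⟩
    · exact ⟨y :: x, cs, by simp⟩

namespace Detector

variable {T R : Type} {D : Detector T R}

open State Letter Config

theorem path_idle {m : ℤ} (hm : m ≤ 0) {l : List (Letter T R)} (hl : ∀ a ∈ l, a ≠ mark) :
    Path D.Step m idle l idle 0 := by
  have := Path.of_loop (S := D.Step) (m := m) (q := idle) (l := l) (w := fun _ => 0)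
    (fun a ha => ⟨?_, hm⟩)
  · simpa using this
  · rcases a with _ | τ | x
    · exact absurd rfl (hl mark ha)
    · exact .usual idle (start τ)
    · exact .usual idle (sym x)

theorem path_begin_idle {m : ℤ} (hm : m ≤ 0) {l : List (Letter T R)} (hl : ∀ a ∈ l, a ≠ mark)
    (hne : l ≠ []) : Path D.Step m begin l idle 0 := by
  rcases l with _ | ⟨a, l⟩
  · exact absurd rfl hne
  · refine Path.cons (c := 0) (s := 0) ?_ hm (path_idle hm fun b hb => hl b (by simp [hb]))
    rcases a with _ | τ | x
    · exact absurd rfl (hl mark (by simp))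
    · exact .usual begin (start τ)
    · exact .usual begin (sym x)

/-- Every block can be passed without a test. -/
theorem exists_path_begin {l : List (Letter T R)} (hl : ∀ a ∈ l, a ≠ mark) :
    ∃ q c, Path D.Step 0 begin l q 0 ∧ D.Step q mark begin c ∧ D.price ≤ c := by
  rcases l with _ | ⟨a, l⟩
  · exact ⟨begin, _, .nil _, step_begin_mark.2 ⟨rfl, rfl⟩, by linarith⟩
  · exact ⟨idle, _, path_begin_idle le_rfl hl (by simp), step_idle_mark.2 ⟨rfl, rfl⟩, le_rfl⟩

/-- The path idles up to the configuration `x` and tests there. Entering from `begin` or from `idle`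
is what distinguishes the first configuration. -/
theorem blockPath_test {m : ℤ} (hm : ∀ q a q' c, D.Step q a q' c → m ≤ c) (hm0 : m ≤ 0)
    {pre l : List (Config T R)} {x : Config T R} {κ : Check T R} (hκ : D.Enter κ x.1 (pre = []))
    (hp : D.Passes κ l) :
    D.BlockPath m begin (word (pre ++ x :: l)) (startWeight κ + D.gain κ x l + D.price) := by
  obtain ⟨q, s, c, h1, h2, h3⟩ := (blockPath_first_iff hm (x := x)).2 ⟨hp, rfl⟩
  rcases pre with _ | ⟨y, pre⟩
  · have hs : D.Step begin (start x.1) (first κ) (startWeight κ) :=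
      .enter_of_begin _ _ (by simpa using hκ)
    refine ⟨q, startWeight κ + s, c, ?_, h2, by linarith⟩
    rw [List.nil_append, word_cons]
    exact .cons hs (hm _ _ _ _ hs) h1
  · have hs : D.Step idle (start x.1) (first κ) (startWeight κ) :=
      .enter_of_idle _ _ (by simpa using hκ)
    refine ⟨q, 0 + (startWeight κ + s), c, ?_, h2, by linarith⟩
    rw [word_append, word_cons (l := l)]
    exact (path_begin_idle hm0 (fun a => ne_mark_of_mem_word) (by simp)).append
      (.cons hs (hm _ _ _ _ hs) h1)

/-- A block with a wrong beginning is punished with its whole length, one unit of weight per letter.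
-/
theorem blockPath_bad {m : ℤ} (hm : ∀ q a q' c, D.Step q a q' c → m ≤ c) {a : Letter T R}
    {l : List (Letter T R)} (hl : ∀ b ∈ l, b ≠ mark) (ha : D.Step begin a (second .len) 1) :
    D.BlockPath m begin (a :: l) ((a :: l).length + D.price) := by
  refine blockPath_cons.2 ⟨_, _, ha, hm _ _ _ _ ha, second .len, l.length, D.price, ?_,
    step_second.2 ⟨rfl, rfl⟩, ?_⟩
  · rw [path_iff_run hm (by simp) hl, run_second_len hl]
    exact ⟨rfl, rfl⟩
  · push_cast [List.length_cons]
    ring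

theorem ratio_pos : 0 < D.ratio D.input := by simp [ratio]

/-- If all paths over a block have small weights, then the block begins with an execution. -/
theorem exists_isTrace_of_blockPath_le {m : ℤ} (hm : ∀ q a q' c, D.Step q a q' c → m ≤ c)
    (hm0 : m ≤ 0) {l : List (Letter T R)} (hl : ∀ a ∈ l, a ≠ mark) {e : ℝ} (he : 0 ≤ e)
    (hs : ∀ s, D.BlockPath m begin l s → (s : ℝ) ≤ e + D.price) (N : ℕ)
    (hN : D.ratio D.input * ((D.input + N + 3) * 2 ^ N * e) + e < l.length) :
    ∃ k τ c, k ≤ l.length ∧ D.sys.IsTrace D.input τ c (min N k) ∧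
      (k ≤ N → D.accept (τ k)) := by
  have hel : e < l.length := lt_of_le_of_lt (by
    have : 0 ≤ D.ratio D.input * ((D.input + N + 3) * 2 ^ N * e) := by positivity
    linarith) hN
  have hbad : ∀ a l', l = a :: l' → ¬ D.Step begin a (second .len) 1 := by
    rintro a l' rfl ha
    have := hs _ (blockPath_bad hm (fun b hb => hl b (by simp [hb])) ha)
    push_cast at this
    push_cast [List.length_cons] at hel
    simp only [List.length_cons] at this
    push_cast at this
    linarith
  obtain ⟨xs, cs, hcs⟩ := exists_eq_word l hl
  rcases xs with _ | ⟨y, xs⟩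
  swap
  · exact absurd (.bad_sym y) (hbad _ _ hcs)
  rcases cs with _ | ⟨x₀, cs'⟩
  · subst hcs
    simp at hel
    linarith
  have hinit : D.sys.init x₀.1 := by
    by_contra h
    exact hbad _ _ hcs (.bad_start _ h)
  rw [List.map_nil, List.nil_append] at hcs
  set cs := x₀ :: cs' with hcs0
  have hlen : cs'.length < l.length := by
    rw [hcs, word, List.length_flatMap]
    have : ∀ cs : List (Config T R), cs.length ≤
        (cs.map fun x => (start x.1 :: x.2.map sym : List (Letter T R)).length).sum := by
      intro cs
      induction cs with
      | nil => simp
      | cons x cs ih => simp only [List.map_cons, List.sum_cons, List.length_cons] at ih ⊢; omega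
    have := this cs
    simp only [hcs0, List.length_cons] at this ⊢
    omega
  set x : ℕ → Config T R := fun i => cs.getD i x₀ with hx
  have hsplit : ∀ i ≤ cs'.length, cs = cs.take i ++ x i :: cs.drop (i + 1) := by
    intro i hi
    have hi' : i < cs.length := by simp [hcs0]; omega
    rw [hx]
    simp only
    rw [List.getD_eq_getElem _ _ hi', List.cons_getElem_drop_succ, List.take_append_drop]
  have htake : ∀ i, cs.take i = [] ↔ i = 0 := by
    intro i; simp [hcs0]
  -- Each admissible test is a path over the block, so the hypothesis bounds its gain by e. The
  -- estimates `e1` to `e7` are this bound for the various checks, and the two signs of a check give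
  -- an absolute value.
  have htest : ∀ i ≤ cs'.length, ∀ κ, D.Enter κ (x i).1 (i = 0) →
      D.Passes κ (cs.drop (i + 1)) →
      ((startWeight κ + D.gain κ (x i) (cs.drop (i + 1)) : ℤ) : ℝ) ≤ e := by
    intro i hi κ hκ hp
    have := blockPath_test hm hm0 (pre := cs.take i) (x := x i) (l := cs.drop (i + 1)) (κ := κ)
      (by rw [htake]; exact hκ) hp
    rw [← hsplit i hi, ← hcs] at this
    have := hs _ this
    push_cast at this ⊢
    linarith
  have hdrop : ∀ i < cs'.length, cs.drop (i + 1) = x (i + 1) :: cs.drop (i + 2) := by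
    intro i hi
    have hi' : i + 1 < cs.length := by simp [hcs0]; omega
    rw [hx]
    simp only
    rw [List.getD_eq_getElem _ _ hi', List.cons_getElem_drop_succ]
  have hlast : cs.drop (cs'.length + 1) = [] := by simp [hcs0]
  have hgain : ∀ κ : Check T R, κ ≠ .len → (∀ y : Config T R,
      (y.2.map (weight₂ κ)).sum = 0) → ∀ y l,
      startWeight κ + D.gain κ y l = (y.2.map (D.weight₁ κ)).sum := by
    intro κ h0 h2 y l
    have h1 : startWeight κ = 0 := by cases κ <;> first | rfl | exact absurd rfl h0
    rcases l with _ | ⟨z, l⟩ <;> simp [gain, h0, h1, h2]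
  have hMark : ∀ (κ : Check T R) l, MarkOK κ → (∀ τ, D.NextOK κ τ) → D.Passes κ l := by
    intro κ l h1 h2
    rcases l with _ | ⟨y, l⟩
    exacts [h1, h2 _]
  have e6 : ∀ r, |((x 0).reg r : ℝ) - D.input * D.sys.input r * (x 0).unit| ≤ e := by
    intro r
    have key : ∀ s, ((sgn s * (D.input * D.sys.input r) * (x 0).unit
        + -sgn s * (x 0).reg r : ℤ) : ℝ) ≤ e := by
      intro s
      have := htest 0 (by omega) (.init r s) rfl (hMark _ _ trivial fun _ => trivial)
      rwa [hgain _ (by simp) (fun y => by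
        rw [sum_map_eq_unit rfl (fun r => rfl) y]; simp [weight₂]), sum_weight₁_init] at this
    have h1 := key true
    have h2 := key false
    simp only [sgn, if_true, Bool.false_eq_true, if_false] at h1 h2
    push_cast at h1 h2
    rw [abs_le]
    constructor <;> linarith
  have e1 : ∀ i < cs'.length, |2 * ((x (i + 1)).unit : ℝ) - (x i).unit| ≤ e := by
    intro i hi
    have key : ∀ s, ((-sgn s * (x i).unit + 2 * sgn s * (x (i + 1)).unit : ℤ) : ℝ) ≤ e := by
      intro s
      have := htest i hi.le (.unit s) trivial (by rw [hdrop i hi]; trivial)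
      rw [hdrop i hi] at this
      simpa [gain, sum_weight₁_unit, sum_weight₂_unit, startWeight] using this
    have h1 := key true
    have h2 := key false
    simp only [sgn, if_true, Bool.false_eq_true, if_false] at h1 h2
    push_cast at h1 h2
    rw [abs_le]
    constructor <;> linarith
  have e2 : ∀ i < cs'.length, ∀ r, |2 * ((x (i + 1)).reg r : ℝ) - (x i).reg r
      - D.sys.delta (x i).1 r * (x i).unit| ≤ e := by
    intro i hi r
    have key : ∀ s, ((-sgn s * D.sys.delta (x i).1 r * (x i).unit + -sgn s * (x i).reg r
        + 2 * sgn s * (x (i + 1)).reg r : ℤ) : ℝ) ≤ e := by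
      intro s
      have := htest i hi.le (.reg (x i).1 r s) rfl (by rw [hdrop i hi]; trivial)
      rw [hdrop i hi] at this
      simpa [gain, sum_weight₁_reg, sum_weight₂_reg, startWeight] using this
    have h1 := key true
    have h2 := key false
    simp only [sgn, if_true, Bool.false_eq_true, if_false] at h1 h2
    push_cast at h1 h2
    rw [abs_le]
    constructor <;> linarith
  have e3 : ∀ i ≤ cs'.length, ∀ r, D.sys.zero (x i).1 r → ((x i).reg r : ℝ) ≤ e := by
    intro i hi r hz
    have := htest i hi (.zero r) hz (hMark _ _ trivial fun _ => trivial)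
    rwa [hgain _ (by simp) (fun y => by
      rw [sum_map_eq_unit rfl (fun r => rfl) y]; simp [weight₂]), sum_weight₁_zero] at this
  have e4 : ∀ i < cs'.length, ¬ D.sys.compat (x i).1 (x (i + 1)).1 → ((x i).unit : ℝ) ≤ e := by
    intro i hi hz
    have := htest i hi.le (.compat (x i).1) rfl (by rw [hdrop i hi]; exact hz)
    rwa [hgain _ (by simp) (fun y => by
      rw [sum_map_eq_unit rfl (fun r => rfl) y]; simp [weight₂]), sum_weight₁_compat] at this
  have e5 : ¬ D.accept (x cs'.length).1 → ((x cs'.length).unit : ℝ) ≤ e := by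
    intro hz
    have := htest cs'.length le_rfl (.ending (x cs'.length).1) ⟨rfl, hz⟩
      (by rw [hlast]; trivial)
    rwa [hgain _ (by simp) (fun y => by
      rw [sum_map_eq_unit rfl (fun r => rfl) y]; simp [weight₂]), sum_weight₁_ending] at this
  have e7 : (l.length : ℝ) - D.ratio D.input * (x 0).unit ≤ e := by
    have := htest 0 (by omega) .len rfl (hMark _ _ trivial fun _ => trivial)
    rw [gain_len, show x 0 :: cs.drop (0 + 1) = cs from rfl, ← hcs, startWeight] at this
    push_cast at this
    linarith
  have hr : (0 : ℝ) < D.ratio D.input := by exact_mod_cast ratio_pos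
  -- The length test bounds the first unit from below by (length - e) / ratio, which is large enough
  -- by `hN`.
  have hU0 : (D.input + N + 3) * 2 ^ N * e < ((x 0).unit : ℝ) := by
    refine lt_of_mul_lt_mul_left (a := (D.ratio D.input : ℝ)) ?_ hr.le
    linarith
  have hM : min N cs'.length ≤ cs'.length := min_le_right _ _
  obtain ⟨ht, hbig⟩ := D.sys.isTrace_of_approx (n := D.input) (τ := fun i => (x i).1)
    (U := fun i => (x i).unit) (X := fun i r => (x i).reg r) (m := min N cs'.length) (N := N)
    (e := e) (min_le_left _ _) he hinit
    (fun i _ r => by exact_mod_cast reg_nonneg _ _) e6 (fun i hi => e1 i (by omega))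
    (fun i hi r => e2 i (by omega) r) (fun i hi r => e3 i (by omega) r)
    (fun i hi => e4 i (by omega)) hU0
  refine ⟨cs'.length, _, _, hlen.le, ht, fun h => ?_⟩
  -- If the whole block is verified, its last unit exceeds e, and the `ending` test would gain this
  -- unit.
  by_contra hacc
  rw [min_eq_right h] at hbig
  exact absurd (e5 hacc) (not_le.2 hbig)

/-- If the system does not accept, every block has a path of weight at least `price + 1`. -/
theorem exists_blockPath_of_not_accepts {μ : ℤ} (hμ : ∀ q a q' c, D.Step q a q' c → μ ≤ c)
    (hμ0 : μ ≤ 0) (hacc : D.accept = D.sys.final) (h : ¬ D.sys.Accepts D.input)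
    {l : List (Letter T R)} (hl : ∀ a ∈ l, a ≠ mark) :
    ∃ s, D.BlockPath μ begin l s ∧ D.price + 1 ≤ s := by
  by_contra! hcon
  rcases l with _ | ⟨a, l⟩
  · refine absurd (hcon (0 + (D.price + 1))
      ⟨begin, 0, _, .nil _, step_begin_mark.2 ⟨rfl, rfl⟩, rfl⟩) (by omega)
  -- Weights are integers, so the error is e = 0, and N may be the block length, which exceeds the
  -- number of steps: the whole block is then a trace.
  · obtain ⟨k, τ, c, hk, ht, hf⟩ := exists_isTrace_of_blockPath_le hμ hμ0 hl le_rfl (fun s hs => by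
      have : s ≤ D.price := by have := hcon s hs; omega
      rw [zero_add]
      exact_mod_cast this) (a :: l).length (by simp; positivity)
    rw [min_eq_right hk] at ht
    exact h ⟨k, τ, c, ht, hacc ▸ hf hk⟩

/-- If the system has no long trace, every block has a path of large weight. -/
theorem exists_blockPath_of_not_hasTrace {μ : ℤ} (hμ : ∀ q a q' c, D.Step q a q' c → μ ≤ c)
    (hμ0 : μ ≤ 0) (hacc : ∀ τ, ¬ D.accept τ) (hprice : D.price = 1) {N : ℕ}
    (h : ¬ D.sys.HasTrace D.input N) :
    ∃ ε : ℝ, 0 < ε ∧ ∀ l : List (Letter T R), (∀ a ∈ l, a ≠ mark) →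
      ∃ s, D.BlockPath μ begin l s ∧ ε * (l.length + 1) ≤ s := by
  -- With e = ε * length, the left-hand side of `hN` is K * ε * length, and ε = 1 / (2 * K) makes it
  -- half the length.
  set K : ℝ := D.ratio D.input * ((D.input + N + 3) * 2 ^ N) + 1 with hK
  have hK1 : 1 ≤ K := by
    have : (0 : ℝ) ≤ D.ratio D.input * ((D.input + N + 3) * 2 ^ N) := by positivity
    linarith
  set ε : ℝ := 1 / (2 * K) with hε
  have hε0 : 0 < ε := by positivity
  have hε1 : ε ≤ 1 := by
    rw [hε, div_le_one (by positivity)]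
    linarith
  refine ⟨ε, hε0, fun l hl => ?_⟩
  by_contra! hcon
  rcases l with _ | ⟨a, l⟩
  · have := hcon (0 + (D.price + 1)) ⟨begin, 0, _, .nil _, step_begin_mark.2 ⟨rfl, rfl⟩, rfl⟩
    rw [hprice] at this
    norm_num at this
    linarith
  · have hpos : (0 : ℝ) < (a :: l).length := by simp; positivity
    obtain ⟨k, τ, c, hk, ht, hf⟩ := exists_isTrace_of_blockPath_le hμ hμ0 hl
      (e := ε * (a :: l).length) (by positivity) (fun s hs => by
      have := hcon s hs
      rw [hprice]
      push_cast
      linarith) N (by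
        have h1 : D.ratio D.input * ((D.input + N + 3) * 2 ^ N * (ε * (a :: l).length))
            + ε * (a :: l).length = K * ε * (a :: l).length := by rw [hK]; ring
        have h2 : K * ε = 1 / 2 := by rw [hε]; field_simp
        rw [h1, h2]
        linarith)
    -- No tag is accepted, so the block cannot stop within the first N steps.
    have hNk : N < k := not_le.1 fun h' => hacc _ (hf h')
    rw [min_eq_left hNk.le] at ht
    exact h ⟨τ, c, ht⟩

end Detector

end MeanPayoff

namespace MeanPayoff

/-! ### Blocks that describe executions -/

namespace Config

variable {T R : Type} [Fintype R]

/-- The configuration with given tag, counters and unit. -/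
noncomputable def ofCounters (τ : T) (c : R → ℤ) (u : ℕ) : Config T R :=
  (τ, List.replicate u none ++
    (Finset.univ : Finset R).toList.flatMap fun r => List.replicate ((c r).toNat * u) (some r))

theorem unit_ofCounters (τ : T) (c : R → ℤ) (u : ℕ) : (ofCounters τ c u).unit = u := by
  classical
  simp only [unit, ofCounters, List.count_append, List.count_replicate_self, Nat.cast_inj,
    Nat.add_eq_left]
  rw [List.count_eq_zero]
  simp

open Classical in
theorem reg_ofCounters (τ : T) {c : R → ℤ} {r : R} (hc : 0 ≤ c r) (u : ℕ) :
    (ofCounters τ c u).reg r = c r * u := by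
  have h : ∀ l : List R, l.Nodup →
      (l.flatMap fun r => List.replicate ((c r).toNat * u) (some r)).count (some r)
        = if r ∈ l then (c r).toNat * u else 0 := by
    intro l
    induction l with
    | nil => simp
    | cons a l ih =>
      intro hl
      rw [List.nodup_cons] at hl
      rw [List.flatMap_cons, List.count_append, ih hl.2, List.count_replicate]
      by_cases h : a = r
      · subst h; simp [hl.1]
      · simp [h, Ne.symm h]
  simp only [reg, ofCounters, List.count_append]
  rw [h _ (Finset.nodup_toList _), List.count_replicate]
  simp [hc]

theorem length_ofCounters (τ : T) (c : R → ℤ) (u : ℕ) :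
    (ofCounters τ c u).2.length = u + ∑ r, (c r).toNat * u := by
  simp [ofCounters, List.length_flatMap]

/-- The description of an execution from step `i` to step `i + j`. -/
noncomputable def execution (τ : ℕ → T) (c : ℕ → R → ℤ) : ℕ → ℕ → List (Config T R)
  | i, 0 => [ofCounters (τ i) (c i) 1]
  | i, j + 1 => ofCounters (τ i) (c i) (2 ^ (j + 1)) :: execution τ c (i + 1) j

theorem exists_execution_eq (τ : ℕ → T) (c : ℕ → R → ℤ) (i j : ℕ) :
    ∃ l, execution τ c i j = ofCounters (τ i) (c i) (2 ^ j) :: l := by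
  cases j
  · exact ⟨_, rfl⟩
  · exact ⟨_, rfl⟩

/-- Halving turns the length into a geometric sum in which the counters grow only linearly. The
constants 4 and 2 are those for which the bound for the tail plus the length of the first
configuration is at most the bound again. -/
theorem length_word_execution_le {τ : ℕ → T} {c : ℕ → R → ℤ} {n : ℕ} (i j : ℕ)
    (hc : ∀ i' ≤ i + j, ∀ r, (c i' r).toNat ≤ n + i') :
    (word (execution τ c i j)).length ≤ 2 ^ j * (4 + 2 * Nat.card R * (n + i + 1)) := by
  have hs : ∀ i' ≤ i + j, ∀ u, ∑ r, (c i' r).toNat * u ≤ Nat.card R * (n + i') * u := by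
    intro i' hi' u
    rw [← Finset.sum_mul, Nat.card_eq_fintype_card]
    refine Nat.mul_le_mul_right _ ?_
    simpa using Finset.sum_le_card_nsmul Finset.univ (fun r => (c i' r).toNat) (n + i')
      (fun r _ => hc i' hi' r)
  induction j generalizing i with
  | zero =>
    have := hs i (by omega) 1
    simp only [execution, word_cons, word_nil, List.append_nil, List.length_cons, List.length_map,
      length_ofCounters, pow_zero, one_mul]
    nlinarith
  | succ j ih =>
    have h1 := hs i (by omega) (2 ^ (j + 1))
    have h2 := ih (i + 1) (fun i' h => hc i' (by omega)) (fun i' h => hs i' (by omega))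
    simp only [execution, word_cons, List.length_cons, List.length_append, List.length_map,
      length_ofCounters]
    have h3 : 1 ≤ 2 ^ j := Nat.one_le_two_pow
    rw [pow_succ] at h1 ⊢
    nlinarith

theorem le_length_word_execution (τ : ℕ → T) (c : ℕ → R → ℤ) (i j : ℕ) :
    2 ^ j ≤ (word (execution τ c i j)).length := by
  obtain ⟨l, h⟩ := exists_execution_eq τ c i j
  simp only [h, word_cons, List.length_cons, List.length_append, List.length_map,
    length_ofCounters]
  omega

end Config

namespace Detector

variable {T R : Type} [Fintype R] {D : Detector T R}

open State Letter Config

/-- The last unit is 1, so an execution that stops at a tag outside `accept` exposes a gain of only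
1. -/
theorem honest_execution {b : ℤ} {n m : ℕ} {τ : ℕ → T} {c : ℕ → R → ℤ}
    (h : D.sys.IsTrace n τ c m) (hb : ¬ D.accept (τ m) → 1 ≤ b) (i j : ℕ) (hij : i + j = m) :
    D.Honest b (execution τ c i j) := by
  have hzero : ∀ i ≤ m, ∀ u r, D.sys.zero (τ i) r → (ofCounters (τ i) (c i) u).reg r = 0 := by
    intro i hi u r hz
    rw [reg_ofCounters _ (h.nonneg i hi r), h.zero i hi r hz, zero_mul]
  induction j generalizing i with
  | zero =>
    refine .single _ (hzero i (by omega) _) fun ha => ?_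
    rw [unit_ofCounters]
    obtain rfl : i = m := by omega
    simpa using hb ha
  | succ j ih =>
    have ih' := ih (i + 1) (by omega)
    obtain ⟨l, hl⟩ := exists_execution_eq τ c (i + 1) j
    rw [execution, hl]
    rw [hl] at ih'
    refine .cons _ _ _ (hzero i (by omega) _) (h.compat i (by omega)) ?_ (fun r => ?_) ih'
    · rw [unit_ofCounters, unit_ofCounters]
      push_cast
      ring
    · rw [reg_ofCounters _ (h.nonneg (i + 1) (by omega) r), reg_ofCounters _
        (h.nonneg i (by omega) r), unit_ofCounters, h.step i (by omega)]
      simp only [ofCounters]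
      push_cast
      ring

/-- Each execution is described by some block over which all paths have small weight. -/
theorem exists_block {μ : ℤ} (hμ : ∀ q a q' c, D.Step q a q' c → μ ≤ c) {b : ℤ} (hb0 : 0 ≤ b)
    {m : ℕ} {τ : ℕ → T} {c : ℕ → R → ℤ} (h : D.sys.IsTrace D.input τ c m)
    (hb : ¬ D.accept (τ m) → 1 ≤ b) :
    ∃ l : List (Letter T R), (∀ a ∈ l, a ≠ mark) ∧ 2 ^ m ≤ l.length ∧
      l.length ≤ 2 ^ m * D.ratio D.input ∧
      ∀ s, D.BlockPath μ begin l s → s ≤ D.price + b := by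
  have hc : ∀ i ≤ m, ∀ r, (c i r).toNat ≤ D.input + i := by
    intro i
    induction i with
    | zero =>
      intro _ r
      rw [h.start]
      have h1 := D.sys.input_nonneg r
      have h2 := D.sys.input_le r
      have : (D.input : ℤ) * D.sys.input r ≤ D.input := by nlinarith
      omega
    | succ i ih =>
      intro hi r
      have h1 := ih (by omega) r
      have h2 := abs_le.1 (D.sys.abs_delta_le (τ i) r)
      rw [h.step i (by omega)]
      omega
  have hlen := length_word_execution_le (τ := τ) (c := c) (n := D.input) 0 m
    (fun i hi => hc i (by omega))
  obtain ⟨l, hl⟩ := exists_execution_eq τ c 0 m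
  refine ⟨word (execution τ c 0 m), fun a => ne_mark_of_mem_word,
    le_length_word_execution _ _ _ _, hlen, fun s hs => ?_⟩
  have hh := honest_execution h hb 0 m (zero_add m)
  rw [hl] at hs hh hlen
  refine blockPath_begin_le hμ hb0 hh h.init (fun r => ?_) ?_ hs
  · rw [reg_ofCounters _ (h.nonneg 0 (by omega) r), unit_ofCounters, h.start]
  · rw [unit_ofCounters]
    have : ((2 ^ m * (4 + 2 * Nat.card R * (D.input + 0 + 1)) : ℕ) : ℤ)
        = D.ratio D.input * (2 ^ m : ℕ) := by
      simp only [ratio]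
      push_cast
      ring
    rw [← this]
    exact_mod_cast hlen

end Detector

end MeanPayoff

namespace MeanPayoff

/-! ### Infinite words and runs that consist of blocks -/

section Blocks

/-- The index of the block that contains a given position. -/
theorem exists_index {t : ℕ → ℕ} (ht : StrictMono t) (h0 : t 0 = 0) : ∃ idx : ℕ → ℕ,
    (∀ i, t (idx i) ≤ i ∧ i < t (idx i + 1)) ∧
      ∀ k i, t k ≤ i → i < t (k + 1) → idx i = k := by
  have h : ∀ i, ∃ k, t k ≤ i ∧ i < t (k + 1) := by
    intro i
    induction i with
    | zero => exact ⟨0, h0.le, by have := ht (Nat.lt_add_one 0); omega⟩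
    | succ i ih =>
      obtain ⟨k, h1, h2⟩ := ih
      by_cases h3 : i + 1 < t (k + 1)
      · exact ⟨k, by omega, h3⟩
      · exact ⟨k + 1, by omega, by have := ht (Nat.lt_add_one (k + 1)); omega⟩
  choose idx hidx using h
  refine ⟨idx, hidx, fun k i h1 h2 => ?_⟩
  obtain ⟨h3, h4⟩ := hidx i
  have h5 := ht.lt_iff_lt.1 (lt_of_le_of_lt h1 h4)
  have h6 := ht.lt_iff_lt.1 (lt_of_le_of_lt h3 h2)
  omega

/-- The concatenation of a sequence of nonempty words. -/
theorem exists_concat {A : Type} (f : ℕ → List A) (hf : ∀ k, f k ≠ []) : ∃ w : ℕ → A,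
    ∀ k j (h : j < (f k).length), w ((∑ i ∈ Finset.range k, (f i).length) + j) = (f k)[j] := by
  set t : ℕ → ℕ := fun k => ∑ i ∈ Finset.range k, (f i).length with ht
  have hsucc : ∀ k, t (k + 1) = t k + (f k).length := fun k => Finset.sum_range_succ _ _
  have hmono : StrictMono t := strictMono_nat_of_lt_succ fun k => by
    have := List.length_pos_iff.2 (hf k)
    rw [hsucc]
    omega
  obtain ⟨idx, h1, h2⟩ := exists_index hmono (by simp [ht])
  refine ⟨fun i => (f (idx i))[i - t (idx i)]'(by
    have := h1 i
    rw [hsucc] at this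
    omega), fun k j hj => ?_⟩
  have h3 : idx (t k + j) = k := h2 k _ (by omega) (by rw [hsucc]; omega)
  have h4 : t k + j - t (idx (t k + j)) = j := by rw [h3]; omega
  have h5 : ∀ k' j' (h' : j' < (f k').length), k' = k → j' = j → (f k')[j'] = (f k)[j] := by
    rintro _ _ _ rfl rfl
    rfl
  exact h5 _ _ _ h3 h4

variable {Q A : Type} {S : Q → A → Q → ℤ → Prop}

theorem Path.exists_fun {m : ℤ} {q q' : Q} {l : List A} {s : ℤ} (h : Path S m q l q' s) :
    ∃ (ρ : ℕ → Q) (c : ℕ → ℤ), ρ 0 = q ∧ ρ l.length = q' ∧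
      (∀ j (hj : j < l.length), S (ρ j) l[j] (ρ (j + 1)) (c j) ∧ m ≤ c j) ∧
      ∑ j ∈ Finset.range l.length, c j = s := by
  induction h with
  | nil q => exact ⟨fun _ => q, fun _ => 0, rfl, rfl, by simp, by simp⟩
  | @cons q a q' c l q'' s h1 h2 _ ih =>
    obtain ⟨ρ, d, h3, h4, h5, h6⟩ := ih
    refine ⟨fun | 0 => q | j + 1 => ρ j, fun | 0 => c | j + 1 => d j, rfl, h4, fun j hj => ?_, ?_⟩
    · rcases j with _ | j
      · simpa [h3] using ⟨h1, h2⟩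
      · exact h5 j (by simpa using hj)
    · rw [List.length_cons, Finset.sum_range_succ', ← h6, add_comm]

theorem Path.of_fun {m : ℤ} {r : ℕ → Q} {w : ℕ → A} {c : ℕ → ℤ}
    (h : ∀ i, S (r i) (w i) (r (i + 1)) (c i) ∧ m ≤ c i) (l : List A) (t : ℕ)
    (hl : ∀ j (hj : j < l.length), w (t + j) = l[j]) :
    Path S m (r t) l (r (t + l.length)) (∑ j ∈ Finset.range l.length, c (t + j)) := by
  induction l generalizing t with
  | nil => exact .nil _
  | cons a l ih =>
    have h1 := ih (t + 1) (fun j hj => by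
      have := hl (j + 1) (by simpa using hj)
      rw [add_assoc, add_comm 1 j]
      simpa using this)
    have h2 := hl 0 (by simp)
    simp only [add_zero, List.getElem_cons_zero] at h2
    have h3 := h t
    rw [h2] at h3
    rw [List.length_cons, Finset.sum_range_succ']
    have h4 := Path.cons h3.1 h3.2 h1
    rw [add_zero, add_comm _ (c t)]
    simpa only [add_assoc, add_comm, add_left_comm] using h4

/-- Runs over the blocks of a word can be put together. -/
theorem exists_run_of_blocks {w : ℕ → A} {t : ℕ → ℕ} (ht : StrictMono t) (h0 : t 0 = 0) {q₀ : Q}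
    {μ σ : ℕ → ℤ} (h : ∀ k, ∃ (ρ : ℕ → Q) (c : ℕ → ℤ), ρ 0 = q₀ ∧ ρ (t (k + 1) - t k) = q₀ ∧
      (∀ j < t (k + 1) - t k, S (ρ j) (w (t k + j)) (ρ (j + 1)) (c j)) ∧
      (∀ j, j + 1 < t (k + 1) - t k → μ k ≤ c j) ∧
      ∑ j ∈ Finset.range (t (k + 1) - t k), c j = σ k) :
    ∃ (r : ℕ → Q) (c : ℕ → ℤ), r 0 = q₀ ∧ (∀ i, S (r i) (w i) (r (i + 1)) (c i)) ∧
      (∀ k, ∑ i ∈ Finset.range (t k), c i = ∑ j ∈ Finset.range k, σ j) ∧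
      ∀ k i, t k ≤ i → i + 1 < t (k + 1) → μ k ≤ c i := by
  choose ρ c h1 h2 h3 h4 h5 using h
  obtain ⟨idx, hi1, hi2⟩ := exists_index ht h0
  have hlt : ∀ k, t k < t (k + 1) := fun k => ht (Nat.lt_succ_self k)
  refine ⟨fun i => ρ (idx i) (i - t (idx i)), fun i => c (idx i) (i - t (idx i)), ?_, fun i => ?_,
    fun k => ?_, fun k i hk hi => ?_⟩
  · have : idx 0 = 0 := hi2 0 0 h0.le (by have := hlt 0; omega)
    simp only [this, h0, Nat.sub_zero]
    exact h1 0
  · obtain ⟨h6, h7⟩ := hi1 i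
    have h8 := h3 (idx i) (i - t (idx i)) (by omega)
    rw [show t (idx i) + (i - t (idx i)) = i by omega] at h8
    by_cases h9 : i + 1 < t (idx i + 1)
    · have h10 : idx (i + 1) = idx i := hi2 _ _ (by omega) h9
      simp only [h10]
      rwa [show i + 1 - t (idx i) = i - t (idx i) + 1 by omega]
    · have h10 : idx (i + 1) = idx i + 1 := hi2 _ _ (by omega) (by
        have := hlt (idx i + 1); omega)
      simp only [h10]
      rw [show i + 1 - t (idx i + 1) = 0 by omega, h1]
      rwa [show i - t (idx i) + 1 = t (idx i + 1) - t (idx i) by omega, h2] at h8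
  · induction k with
    | zero => simp [h0]
    | succ k ih =>
      have h6 := hlt k
      rw [Finset.sum_range_succ, ← ih, ← h5 k,
        ← Finset.sum_range_add_sum_Ico _ h6.le, Finset.sum_Ico_eq_sum_range]
      congr 1
      refine Finset.sum_congr rfl fun j hj => ?_
      rw [Finset.mem_range] at hj
      have h7 : idx (t k + j) = k := hi2 k _ (by omega) (by omega)
      rw [h7, show t k + j - t k = j by omega]
  · have h6 : idx i = k := hi2 k i hk (by omega)
    simp only [h6]
    exact h4 k _ (by omega)

/-- The positions of a letter that occurs infinitely often, as a sequence. -/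
theorem exists_block_positions {w : ℕ → A} {a : A} (h : ∀ i, ∃ j ≥ i, w j = a) : ∃ t : ℕ → ℕ,
    StrictMono t ∧ t 0 = 0 ∧ ∀ k, w (t (k + 1) - 1) = a ∧
      ∀ i, t k ≤ i → i + 1 < t (k + 1) → w i ≠ a := by
  classical
  set t : ℕ → ℕ := fun k => Nat.rec 0 (fun _ i => Nat.find (h i) + 1) k with ht
  have hsucc : ∀ k, t (k + 1) = Nat.find (h (t k)) + 1 := fun k => rfl
  refine ⟨t, strictMono_nat_of_lt_succ fun k => ?_, rfl, fun k => ⟨?_, fun i h1 h2 h3 => ?_⟩⟩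
  · have := (Nat.find_spec (h (t k))).1
    rw [hsucc]
    omega
  · rw [hsucc]
    exact (Nat.find_spec (h (t k))).2
  · rw [hsucc] at h2
    exact Nat.find_min (h (t k)) (by omega) ⟨h1, h3⟩

end Blocks

namespace Detector

variable {T R : Type} {D : Detector T R}

open State Letter

/-- A run of the detector over a word, with its weights. -/
structure IsRun (D : Detector T R) (w : ℕ → Letter T R) (r : ℕ → State T R) (c : ℕ → ℤ) :
    Prop where
  start : r 0 = begin
  step : ∀ i, D.Step (r i) (w i) (r (i + 1)) (c i)

/-- There are finitely many triples of source, letter and target, each with at most one weight. -/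
theorem exists_weight_bound [Finite T] [Finite R] (D : Detector T R) :
    ∃ W : ℕ, 1 ≤ W ∧ ∀ q a q' c, D.Step q a q' c → |c| ≤ W := by
  have := Fintype.ofFinite T
  have := Fintype.ofFinite R
  classical
  have h : ∀ x : State T R × Letter T R × State T R, ∃ W : ℕ, ∀ c, D.Step x.1 x.2.1 x.2.2 c →
      |c| ≤ W := by
    intro x
    by_cases hx : ∃ c, D.Step x.1 x.2.1 x.2.2 c
    · obtain ⟨c, hc⟩ := hx
      refine ⟨c.natAbs, fun c' hc' => ?_⟩
      rw [hc'.unique hc, Int.natCast_natAbs]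
    · exact ⟨0, fun c hc => absurd ⟨c, hc⟩ hx⟩
  choose W hW using h
  obtain ⟨B, hB⟩ := (Set.finite_range W).bddAbove
  refine ⟨B + 1, by omega, fun q a q' c hc => (hW (q, a, q') c hc).trans ?_⟩
  have := hB (Set.mem_range_self (q, a, q'))
  push_cast
  have : (W (q, a, q') : ℤ) ≤ B := by exact_mod_cast this
  linarith

/-- Over a word with finitely many letters `mark`, some run has finally only weights `1`. -/
theorem exists_isRun_of_eventually_ne {w : ℕ → Letter T R} {t : ℕ} (h : ∀ i ≥ t, w i ≠ mark) :
    ∃ r c, D.IsRun w r c ∧ ∀ i ≥ t, c i = 1 := by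
  classical
  set ρ : ℕ → State T R := fun i => Nat.rec begin (fun i q => (D.usual q (w i)).1) i with hρ
  have hsucc : ∀ i, ρ (i + 1) = (D.usual (ρ i) (w i)).1 := fun i => rfl
  have hρi : ∀ i, ρ i = begin ∨ ρ i = idle := by
    intro i
    induction i with
    | zero => exact .inl rfl
    | succ i ih =>
      rw [hsucc]
      rcases ih with ih | ih <;> rw [ih] <;> rcases w i with _ | _ | _ <;> simp [usual]
  -- Default transitions keep the run in `begin` or `idle`, from which the sink can be entered at
  -- position t after the last mark.
  refine ⟨fun i => if i ≤ t then ρ i else sink, fun i => if i < t then (D.usual (ρ i) (w i)).2 else 1,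
    ⟨by simp [hρ], fun i => ?_⟩, fun i hi => by simp [not_lt.2 hi]⟩
  rcases lt_trichotomy i t with hi | rfl | hi
  · simp only [hi.le, hi, if_true, Nat.succ_le_iff.2 hi]
    rw [hsucc]
    exact .usual _ _
  · simp only [le_refl, if_true, lt_irrefl, if_false, Nat.not_succ_le_self]
    rcases hρi i with h' | h' <;> rw [h']
    · exact .sink_of_begin _ (h i le_rfl)
    · exact .sink_of_idle _ (h i le_rfl)
  · have hi' := h i hi.le
    simp only [not_le.2 hi, not_lt.2 hi.le, if_false, not_le.2 (show t < i + 1 by omega)]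
    rcases hw : w i with _ | τ | x
    · exact absurd hw hi'
    · exact .usual sink (start τ)
    · exact .usual sink (sym x)

/-- Choosing a path for each block of a word yields a run. -/
theorem exists_isRun_of_blocks {w : ℕ → Letter T R} (h : ∀ i, ∃ j ≥ i, w j = mark)
    (P : ℕ → ℕ → ℤ → ℤ → Prop)
    (hP : ∀ (i : ℕ) (l : List (Letter T R)), (∀ a ∈ l, a ≠ mark) →
      ∃ μ s, D.BlockPath μ begin l s ∧ P i l.length μ s) :
    ∃ (t : ℕ → ℕ) (μ σ : ℕ → ℤ) (r : ℕ → State T R) (c : ℕ → ℤ), StrictMono t ∧ t 0 = 0 ∧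
      D.IsRun w r c ∧ (∀ k, P (t k) (t (k + 1) - 1 - t k) (μ k) (σ k)) ∧
      (∀ k, ∑ i ∈ Finset.range (t k), c i = ∑ j ∈ Finset.range k, σ j) ∧
      ∀ k i, t k ≤ i → i + 1 < t (k + 1) → μ k ≤ c i := by
  obtain ⟨t, ht, ht0, hw⟩ := exists_block_positions h
  have hlt : ∀ k, t k < t (k + 1) := fun k => ht (Nat.lt_succ_self k)
  set l : ℕ → List (Letter T R) := fun k =>
    List.ofFn fun j : Fin (t (k + 1) - 1 - t k) => w (t k + j) with hl
  have hlen : ∀ k, (l k).length = t (k + 1) - 1 - t k := fun k => by simp [hl]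
  have hne : ∀ k, ∀ a ∈ l k, a ≠ mark := by
    intro k a ha
    obtain ⟨j, rfl⟩ := (List.mem_ofFn' _ _).1 ha
    exact (hw k).2 _ (by omega) (by have := j.2; omega)
  choose μ σ hbp hp using fun k => hP (t k) (l k) (hne k)
  obtain ⟨r, c, h1, h2, h3, h4⟩ := exists_run_of_blocks (S := D.Step) (w := w) ht ht0
    (q₀ := begin) (μ := μ) (σ := σ) (fun k => by
      obtain ⟨q', s', d, h1, h2, h3⟩ := hbp k
      obtain ⟨ρ, c, h4, h5, h6, h7⟩ := h1.exists_fun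
      have hk := hlt k
      rw [hlen] at h5 h7
      have hd : t (k + 1) - t k = t (k + 1) - 1 - t k + 1 := by omega
      refine ⟨fun j => if j ≤ t (k + 1) - 1 - t k then ρ j else begin,
        fun j => if j < t (k + 1) - 1 - t k then c j else d, by simpa using h4, ?_, fun j hj => ?_,
        fun j hj => ?_, ?_⟩
      · rw [hd]; simp
      · rcases Nat.lt_or_ge j (t (k + 1) - 1 - t k) with hj' | hj'
        · have := (h6 j (by rw [hlen]; exact hj')).1
          simp only [hj'.le, hj', if_true, Nat.succ_le_iff.2 hj']
          simpa [hl] using this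
        · obtain rfl : j = t (k + 1) - 1 - t k := by omega
          simp only [le_refl, if_true, lt_irrefl, if_false, Nat.not_succ_le_self]
          rw [h5, show t k + (t (k + 1) - 1 - t k) = t (k + 1) - 1 by omega, (hw k).1]
          exact h2
      · beta_reduce
        rw [if_pos (by omega)]
        exact (h6 j (by rw [hlen]; omega)).2
      · rw [hd, Finset.sum_range_succ, if_neg (lt_irrefl _), h3, ← h7]
        congr 1
        exact Finset.sum_congr rfl fun j hj => by rw [if_pos (Finset.mem_range.1 hj)])
  exact ⟨t, μ, σ, r, c, ht, ht0, ⟨h1, h2⟩, fun k => by rw [← hlen]; exact hp k, h3, h4⟩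

/-- An upper bound for the weights of all runs over a word that consists of given blocks. -/
theorem sum_le_of_blocks {W : ℕ} (hW1 : 1 ≤ W) (hW : ∀ q a q' c, D.Step q a q' c → |c| ≤ W)
    {l : ℕ → List (Letter T R)} {B : ℤ} (hB : -1 ≤ B)
    (hs : ∀ k s, D.BlockPath (-W) begin (l k) s → s ≤ B) {Λ : ℕ → ℕ} (hΛ : Monotone Λ)
    (hlΛ : ∀ k, (l k).length + 1 ≤ Λ k) {w : ℕ → Letter T R}
    (hw : ∀ k j (h : j < (l k ++ [mark]).length),
      w ((∑ i ∈ Finset.range k, (l i ++ [mark]).length) + j) = (l k ++ [mark])[j])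
    {r : ℕ → State T R} {c : ℕ → ℤ} (hr : D.IsRun w r c) (k i : ℕ)
    (hi : ∑ i ∈ Finset.range k, (l i ++ [mark]).length ≤ i)
    (hi' : i < ∑ i ∈ Finset.range (k + 1), (l i ++ [mark]).length) :
    ∑ j ∈ Finset.range i, c j ≤ B * k + (2 * W + 1) * Λ k := by
  set t : ℕ → ℕ := fun k => ∑ i ∈ Finset.range k, (l i ++ [mark]).length with ht
  have hsucc : ∀ k, t (k + 1) = t k + (l k ++ [mark]).length := fun k => Finset.sum_range_succ _ _
  have hlen : ∀ k, (l k ++ [mark]).length = (l k).length + 1 := fun k => by simp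
  have hc : ∀ i, |c i| ≤ W := fun i => hW _ _ _ _ (hr.step i)
  have hm : ∀ i, D.Step (r i) (w i) (r (i + 1)) (c i) ∧ -(W : ℤ) ≤ c i := fun i =>
    ⟨hr.step i, (abs_le.1 (hc i)).1⟩
  have hbound : ∀ a b : ℕ, ∑ j ∈ Finset.range b, c (a + j) ≤ W * b := by
    intro a b
    have := Finset.sum_le_card_nsmul (Finset.range b) (fun j => c (a + j)) W
      (fun j _ => (abs_le.1 (hc _)).2)
    rw [Finset.card_range, nsmul_eq_mul, mul_comm] at this
    exact this
  have hsum : ∀ a b : ℕ, ∑ j ∈ Finset.range (a + b), c j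
      = ∑ j ∈ Finset.range a, c j + ∑ j ∈ Finset.range b, c (a + j) :=
    fun a b => Finset.sum_range_add _ _ _
  have hW1' : (1 : ℤ) ≤ W := by exact_mod_cast hW1
  have hΛ1 : ∀ k, (1 : ℤ) ≤ Λ k := fun k => by have := hlΛ k; omega
  -- At block boundaries a run is in `begin` or dead. Death costs at most one uncontrolled block,
  -- hence the term with `Λ`; afterwards each nonempty block weighs at most -1, which is at most B.
  have key : ∀ k, (r (t k) = begin ∧ ∑ j ∈ Finset.range (t k), c j ≤ B * k) ∨
      (r (t k) = dead ∧ ∑ j ∈ Finset.range (t k), c j ≤ B * k + (W + 1) * Λ k) := by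
    intro k
    induction k with
    | zero => exact .inl ⟨by simpa [ht] using hr.start, by simp [ht]⟩
    | succ k ih =>
      have hp := Path.of_fun hm (l k ++ [mark]) (t k) (hw k)
      rw [← hsucc] at hp
      have hsk := hsum (t k) (l k ++ [mark]).length
      rw [← hsucc] at hsk
      have hbk := hbound (t k) (l k ++ [mark]).length
      have hlk : ((l k ++ [mark]).length : ℤ) ≤ Λ k := by
        rw [hlen]; exact_mod_cast hlΛ k
      have hmono : (Λ k : ℤ) ≤ Λ (k + 1) := by exact_mod_cast hΛ (Nat.le_succ k)
      have hΛk := hΛ1 k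
      rcases ih with ⟨h1, h2⟩ | ⟨h1, h2⟩
      · obtain ⟨q', s₁, hp1, hp2⟩ := Path.append_iff.1 hp
        obtain ⟨q'', d, hd1, hd2, hd3⟩ := Path.cons_iff.1 hp2
        obtain ⟨rfl, hd4⟩ := Path.nil_iff.1 hd3
        rcases step_mark hd1 with h3 | h3
        · left
          refine ⟨h3, ?_⟩
          have := hs k _ ⟨q', s₁, d, by rw [← h1]; exact hp1, by rw [← h3]; exact hd1, rfl⟩
          rw [hsk]
          push_cast
          linarith
        · right
          refine ⟨h3, ?_⟩
          rw [hsk]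
          push_cast
          nlinarith
      · right
        have h3 : ∀ j, r (t k + j) = dead := by
          intro j
          induction j with
          | zero => exact h1
          | succ j ih =>
            have := hr.step (t k + j)
            rw [ih, step_dead] at this
            exact this.1
        have h4 : ∀ j, c (t k + j) = -1 := by
          intro j
          have := hr.step (t k + j)
          rw [h3, step_dead] at this
          exact this.2
        refine ⟨by rw [hsucc]; exact h3 _, ?_⟩
        rw [hsk]
        simp only [h4, Finset.sum_const, Finset.card_range, hlen]
        push_cast
        simp only [nsmul_eq_mul]
        push_cast
        nlinarith
  change t k ≤ i at hi
  change i < t (k + 1) at hi'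
  have hik : i = t k + (i - t k) := by omega
  have h1 := hsum (t k) (i - t k)
  rw [← hik] at h1
  have h2 := hbound (t k) (i - t k)
  have h3 : ((i - t k : ℕ) : ℤ) ≤ Λ k := by
    have := hsucc k
    have h4 := hlΛ k
    rw [hlen] at this
    have : i - t k ≤ Λ k := by omega
    exact_mod_cast this
  have h5 : (W : ℤ) * ((i - t k : ℕ) : ℤ) ≤ W * Λ k := by gcongr
  have hΛk := hΛ1 k
  rcases key k with ⟨_, h4⟩ | ⟨_, h4⟩
  · rw [h1]; nlinarith
  · rw [h1]; linarith

end Detector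

end MeanPayoff

namespace MeanPayoff

/-! ### Mean payoffs of bounded sequences -/

theorem abs_average_le {x : ℕ → ℝ} {W : ℝ} (hx : ∀ i, |x i| ≤ W) (n : ℕ) : |average x n| ≤ W := by
  have hW : 0 ≤ W := (abs_nonneg _).trans (hx 0)
  rcases Nat.eq_zero_or_pos n with rfl | hn
  · simpa [average] using hW
  · have hn' : (0 : ℝ) < n := by exact_mod_cast hn
    rw [average, abs_mul, abs_of_pos (by positivity), one_div, inv_mul_le_iff₀ hn']
    refine (Finset.abs_sum_le_sum_abs _ _).trans ?_
    simpa using Finset.sum_le_card_nsmul (Finset.range n) (fun i => |x i|) W (fun i _ => hx i)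

theorem isBoundedUnder_average {x : ℕ → ℝ} {W : ℝ} (hx : ∀ i, |x i| ≤ W) :
    IsBoundedUnder (· ≤ ·) atTop (average x) ∧ IsBoundedUnder (· ≥ ·) atTop (average x) :=
  ⟨isBoundedUnder_of ⟨W, fun n => (abs_le.1 (abs_average_le hx n)).2⟩,
    isBoundedUnder_of ⟨-W, fun n => (abs_le.1 (abs_average_le hx n)).1⟩⟩

/-- Bounding the limsup covers both kinds. The uniform bound on the terms makes liminf and limsup
genuine rather than default values. -/
theorem LimitKind.val_le (v : LimitKind) {x f : ℕ → ℝ} {W a : ℝ} (hx : ∀ i, |x i| ≤ W)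
    (hf : ∀ᶠ n in atTop, average x n ≤ f n) (ha : Tendsto f atTop (nhds a)) : v.val x ≤ a := by
  obtain ⟨h1, h2⟩ := isBoundedUnder_average hx
  have h3 : limsup (average x) atTop ≤ a := by
    rw [← ha.limsup_eq]
    exact limsup_le_limsup hf h2.isCoboundedUnder_le ha.isBoundedUnder_le
  cases v with
  | limSupAvg => exact h3
  | limInfAvg => exact (liminf_le_limsup h1 h2).trans h3

theorem LimitKind.le_val (v : LimitKind) {x f : ℕ → ℝ} {W a : ℝ} (hx : ∀ i, |x i| ≤ W)
    (hf : ∀ᶠ n in atTop, f n ≤ average x n) (ha : Tendsto f atTop (nhds a)) : a ≤ v.val x := by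
  obtain ⟨h1, h2⟩ := isBoundedUnder_average hx
  have h3 : a ≤ liminf (average x) atTop := by
    rw [← ha.liminf_eq]
    exact liminf_le_liminf hf ha.isBoundedUnder_ge h1.isCoboundedUnder_ge
  cases v with
  | limSupAvg => exact h3.trans (liminf_le_limsup h1 h2)
  | limInfAvg => exact h3

theorem LimitKind.abs_val_le (v : LimitKind) {x : ℕ → ℝ} {W : ℝ} (hx : ∀ i, |x i| ≤ W) :
    |v.val x| ≤ W :=
  abs_le.2 ⟨v.le_val hx (.of_forall fun n => (abs_le.1 (abs_average_le hx n)).1)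
    tendsto_const_nhds, v.val_le hx (.of_forall fun n => (abs_le.1 (abs_average_le hx n)).2)
    tendsto_const_nhds⟩

/-- Small averages along a subsequence suffice, but for the liminf only. This is why emptiness is
treated with `limInfAvg`. -/
theorem liminf_average_le {x : ℕ → ℝ} {W a : ℝ} (hx : ∀ i, |x i| ≤ W)
    (hf : ∃ᶠ n in atTop, average x n ≤ a) : LimitKind.limInfAvg.val x ≤ a :=
  liminf_le_of_frequently_le hf (isBoundedUnder_average hx).2

/-! ### Runs of automata -/

namespace WeightedAutomaton

variable {Q A : Type} (M : WeightedAutomaton Q A)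

theorem exists_isRun (w : ℕ → A) : ∃ r, M.IsRun w r := by
  choose next hnext using M.total
  let r : ℕ → Q := fun i => Nat.rec M.init (fun i q => next q (w i)) i
  exact ⟨r, rfl, fun i => hnext (r i) (w i)⟩

theorem exists_bound [Finite Q] [Finite A] : ∃ W : ℝ, ∀ w r i, |M.weights w r i| ≤ W := by
  obtain ⟨W, hW⟩ := (Set.finite_range fun x : Q × A × Q =>
    |(M.wt x.1 x.2.1 x.2.2 : ℝ)|).bddAbove
  exact ⟨W, fun w r i => hW (Set.mem_range_self (r i, w i, r (i + 1)))⟩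

/-- The values of the runs over a word. -/
def values (v : LimitKind) (w : ℕ → A) : Set ℝ :=
  {x : ℝ | ∃ r, M.IsRun w r ∧ x = v.val (M.weights w r)}

theorem values_nonempty (v : LimitKind) (w : ℕ → A) : (M.values v w).Nonempty := by
  obtain ⟨r, hr⟩ := M.exists_isRun w
  exact ⟨_, r, hr, rfl⟩

theorem bdd_values [Finite Q] [Finite A] (v : LimitKind) (w : ℕ → A) :
    BddAbove (M.values v w) ∧ BddBelow (M.values v w) := by
  obtain ⟨W, hW⟩ := M.exists_bound
  constructor
  · refine ⟨W, ?_⟩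
    rintro _ ⟨r, _, rfl⟩
    exact (abs_le.1 (v.abs_val_le (hW w r))).2
  · refine ⟨-W, ?_⟩
    rintro _ ⟨r, _, rfl⟩
    exact (abs_le.1 (v.abs_val_le (hW w r))).1

theorem lang_eq (v : LimitKind) (w : ℕ → A) : M.lang v w = sSup (M.values v w) := rfl

/-- `r` follows the strategy `s`. -/
def Follows (s : List Q → Q → Q) (r : ℕ → Q) : Prop :=
  r 0 = M.init ∧ ∀ i, r (i + 1) = s ((List.range i).map r) (r i)

/-- The pair of history and current state evolves by iterating one function. -/
theorem existsUnique_follows (s : List Q → Q → Q) : ∃! r, M.Follows s r := by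
  set g : List Q × Q → List Q × Q := fun x => (x.1 ++ [x.2], s x.1 x.2) with hg
  have h : ∀ r, M.Follows s r → ∀ i, ((List.range i).map r, r i) = g^[i] ([], M.init) := by
    rintro r ⟨h0, hr⟩ i
    induction i with
    | zero => simp [h0]
    | succ i ih =>
      rw [Function.iterate_succ_apply', ← ih, hg]
      simp [List.range_succ, hr i]
  have h' : ∀ i, (g^[i] ([], M.init)).1 = (List.range i).map fun j => (g^[j] ([], M.init)).2 := by
    intro i
    induction i with
    | zero => rfl
    | succ i ih =>
      rw [Function.iterate_succ_apply', List.range_succ, List.map_append, ← ih]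
      rfl
  refine ⟨fun i => (g^[i] ([], M.init)).2, ⟨rfl, fun i => ?_⟩, fun r hr => ?_⟩
  · rw [← h' i]
    simp only [Function.iterate_succ_apply']
    rfl
  · funext i
    rw [← h r hr i]

end WeightedAutomaton

namespace AlternatingAutomaton

variable {Q A : Type} (M : AlternatingAutomaton Q A)

theorem exists_isStrategy (w : ℕ → A) : ∃ s, M.IsStrategy w s := by
  choose next hnext using M.total
  exact ⟨fun h q => next q (w h.length), fun h q => hnext _ _⟩

theorem isRun_of_follows {w : ℕ → A} {s : List Q → Q → Q} {r : ℕ → Q} (hs : M.IsStrategy w s)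
    (hr : M.Follows s r) : M.IsRun w r := by
  refine ⟨hr.1, fun i => ?_⟩
  have := hs ((List.range i).map r) (r i)
  rw [← hr.2 i] at this
  simpa using this

/-- The strategy reads its position from the length of the history. Away from `r` it falls back on
an arbitrary strategy, because legality is required on all histories. -/
theorem exists_isStrategy_of_isRun {w : ℕ → A} {r : ℕ → Q} (hr : M.IsRun w r) :
    ∃ s, M.IsStrategy w s ∧ M.Follows s r := by
  classical
  obtain ⟨s, hs⟩ := M.exists_isStrategy w
  refine ⟨fun h q => if q = r h.length then r (h.length + 1) else s h q, fun h q => ?_, hr.1,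
    fun i => by simp⟩
  beta_reduce
  split_ifs with h'
  · rw [h']
    exact hr.2 _
  · exact hs h q

theorem lang_of_isMax (hM : ∀ q, M.isMax q = true) (v : LimitKind) (w : ℕ → A) :
    M.lang v w = M.toWeightedAutomaton.lang v w := by
  have h : ∀ s t r, M.IsOutcome s t r ↔ M.Follows s r := by
    intro s t r
    simp [IsOutcome, WeightedAutomaton.Follows, hM]
  rw [lang, WeightedAutomaton.lang]
  congr 1
  ext x
  constructor
  · rintro ⟨s, hs, rfl⟩
    obtain ⟨r, hr, hu⟩ := M.existsUnique_follows s
    refine ⟨r, M.isRun_of_follows hs hr, ?_⟩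
    have : {y : ℝ | ∃ t, M.IsStrategy w t ∧ ∃ r, M.IsOutcome s t r ∧ y = v.val (M.weights w r)}
        = {v.val (M.weights w r)} := by
      ext y
      simp only [h, Set.mem_ofPred_eq, Set.mem_singleton_iff]
      constructor
      · rintro ⟨_, _, r', hr', rfl⟩
        rw [hu r' hr']
      · rintro rfl
        exact ⟨s, hs, r, hr, rfl⟩
    rw [this, csInf_singleton]
  · rintro ⟨r, hr, rfl⟩
    obtain ⟨s, hs, hf⟩ := M.exists_isStrategy_of_isRun hr
    refine ⟨s, hs, ?_⟩
    have : {y : ℝ | ∃ t, M.IsStrategy w t ∧ ∃ r, M.IsOutcome s t r ∧ y = v.val (M.weights w r)}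
        = {v.val (M.weights w r)} := by
      ext y
      simp only [h, Set.mem_ofPred_eq, Set.mem_singleton_iff]
      constructor
      · rintro ⟨_, _, r', hr', rfl⟩
        rw [(M.existsUnique_follows s).unique hr' hf]
      · rintro rfl
        exact ⟨s, hs, r, hf, rfl⟩
    rw [this, csInf_singleton]

/-- The choices of player 1 never matter, so the inner infimum ranges over all runs and the outer
supremum is over a single number. -/
theorem lang_of_not_isMax (hM : ∀ q, M.isMax q = false) (v : LimitKind) (w : ℕ → A) :
    M.lang v w = sInf (M.values v w) := by
  have h : ∀ s t r, M.IsOutcome s t r ↔ M.Follows t r := by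
    intro s t r
    simp [IsOutcome, WeightedAutomaton.Follows, hM]
  have h' : ∀ s, {y : ℝ | ∃ t, M.IsStrategy w t ∧
      ∃ r, M.IsOutcome s t r ∧ y = v.val (M.weights w r)} = M.values v w := by
    intro s
    ext y
    simp only [h, WeightedAutomaton.values, Set.mem_ofPred_eq]
    constructor
    · rintro ⟨t, ht, r, hr, rfl⟩
      exact ⟨r, M.isRun_of_follows ht hr, rfl⟩
    · rintro ⟨r, hr, rfl⟩
      obtain ⟨t, ht, hf⟩ := M.exists_isStrategy_of_isRun hr
      exact ⟨t, ht, r, hf, rfl⟩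
  obtain ⟨s, hs⟩ := M.exists_isStrategy w
  have : {x : ℝ | ∃ s, M.IsStrategy w s ∧ x = sInf (M.values v w)} = {sInf (M.values v w)} := by
    ext x
    simp only [Set.mem_ofPred_eq, Set.mem_singleton_iff]
    exact ⟨fun ⟨_, _, h⟩ => h, fun h => ⟨s, hs, h⟩⟩
  rw [lang]
  simp only [h']
  rw [this, csSup_singleton]

end AlternatingAutomaton

/-! ### The detector as a weighted automaton -/

namespace Detector

variable {T R : Type} (D : Detector T R)

open State Letter

open Classical in
/-- The weighted automaton whose weights are those of the detector times `σ`. -/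
noncomputable def toAutomaton (σ : ℤ) : WeightedAutomaton (State T R) (Letter T R) where
  init := begin
  edge q a q' := if h : ∃ c, D.Step q a q' c then some ((σ * h.choose : ℤ) : ℚ) else none
  total q a := ⟨_, by rw [dif_pos ⟨_, .usual q a⟩]; rfl⟩

variable {D}

theorem edge_toAutomaton {σ : ℤ} {q a q' c} (h : D.Step q a q' c) :
    (D.toAutomaton σ).edge q a q' = some ((σ * c : ℤ) : ℚ) := by
  have h' : ∃ c, D.Step q a q' c := ⟨c, h⟩
  simp only [toAutomaton, dif_pos h']
  rw [h'.choose_spec.unique h]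

theorem edge_toAutomaton_eq_none {σ : ℤ} {q a q'} (h : ¬ ∃ c, D.Step q a q' c) :
    (D.toAutomaton σ).edge q a q' = none := by
  simp only [toAutomaton, dif_neg h]

theorem isRun_toAutomaton {σ : ℤ} {w : ℕ → Letter T R} {r : ℕ → State T R} :
    (D.toAutomaton σ).IsRun w r ↔ ∃ c, D.IsRun w r c := by
  constructor
  · rintro ⟨h0, h⟩
    have : ∀ i, ∃ c, D.Step (r i) (w i) (r (i + 1)) c := by
      intro i
      by_contra hi
      have := h i
      rw [WeightedAutomaton.IsTrans, edge_toAutomaton_eq_none hi] at this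
      exact absurd this (by simp)
    choose c hc using this
    exact ⟨c, h0, hc⟩
  · rintro ⟨c, h0, h⟩
    exact ⟨h0, fun i => by rw [WeightedAutomaton.IsTrans, edge_toAutomaton (h i)]; rfl⟩

theorem weights_toAutomaton {σ : ℤ} {w : ℕ → Letter T R} {r : ℕ → State T R} {c : ℕ → ℤ}
    (h : D.IsRun w r c) : (D.toAutomaton σ).weights w r = fun i => ((σ * c i : ℤ) : ℝ) := by
  funext i
  rw [WeightedAutomaton.weights, WeightedAutomaton.wt, edge_toAutomaton (h.step i)]
  simp

theorem average_weights {σ : ℤ} {w : ℕ → Letter T R} {r : ℕ → State T R} {c : ℕ → ℤ}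
    (h : D.IsRun w r c) (n : ℕ) : average ((D.toAutomaton σ).weights w r) n
      = σ * ((∑ i ∈ Finset.range n, c i : ℤ) : ℝ) / n := by
  rw [average, weights_toAutomaton h]
  push_cast
  rw [← Finset.mul_sum]
  ring

end Detector

end MeanPayoff

/-! ### Values of words under the detector. -/

namespace MeanPayoff

namespace Detector

variable {T R : Type} {D : Detector T R}

open State Letter

theorem tendsto_const_div_sqrt (K : ℝ) :
    Tendsto (fun n : ℕ => K / Real.sqrt n) atTop (nhds 0) :=
  tendsto_const_nhds.div_atTop (Real.tendsto_sqrt_atTop.comp tendsto_natCast_atTop_atTop)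

theorem tendsto_average_of_eventually_one {σ : ℤ} {w : ℕ → Letter T R} {r : ℕ → State T R}
    {c : ℕ → ℤ} (h : D.IsRun w r c) {t : ℕ} (hc : ∀ i ≥ t, c i = 1) :
    Tendsto (average ((D.toAutomaton σ).weights w r)) atTop (nhds σ) := by
  have h1 : ∀ j, ∑ i ∈ Finset.range (t + j), c i = ∑ i ∈ Finset.range t, c i + j := by
    intro j
    rw [Finset.sum_range_add, Finset.sum_congr rfl fun i _ => hc (t + i) (by omega)]
    simp
  set C : ℝ := ((∑ i ∈ Finset.range t, c i : ℤ) : ℝ) - t with hC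
  have h2 : ∀ᶠ n : ℕ in atTop, σ * (C / n + 1) = average ((D.toAutomaton σ).weights w r) n := by
    filter_upwards [eventually_ge_atTop (t + 1)] with n hn
    obtain ⟨j, rfl⟩ := Nat.exists_eq_add_of_le (show t ≤ n by omega)
    rw [average_weights h, h1 j]
    have : ((t + j : ℕ) : ℝ) ≠ 0 := by
      have : t + j ≠ 0 := by omega
      exact_mod_cast this
    field_simp
    rw [hC]
    push_cast
    ring
  refine Tendsto.congr' h2 ?_
  have h3 : Tendsto (fun n : ℕ => C / (n : ℝ)) atTop (nhds 0) :=
    tendsto_const_nhds.div_atTop tendsto_natCast_atTop_atTop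
  simpa using (h3.add_const 1).const_mul (σ : ℝ)

theorem eventually_ne_or_frequently (w : ℕ → Letter T R) :
    (∃ t, ∀ i ≥ t, w i ≠ mark) ∨ ∀ i, ∃ j ≥ i, w j = mark := by
  by_cases h : ∃ t, ∀ i ≥ t, w i ≠ mark
  · exact .inl h
  · push Not at h
    exact .inr h

/-- If the system accepts, the value of some word is negative. -/
theorem exists_lang_neg [Finite T] [Fintype R] (hacc : D.accept = D.sys.final) (hp : D.price = -1)
    (h : D.sys.Accepts D.input) (v : LimitKind) : ∃ w, (D.toAutomaton 1).lang v w < 0 := by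
  obtain ⟨m, τ, c, ht, hf⟩ := h
  obtain ⟨W, hW1, hW⟩ := D.exists_weight_bound
  have hWm : ∀ q a q' c, D.Step q a q' c → -(W : ℤ) ≤ c := fun q a q' c h =>
    (abs_le.1 (hW q a q' c h)).1
  obtain ⟨l, hl, _, _, hs⟩ := exists_block hWm le_rfl ht (fun h => absurd (hacc ▸ hf) h)
  rw [hp, add_zero] at hs
  obtain ⟨w, hw⟩ := exists_concat (fun _ : ℕ => l ++ [mark]) (by simp)
  obtain ⟨L, hL⟩ : ∃ L, L = (l ++ [mark]).length := ⟨_, rfl⟩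
  have hlL : l.length + 1 = L := by simp [hL]
  have hL0 : (0 : ℝ) < L := by rw [← hlL]; positivity
  have hT : ∀ k, ∑ _i ∈ Finset.range k, (l ++ [mark]).length = k * L := by
    intro k
    rw [← hL]
    simp
  refine ⟨w, lt_of_le_of_lt (csSup_le (WeightedAutomaton.values_nonempty _ v w) ?_)
    (show -(1 / (L : ℝ)) < 0 by rw [neg_lt_zero]; positivity)⟩
  rintro _ ⟨r, hr, rfl⟩
  have := Fintype.ofFinite T
  obtain ⟨W', hW'⟩ := (D.toAutomaton 1).exists_bound
  obtain ⟨c, hc⟩ := isRun_toAutomaton.1 hr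
  set K : ℝ := 1 + (2 * W + 1) * L with hK
  refine v.val_le (hW' w r) (f := fun n => -(1 / (L : ℝ)) + K / n) ?_ ?_
  · filter_upwards [eventually_ge_atTop 1] with n hn
    have hsum := sum_le_of_blocks hW1 hW (l := fun _ => l) le_rfl (fun _ => hs)
      (Λ := fun _ => L) monotone_const (fun _ => hlL.le) hw hc (n / L) n
      (by rw [hT]; exact Nat.div_mul_le_self n L)
      (by
        rw [hT, mul_comm]
        exact Nat.lt_mul_div_succ n (by omega))
    have hsum' : ((∑ j ∈ Finset.range n, c j : ℤ) : ℝ) ≤ -((n / L : ℕ) : ℝ) + (2 * W + 1) * L := by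
      have : ((∑ j ∈ Finset.range n, c j : ℤ) : ℝ)
          ≤ ((-1 * ((n / L : ℕ) : ℤ) + (2 * W + 1) * L : ℤ) : ℝ) := by exact_mod_cast hsum
      refine this.trans (le_of_eq ?_)
      generalize n / L = k
      push_cast
      ring
    have hdiv : (n : ℝ) / L - 1 ≤ ((n / L : ℕ) : ℝ) := by
      have h1 := Nat.lt_mul_div_succ n (show 0 < L by omega)
      have h2 : (n : ℝ) < L * ((n / L : ℕ) + 1) := by exact_mod_cast h1
      rw [sub_le_iff_le_add, div_le_iff₀ hL0]
      linarith
    have hn0 : (0 : ℝ) < n := by exact_mod_cast hn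
    rw [average_weights hc, Int.cast_one, one_mul, div_le_iff₀ hn0]
    have : (-(1 / (L : ℝ)) + K / n) * n = -(n / L) + K := by field_simp
    rw [this, hK]
    linarith
  · have h3 : Tendsto (fun n : ℕ => K / (n : ℝ)) atTop (nhds 0) :=
      tendsto_const_nhds.div_atTop tendsto_natCast_atTop_atTop
    simpa using h3.const_add (-(1 / (L : ℝ)))

/-- If the system does not accept, the value of every word is nonnegative. -/
theorem lang_nonneg [Finite T] [Finite R] (hacc : D.accept = D.sys.final) (hp : D.price = -1)
    (h : ¬ D.sys.Accepts D.input) (v : LimitKind) (w : ℕ → Letter T R) :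
    0 ≤ (D.toAutomaton 1).lang v w := by
  have := Fintype.ofFinite T
  have := Fintype.ofFinite R
  obtain ⟨W', hW'⟩ := (D.toAutomaton 1).exists_bound
  suffices hsuff : ∃ r c, D.IsRun w r c ∧ 0 ≤ v.val ((D.toAutomaton 1).weights w r) by
    obtain ⟨r, c, hr, hv⟩ := hsuff
    exact hv.trans (le_csSup ((D.toAutomaton 1).bdd_values v w).1
      ⟨r, isRun_toAutomaton.2 ⟨c, hr⟩, rfl⟩)
  rcases eventually_ne_or_frequently w with ⟨t, ht⟩ | hw
  · obtain ⟨r, c, hr, hc⟩ := exists_isRun_of_eventually_ne ht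
    have h1 := tendsto_average_of_eventually_one (σ := 1) hr hc
    exact ⟨r, c, hr, le_trans (by simp) (v.le_val (hW' w r) (.of_forall fun n => le_rfl) h1)⟩
  obtain ⟨W, hW1, hW⟩ := D.exists_weight_bound
  have hWm : ∀ q a q' c, D.Step q a q' c → -(W : ℤ) ≤ c := fun q a q' c h =>
    (abs_le.1 (hW q a q' c h)).1
  -- A block of length n that starts at position i is tested only if n * n ≤ i, so that the dip
  -- inside the test is at most W * √i. Longer blocks are passed with weights 0 at a final cost of
  -- 1.
  obtain ⟨t, μ, σ, r, c, ht, ht0, hr, hP, hsum, hμ⟩ := exists_isRun_of_blocks (D := D) hw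
    (fun i n μ s => (n * n ≤ i ∧ μ = -(W : ℤ) ∧ 0 ≤ s) ∨ (i < n * n ∧ μ = 0 ∧ -1 ≤ s))
    (fun i l hl => by
      by_cases hi : l.length * l.length ≤ i
      · obtain ⟨s, hs1, hs2⟩ := exists_blockPath_of_not_accepts hWm (by simp) hacc h hl
        exact ⟨_, s, hs1, .inl ⟨hi, rfl, by omega⟩⟩
      · obtain ⟨q, d, h1, h2, h3⟩ := exists_path_begin hl
        exact ⟨0, 0 + d, ⟨q, 0, d, h1, h2, rfl⟩, .inr ⟨by omega, rfl, by omega⟩⟩)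
  have hlt : ∀ k, t k < t (k + 1) := fun k => ht (Nat.lt_add_one k)
  -- The square root of the position is a potential: passing a block with n * n > t k raises it by
  -- at least 1/3, which pays for the loss of 1.
  have hS : ∀ k, -(3 * Real.sqrt (t k)) ≤ ((∑ j ∈ Finset.range k, σ j : ℤ) : ℝ) := by
    intro k
    induction k with
    | zero => simp [ht0]
    | succ k ih =>
      have hk := hlt k
      obtain ⟨n, hn⟩ : ∃ n, n = t (k + 1) - 1 - t k := ⟨_, rfl⟩
      have hn' : t (k + 1) = t k + n + 1 := by omega
      have hPk := hP k
      rw [← hn] at hPk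
      rw [Finset.sum_range_succ]
      push_cast
      push_cast at ih
      have h0 := Real.sqrt_nonneg (t k)
      rcases hPk with ⟨_, _, h1⟩ | ⟨h1, _, h2⟩
      · have h3 : (0 : ℝ) ≤ σ k := by exact_mod_cast h1
        have h4 : Real.sqrt (t k) ≤ Real.sqrt (t (k + 1)) :=
          Real.sqrt_le_sqrt (by exact_mod_cast hk.le)
        linarith
      · have h3 : (-1 : ℝ) ≤ σ k := by exact_mod_cast h2
        have h4 : Real.sqrt (t k) + 1 / 3 ≤ Real.sqrt (t (k + 1)) := by
          refine Real.le_sqrt_of_sq_le ?_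
          have h5 : Real.sqrt (t k) ≤ n := by
            rw [Real.sqrt_le_left (by positivity)]
            have : t k ≤ n ^ 2 := by rw [sq]; exact h1.le
            exact_mod_cast this
          have h6 := Real.sq_sqrt (show (0 : ℝ) ≤ t k by positivity)
          rw [hn']
          push_cast
          nlinarith
        linarith
  refine ⟨r, c, hr, v.le_val (hW' w r) (f := fun n : ℕ => -(3 + W) / Real.sqrt n) ?_
    (tendsto_const_div_sqrt _)⟩
  obtain ⟨idx, hidx, _⟩ := exists_index ht ht0
  filter_upwards [eventually_ge_atTop 1] with i hi
  obtain ⟨h1, h2⟩ := hidx i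
  set k := idx i
  have hsplit : ∑ j ∈ Finset.range i, c j
      = ∑ j ∈ Finset.range k, σ j + ∑ j ∈ Finset.Ico (t k) i, c j := by
    rw [← hsum, Finset.sum_range_add_sum_Ico _ h1]
  have hi0 : (0 : ℝ) < i := by exact_mod_cast hi
  have h3 : Real.sqrt (t k) ≤ Real.sqrt i := Real.sqrt_le_sqrt (by exact_mod_cast h1)
  have h5 := hS k
  have h6 : -(W * Real.sqrt i) ≤ ((∑ j ∈ Finset.Ico (t k) i, c j : ℤ) : ℝ) := by
    obtain ⟨n, hn⟩ : ∃ n, n = t (k + 1) - 1 - t k := ⟨_, rfl⟩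
    have hPk := hP k
    rw [← hn] at hPk
    have h7 : ((i - t k : ℕ) : ℤ) * μ k ≤ ∑ j ∈ Finset.Ico (t k) i, c j := by
      have := Finset.card_nsmul_le_sum (Finset.Ico (t k) i) c (μ k) (fun j hj => by
        rw [Finset.mem_Ico] at hj
        exact hμ k j hj.1 (by omega))
      simpa using this
    rcases hPk with ⟨h8, h9, _⟩ | ⟨_, h9, _⟩
    · rw [h9] at h7
      have h10 : (((i - t k : ℕ) : ℤ) * -(W : ℤ) : ℝ) ≤ ((∑ j ∈ Finset.Ico (t k) i, c j : ℤ) : ℝ) := by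
        exact_mod_cast h7
      have h11 : ((i - t k : ℕ) : ℝ) ≤ Real.sqrt i := by
        refine Real.le_sqrt_of_sq_le ?_
        have h12 : i - t k ≤ n := by omega
        have h13 : (i - t k) ^ 2 ≤ i := by
          rw [sq]
          exact (Nat.mul_le_mul h12 h12).trans (h8.trans h1)
        exact_mod_cast h13
      have h12 : (0 : ℝ) ≤ W := by positivity
      push_cast at h10 ⊢
      nlinarith
    · rw [h9, mul_zero] at h7
      have h10 : (0 : ℝ) ≤ ((∑ j ∈ Finset.Ico (t k) i, c j : ℤ) : ℝ) := by exact_mod_cast h7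
      have : 0 ≤ (W : ℝ) * Real.sqrt i := by positivity
      linarith
  rw [average_weights hr, hsplit, Int.cast_one, one_mul, le_div_iff₀ hi0]
  have h7 : -(3 + (W : ℝ)) / Real.sqrt i * i = -(3 + W) * Real.sqrt i := by
    have h8 := Real.mul_self_sqrt hi0.le
    have h9 : Real.sqrt i ≠ 0 := (Real.sqrt_pos.2 hi0).ne'
    field_simp
    rw [sq, h8]
  rw [h7, Int.cast_add]
  linarith

/-- If the system has arbitrarily long traces, all runs over some word have nonnegative values. -/
theorem exists_sInf_values_nonneg [Finite T] [Fintype R] (hp : D.price = 1)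
    (h : ∀ m, D.sys.HasTrace D.input m) (v : LimitKind) :
    ∃ w, 0 ≤ sInf ((D.toAutomaton (-1)).values v w) := by
  obtain ⟨W, hW1, hW⟩ := D.exists_weight_bound
  have hWm : ∀ q a q' c, D.Step q a q' c → -(W : ℤ) ≤ c := fun q a q' c h =>
    (abs_le.1 (hW q a q' c h)).1
  have hb : ∀ m, ∃ l : List (Letter T R), 2 ^ m ≤ l.length ∧ l.length ≤ 2 ^ m * D.ratio D.input ∧
      ∀ s, D.BlockPath (-W) begin l s → s ≤ 2 := by
    intro m
    obtain ⟨τ, c, ht⟩ := h m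
    obtain ⟨l, _, h1, h2, h3⟩ := exists_block hWm (b := 1) zero_le_one ht (fun _ => le_rfl)
    exact ⟨l, h1, h2, fun s hs => by have := h3 s hs; omega⟩
  choose l hl1 hl2 hl3 using hb
  -- About log k steps in block k give a length of order k. Thus k blocks have total weight at most
  -- 2 * k but occupy at least k ^ 2 / 4 positions, and an incomplete block contributes only O(k).
  set f : ℕ → List (Letter T R) := fun k => l (Nat.log 2 (k + 1)) with hf
  set Λ : ℕ → ℕ := fun k => (k + 1) * D.ratio D.input + 1 with hΛ
  have hfΛ : ∀ k, (f k).length + 1 ≤ Λ k := by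
    intro k
    have h1 := hl2 (Nat.log 2 (k + 1))
    have h2 := Nat.pow_log_le_self 2 (show k + 1 ≠ 0 by omega)
    have h3 := Nat.mul_le_mul_right (D.ratio D.input) h2
    simp only [hf, hΛ]
    omega
  have hΛm : Monotone Λ := fun a b hab => by
    simp only [hΛ]
    gcongr
  obtain ⟨w, hw⟩ := exists_concat (fun k => f k ++ [mark]) (by simp)
  set t : ℕ → ℕ := fun k => ∑ i ∈ Finset.range k, (f i ++ [mark]).length with ht
  have hsucc : ∀ k, t (k + 1) = t k + (f k ++ [mark]).length := fun k => Finset.sum_range_succ _ _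
  have hmono : StrictMono t := strictMono_nat_of_lt_succ fun k => by
    rw [hsucc]
    simp
  have htk : ∀ k, k ^ 2 ≤ 4 * t k := by
    intro k
    induction k with
    | zero => simp
    | succ k ih =>
      have h1 := hl1 (Nat.log 2 (k + 1))
      have h2 := Nat.lt_pow_succ_log_self (b := 2) one_lt_two (k + 1)
      rw [pow_succ] at h2
      have h3 : (f k ++ [mark]).length = (f k).length + 1 := by simp
      have h4 : k + 1 < (f k).length * 2 := by
        simp only [hf]
        omega
      rw [hsucc, h3]
      nlinarith
  set K : ℝ := 2 + (2 * W + 1) * (D.ratio D.input + 1) with hK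
  have hK0 : 0 ≤ K := by positivity
  refine ⟨w, le_csInf (WeightedAutomaton.values_nonempty _ v w) ?_⟩
  rintro _ ⟨r, hr, rfl⟩
  have := Fintype.ofFinite T
  obtain ⟨W', hW'⟩ := (D.toAutomaton (-1)).exists_bound
  obtain ⟨c, hc⟩ := isRun_toAutomaton.1 hr
  obtain ⟨idx, hidx, _⟩ := exists_index hmono (by simp [ht])
  refine v.le_val (hW' w r) (f := fun n : ℕ => -(3 * K) / Real.sqrt n) ?_ (tendsto_const_div_sqrt _)
  filter_upwards [eventually_ge_atTop 1] with i hi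
  obtain ⟨h1, h2⟩ := hidx i
  set k := idx i
  have hsum := sum_le_of_blocks hW1 hW (l := f) (B := 2) (by norm_num) (fun k => hl3 _) hΛm hfΛ hw
    hc k i h1 h2
  have hsum' : ((∑ j ∈ Finset.range i, c j : ℤ) : ℝ) ≤ K * (k + 1) := by
    have h3 : ((∑ j ∈ Finset.range i, c j : ℤ) : ℝ)
        ≤ ((2 * (k : ℤ) + (2 * W + 1) * (Λ k : ℤ) : ℤ) : ℝ) := by exact_mod_cast hsum
    refine h3.trans ?_
    simp only [hΛ, hK]
    push_cast
    have h4 : (0 : ℝ) ≤ k := by positivity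
    have h5 : (0 : ℝ) ≤ W := by positivity
    have h6 : (0 : ℝ) ≤ (W : ℝ) * k := by positivity
    nlinarith
  have hi0 : (0 : ℝ) < i := by exact_mod_cast hi
  have hk : (k : ℝ) ≤ 2 * Real.sqrt i := by
    have h3 : k ^ 2 ≤ 4 * i := (htk k).trans (by omega)
    have h4 : (k : ℝ) ^ 2 ≤ 4 * i := by exact_mod_cast h3
    refine abs_le_of_sq_le_sq' ?_ (by positivity) |>.2
    rw [mul_pow, Real.sq_sqrt hi0.le]
    linarith
  have hi1 : 1 ≤ Real.sqrt i := by
    rw [Real.one_le_sqrt]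
    exact_mod_cast hi
  rw [average_weights hc, le_div_iff₀ hi0]
  have h7 : -(3 * K) / Real.sqrt i * i = -(3 * K) * Real.sqrt i := by
    have h8 := Real.mul_self_sqrt hi0.le
    have h9 : Real.sqrt i ≠ 0 := (Real.sqrt_pos.2 hi0).ne'
    field_simp
    rw [sq, h8]
  rw [h7]
  have h8 : K * (k + 1) ≤ K * (3 * Real.sqrt i) := by
    gcongr
    linarith
  push_cast at hsum' ⊢
  linarith

/-- If the system has no long trace, some run over each word has a negative value. -/
theorem sInf_values_neg [Finite T] [Finite R] (hacc : ∀ τ, ¬ D.accept τ) (hp : D.price = 1)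
    {N : ℕ} (h : ¬ D.sys.HasTrace D.input N) (w : ℕ → Letter T R) :
    sInf ((D.toAutomaton (-1)).values .limInfAvg w) < 0 := by
  have := Fintype.ofFinite T
  have := Fintype.ofFinite R
  obtain ⟨W', hW'⟩ := (D.toAutomaton (-1)).exists_bound
  suffices hsuff : ∃ r c, D.IsRun w r c ∧
      LimitKind.limInfAvg.val ((D.toAutomaton (-1)).weights w r) < 0 by
    obtain ⟨r, c, hr, hv⟩ := hsuff
    exact (csInf_le ((D.toAutomaton (-1)).bdd_values _ w).2
      ⟨r, isRun_toAutomaton.2 ⟨c, hr⟩, rfl⟩).trans_lt hv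
  rcases eventually_ne_or_frequently w with ⟨t, ht⟩ | hw
  · obtain ⟨r, c, hr, hc⟩ := exists_isRun_of_eventually_ne ht
    have h1 := tendsto_average_of_eventually_one (σ := -1) hr hc
    refine ⟨r, c, hr, (LimitKind.val_le _ (hW' w r) (.of_forall fun n => le_rfl) h1).trans_lt ?_⟩
    simp
  obtain ⟨W, hW1, hW⟩ := D.exists_weight_bound
  have hWm : ∀ q a q' c, D.Step q a q' c → -(W : ℤ) ≤ c := fun q a q' c h =>
    (abs_le.1 (hW q a q' c h)).1
  obtain ⟨ε, hε, hbl⟩ := exists_blockPath_of_not_hasTrace hWm (by simp) hacc hp h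
  obtain ⟨t, μ, σ, r, c, ht, ht0, hr, hP, hsum, _⟩ := exists_isRun_of_blocks (D := D) hw
    (fun _ n _ s => ε * (n + 1) ≤ s) (fun i l hl => ⟨_, hbl l hl⟩)
  have hS : ∀ k, ε * t k ≤ ((∑ j ∈ Finset.range k, σ j : ℤ) : ℝ) := by
    intro k
    induction k with
    | zero => simp [ht0]
    | succ k ih =>
      have hk := ht (Nat.lt_add_one k)
      obtain ⟨n, hn⟩ : ∃ n, n = t (k + 1) - 1 - t k := ⟨_, rfl⟩
      have hn' : t (k + 1) = t k + n + 1 := by omega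
      have hPk := hP k
      rw [← hn] at hPk
      rw [Finset.sum_range_succ, hn']
      push_cast at ih ⊢
      linarith
  -- Only the averages at block ends are controlled; nothing is known inside the tests.
  refine ⟨r, c, hr, (liminf_average_le (hW' w r) (a := -ε) ?_).trans_lt (by linarith)⟩
  rw [frequently_atTop]
  intro n
  refine ⟨t (n + 1), (Nat.le_succ n).trans ht.le_apply, ?_⟩
  have h0 : (0 : ℝ) < t (n + 1) := by
    have : n + 1 ≤ t (n + 1) := ht.le_apply
    have : 0 < t (n + 1) := by omega
    exact_mod_cast this
  rw [average_weights hr, hsum, div_le_iff₀ h0]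
  have := hS (n + 1)
  push_cast at this ⊢
  linarith

end Detector

end MeanPayoff

namespace MeanPayoff

/-! ### Operations on automata -/

namespace WeightedAutomaton

variable {Q Q' A A' : Type} (M : WeightedAutomaton Q A)

/-- The automaton that may also choose, at the beginning, to collect weights `0` only. -/
def withZero : WeightedAutomaton (Option (Option Q)) A where
  init := none
  edge
    | none, _, some none => some 0
    | none, a, some (some q) => M.edge M.init a q
    | some none, _, some none => some 0
    | some (some q), a, some (some q') => M.edge q a q'
    | _, _, _ => none
  total
    | none, _ => ⟨some none, rfl⟩
    | some none, _ => ⟨some none, rfl⟩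
    | some (some q), a => (M.total q a).imp' (fun q' => some (some q')) fun _ h => h

/-- The fresh initial state is never revisited and the two parts are not connected, so the first
transition decides between the constant run and a run of `M`. -/
theorem values_withZero (v : LimitKind) (w : ℕ → A) :
    M.withZero.values v w = insert 0 (M.values v w) := by
  have hzero : v.val (fun _ => 0) = 0 := by
    have h : ∀ i : ℕ, |(fun _ : ℕ => (0 : ℝ)) i| ≤ 0 := by simp
    simpa using v.abs_val_le h
  ext x
  simp only [values, Set.mem_insert_iff, Set.mem_ofPred_eq]
  constructor
  · rintro ⟨r, ⟨h0, hr⟩, rfl⟩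
    have hnot : ∀ i, r (i + 1) ≠ none := by
      intro i hi
      have h := hr i
      rw [hi] at h
      rcases hri : r i with _ | _ | q <;> rw [hri] at h <;> simp [IsTrans, withZero] at h
    rcases h1 : r 1 with _ | _ | q
    · exact absurd h1 (hnot 0)
    · left
      have hall : ∀ i, r (i + 1) = some none := by
        intro i
        induction i with
        | zero => exact h1
        | succ i ih =>
          have h := hr (i + 1)
          rw [ih] at h
          rcases hri : r (i + 1 + 1) with _ | _ | q
          · exact absurd hri (hnot _)
          · rfl
          · rw [hri] at h
            simp [IsTrans, withZero] at h
      have hw : M.withZero.weights w r = fun _ => 0 := by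
        funext i
        rw [weights, wt, hall i]
        rcases i with _ | i
        · rw [h0]
          simp [withZero]
        · rw [hall i]
          simp [withZero]
      rw [hw, hzero]
    · right
      have hall : ∀ i, ∃ q, r (i + 1) = some (some q) := by
        intro i
        induction i with
        | zero => exact ⟨q, h1⟩
        | succ i ih =>
          obtain ⟨q, hq⟩ := ih
          have h := hr (i + 1)
          rw [hq] at h
          rcases hri : r (i + 1 + 1) with _ | _ | q'
          · exact absurd hri (hnot _)
          · rw [hri] at h
            simp [IsTrans, withZero] at h
          · exact ⟨q', rfl⟩
      choose s hs using hall
      set r' : ℕ → Q := fun i => Nat.casesOn i M.init s with hr'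
      have hedge : ∀ i, M.withZero.edge (r i) (w i) (r (i + 1))
          = M.edge (r' i) (w i) (r' (i + 1)) := by
        intro i
        rw [hs i]
        rcases i with _ | i
        · rw [h0]
          rfl
        · rw [hs i]
          rfl
      refine ⟨r', ⟨rfl, fun i => ?_⟩, ?_⟩
      · have h := hr i
        rwa [IsTrans, hedge] at h
      · congr 1
        funext i
        rw [weights, weights, wt, wt, hedge]
  · rintro (rfl | ⟨r, ⟨h0, hr⟩, rfl⟩)
    · refine ⟨fun i => Nat.casesOn i none fun _ => some none, ⟨rfl, fun i => ?_⟩, ?_⟩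
      · rcases i with _ | i <;> rfl
      · rw [← hzero]
        congr 1
        funext i
        rcases i with _ | i <;> simp [weights, wt, withZero]
    · have hedge : ∀ i, M.withZero.edge
          (Nat.casesOn i none fun j => some (some (r (j + 1))) : Option (Option Q)) (w i)
          (some (some (r (i + 1)))) = M.edge (r i) (w i) (r (i + 1)) := by
        rintro (_ | i)
        · rw [h0]
          rfl
        · rfl
      refine ⟨fun i => Nat.casesOn i none fun j => some (some (r (j + 1))),
        ⟨rfl, fun i => ?_⟩, ?_⟩
      · rw [IsTrans, hedge]
        exact hr i
      · congr 1
        funext i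
        rw [weights, weights, wt, wt, hedge]

theorem lang_withZero [Finite Q] [Finite A] (v : LimitKind) (w : ℕ → A) :
    M.withZero.lang v w = max 0 (M.lang v w) := by
  rw [lang_eq, values_withZero, csSup_insert (M.bdd_values v w).1 (M.values_nonempty v w)]
  rfl

/-- The automaton with renamed states and letters. -/
def reindex (e : Q ≃ Q') (f : A ≃ A') : WeightedAutomaton Q' A' where
  init := e M.init
  edge q a q' := M.edge (e.symm q) (f.symm a) (e.symm q')
  total q a := (M.total (e.symm q) (f.symm a)).imp' e fun q' h => by simpa using h

theorem values_reindex (e : Q ≃ Q') (f : A ≃ A') (v : LimitKind) (w : ℕ → A) :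
    (M.reindex e f).values v (f ∘ w) = M.values v w := by
  ext x
  constructor
  · rintro ⟨r, ⟨h0, hr⟩, rfl⟩
    refine ⟨e.symm ∘ r, ⟨by simp [h0, reindex], fun i => ?_⟩, ?_⟩
    · simpa [IsTrans, reindex] using hr i
    · congr 1
      funext i
      simp [weights, wt, reindex]
  · rintro ⟨r, ⟨h0, hr⟩, rfl⟩
    refine ⟨e ∘ r, ⟨by simp [h0, reindex], fun i => ?_⟩, ?_⟩
    · simpa [IsTrans, reindex] using hr i
    · congr 1
      funext i
      simp [weights, wt, reindex]

/-- The automaton with states and letters renamed as numbers. -/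
noncomputable def toFin [Finite Q] [Finite A] : NAut (Nat.card Q) (Nat.card A) :=
  M.reindex (Finite.equivFin Q) (Finite.equivFin A)

/-- All states belong to one player. -/
def toAlternating (b : Bool) : AlternatingAutomaton Q A where
  toWeightedAutomaton := M
  isMax _ := b

theorem forall_word_toFin [Finite A] {p : (ℕ → Fin (Nat.card A)) → Prop} :
    (∀ w, p w) ↔ ∀ w, p (Finite.equivFin A ∘ w) :=
  ((Equiv.refl ℕ).arrowCongr (Finite.equivFin A)).forall_congr_right.symm

theorem lang_toFin [Finite Q] [Finite A] (v : LimitKind) (w : ℕ → A) :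
    M.toFin.lang v (Finite.equivFin A ∘ w) = M.lang v w := by
  rw [lang_eq, toFin, values_reindex]
  rfl

theorem lang_toAlternating_true (v : LimitKind) : (M.toAlternating true).lang v = M.lang v :=
  funext fun w => (M.toAlternating true).lang_of_isMax (fun _ => rfl) v w

theorem lang_toAlternating_false (v : LimitKind) (w : ℕ → A) :
    (M.toAlternating false).lang v w = sInf (M.values v w) :=
  (M.toAlternating false).lang_of_not_isMax (fun _ => rfl) v w

end WeightedAutomaton

/-! ### Computable families of automata -/

open WeightedAutomaton

/-- Integers are coded with the nonnegative ones at even numbers and the negative ones at odd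
numbers. -/
theorem primrec_int_ofNat : Primrec Int.ofNat :=
  Primrec.encode_iff.1 ((Primrec.nat_mul.comp (Primrec.const 2) Primrec.id).of_eq
    fun n => by with_unfolding_all rfl)

theorem primrec_int_negSucc : Primrec Int.negSucc :=
  Primrec.encode_iff.1 ((Primrec.succ.comp (Primrec.nat_mul.comp (Primrec.const 2)
    Primrec.id)).of_eq fun n => by with_unfolding_all rfl)

theorem primrec_natCast_sub {f g : ℕ → ℕ} (hf : Primrec f) (hg : Primrec g) :
    Primrec fun n => (f n : ℤ) - g n := by
  refine (Primrec.ite (c := fun n => g n ≤ f n) (Primrec.nat_le.comp hg hf)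
    (primrec_int_ofNat.comp (Primrec.nat_sub.comp hf hg))
    (primrec_int_negSucc.comp (Primrec.nat_sub.comp (Primrec.nat_sub.comp hg hf)
      (Primrec.const 1)))).of_eq fun n => ?_
  split_ifs with h
  · simp only [Int.ofNat_eq_natCast]
    omega
  · rw [Int.negSucc_eq]
    omega

theorem primrec_affine (a b : ℤ) : Primrec fun n : ℕ => a + b * n := by
  have h : ∀ a b : ℕ, Primrec fun n : ℕ => a + b * n := fun a b =>
    Primrec.nat_add.comp (Primrec.const a) (Primrec.nat_mul.comp (Primrec.const b) Primrec.id)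
  refine (primrec_natCast_sub (h a.toNat b.toNat) (h (-a).toNat (-b).toNat)).of_eq fun n => ?_
  have ha : a = a.toNat - (-a).toNat := by omega
  have hb : b = b.toNat - (-b).toNat := by omega
  conv_rhs => rw [ha, hb]
  push_cast
  ring

/-- The automata have the same initial state and their weights are computable. -/
def ComputableFamily {Q A : Type} (F : ℕ → WeightedAutomaton Q A) : Prop :=
  (∃ q, ∀ n, (F n).init = q) ∧
    ∀ q a q', Computable fun n => ((F n).edge q a q').map encodeRat

namespace ComputableFamily

variable {Q Q' A A' : Type} {F : ℕ → WeightedAutomaton Q A}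

theorem withZero (h : ComputableFamily F) : ComputableFamily fun n => (F n).withZero := by
  obtain ⟨⟨q₀, h0⟩, h⟩ := h
  refine ⟨⟨none, fun _ => rfl⟩, ?_⟩
  rintro (_ | _ | q) a (_ | _ | q')
  all_goals try exact Computable.const _
  · exact (h q₀ a q').of_eq fun n => by rw [← h0 n]; rfl
  · exact h q a q'

theorem toFin [Finite Q] [Finite A] (h : ComputableFamily F) :
    ComputableFamily fun n => (F n).toFin := by
  obtain ⟨⟨q₀, h0⟩, h⟩ := h
  exact ⟨⟨Finite.equivFin Q q₀, fun n => by rw [← h0 n]; rfl⟩, fun q a q' => h _ _ _⟩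

theorem computable_encode {k m : ℕ} {F : ℕ → NAut k m} (h : ComputableFamily F) :
    Computable fun n => (F n).encode := by
  obtain ⟨⟨q₀, h0⟩, h⟩ := h
  refine (Computable.pair (Computable.const k) (Computable.pair (Computable.const m)
    (Computable.pair (Computable.const (q₀ : ℕ)) (Computable.list_ofFn fun q =>
      Computable.list_ofFn fun a => Computable.list_ofFn fun q' => h q a q')))).of_eq fun n => ?_
  rw [WeightedAutomaton.encode, h0]

theorem computable_encode_toAlternating {k m : ℕ} {F : ℕ → NAut k m} (h : ComputableFamily F)
    (b : Bool) : Computable fun n => ((F n).toAlternating b).encode :=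
  Computable.pair h.computable_encode (Computable.const (List.ofFn fun _ : Fin k => b))

end ComputableFamily

namespace Detector

variable {T R : Type}

open State Letter

/-- The input occurs only in the unit weights of `len` and `init`, and linearly. The system itself
is fixed, so its noncomputable choices become constants of the reduction. -/
theorem exists_usual_eq (S : CounterSystem T R) (p : ℤ) (acc : T → Prop) (q : State T R)
    (a : Letter T R) : ∃ q' α β, ∀ n : ℕ,
      (Detector.mk S n p acc).usual q a = (q', α + β * (n : ℤ)) := by
  by_cases h : ∀ n : ℕ, (Detector.mk S n p acc).usual q a = (Detector.mk S 0 p acc).usual q a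
  · exact ⟨_, _, 0, fun n => by rw [h n, zero_mul, add_zero]⟩
  rcases q with _ | _ | κ | κ | _ | _ <;> rcases a with _ | τ | x
  all_goals try exact absurd (fun n => rfl) h
  rcases κ with _ | _ | ⟨r, s⟩ | _ | _ | _ | _ | _ <;> rcases x with _ | r'
  all_goals try exact absurd (fun n => rfl) h
  · refine ⟨first .len, 1 - (4 + 2 * Nat.card R), -(2 * Nat.card R), fun n => ?_⟩
    simp only [usual, weight₁, ratio, Prod.mk.injEq, true_and]
    push_cast
    ring
  · refine ⟨first (.init r s), 0, sgn s * S.input r, fun n => ?_⟩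
    simp only [usual, weight₁, Prod.mk.injEq, true_and]
    ring

/-- The graph of transitions does not depend on n, only the weights do. -/
theorem exists_step_affine (S : CounterSystem T R) (p : ℤ) (acc : T → Prop) (q : State T R)
    (a : Letter T R) (q' : State T R) :
    (∀ n, ¬ ∃ c, (Detector.mk S n p acc).Step q a q' c) ∨
      ∃ α β, ∀ n : ℕ, (Detector.mk S n p acc).Step q a q' (α + β * (n : ℤ)) := by
  by_cases h : ∃ n c, (Detector.mk S n p acc).Step q a q' c
  · right
    obtain ⟨n, c, h⟩ := h
    have hconst : ∀ x : ℤ, (∀ n : ℕ, (Detector.mk S n p acc).Step q a q' x) →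
        ∃ α β, ∀ n : ℕ, (Detector.mk S n p acc).Step q a q' (α + β * (n : ℤ)) :=
      fun x hx => ⟨x, 0, fun n => by simpa using hx n⟩
    cases h with
    | usual =>
      obtain ⟨q₁, α, β, hu⟩ := exists_usual_eq S p acc q a
      refine ⟨α, β, fun m => ?_⟩
      have h1 := Step.usual (D := Detector.mk S m p acc) q a
      rw [hu m] at h1
      rwa [hu n]
    | sink_of_begin _ h => exact hconst _ fun m => .sink_of_begin _ h
    | sink_of_idle _ h => exact hconst _ fun m => .sink_of_idle _ h
    | enter_of_begin κ τ h => exact hconst _ fun m => .enter_of_begin κ τ h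
    | enter_of_idle κ τ h => exact hconst _ fun m => .enter_of_idle κ τ h
    | bad_start τ h => exact hconst _ fun m => .bad_start τ h
    | bad_sym x => exact hconst _ fun m => .bad_sym x
  · left
    exact fun n hn => h ⟨n, hn⟩

theorem computableFamily_toAutomaton (S : CounterSystem T R) (p : ℤ) (acc : T → Prop) (σ : ℤ) :
    ComputableFamily fun n => (Detector.mk S n p acc).toAutomaton σ := by
  refine ⟨⟨begin, fun _ => rfl⟩, fun q a q' => ?_⟩
  rcases exists_step_affine S p acc q a q' with h | ⟨α, β, h⟩
  · exact (Computable.const none).of_eq fun n => by rw [edge_toAutomaton_eq_none (h n)]; rfl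
  · refine (Computable.option_some.comp (Computable.pair
      (primrec_affine (σ * α) (σ * β)).to_comp (Computable.const 1))).of_eq fun n => ?_
    rw [edge_toAutomaton (h n), Option.map_some, encodeRat, Rat.num_intCast, Rat.den_intCast]
    congr 2
    ring

end Detector

/-! ### Reductions -/

/-- A decider may diverge off the codes, but composed with the computable map from n to the code of
its instance it is total, and negating its answer decides `H`. -/
theorem not_decidableProblem {I C : Type} [Primcodable C] {code : I → C} {P : I → Prop}
    {H : ℕ → Prop} (hH : ¬ ComputablePred H) (inst : ℕ → I)
    (hc : Computable fun n => code (inst n)) (h : ∀ n, P (inst n) ↔ ¬ H n) :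
    ¬ DecidableProblem code P := by
  rintro ⟨f, hf, hfP⟩
  choose b hb hbP using fun n => hfP (inst n)
  have hcb : Computable b :=
    (hf.comp hc).of_eq fun n => Part.eq_some_iff.2 (hb n)
  refine hH (ComputablePred.computable_iff.2 ⟨fun n => !(b n),
    Primrec.not.to_comp.comp hcb, funext fun n => propext ?_⟩)
  have := (hbP n).trans (h n)
  cases hbn : b n <;> simp_all

end MeanPayoff

/-! ### Assembly of the reductions. -/

namespace MeanPayoff

open WeightedAutomaton

/-- There are computable families of automata such that it is undecidable whether all values are
nonnegative, and whether the infimum of the values of the runs is nonnegative for some word. -/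
theorem exists_undecidable_family : ∃ (Q A : Type) (_ : Finite Q) (_ : Finite A)
    (F G : ℕ → WeightedAutomaton Q A) (H : ℕ → Prop), ¬ ComputablePred H ∧
      ComputableFamily F ∧ ComputableFamily G ∧
      (∀ v n, (∀ w, 0 ≤ (F n).lang v w) ↔ ¬ H n) ∧
      ∀ n, (∃ w, 0 ≤ sInf ((G n).values .limInfAvg w)) ↔ ¬ H n := by
  obtain ⟨T, _, k, S, H, hH, h1, h2⟩ := exists_undecidable_counterSystem
  have := Fintype.ofFinite T
  refine ⟨State T (Fin k), Letter T (Fin k), inferInstance, inferInstance, _, _, H, hH,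
    Detector.computableFamily_toAutomaton S (-1) S.final 1,
    Detector.computableFamily_toAutomaton S 1 (fun _ => False) (-1), fun v n => ⟨?_, ?_⟩,
    fun n => ⟨?_, ?_⟩⟩
  · intro h hn
    obtain ⟨w, hw⟩ := Detector.exists_lang_neg (D := ⟨S, n, -1, S.final⟩) rfl rfl (h1 n hn).1 v
    exact (h w).not_gt hw
  · exact fun hn => Detector.lang_nonneg (D := ⟨S, n, -1, S.final⟩) rfl rfl (h2 n hn).1 v
  · rintro ⟨w, hw⟩ hn
    obtain ⟨m, hm⟩ := (h1 n hn).2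
    exact hw.not_gt (Detector.sInf_values_neg (D := ⟨S, n, 1, fun _ => False⟩)
      (fun _ h => h) rfl hm w)
  · exact fun hn => Detector.exists_sInf_values_nonneg (D := ⟨S, n, 1, fun _ => False⟩) rfl
      (h2 n hn).2 .limInfAvg

end MeanPayoff

theorem mainTheorem7 :
    -- nondeterministic automata: universality, inclusion, equivalence, for each kind of value
    (∀ v : MeanPayoff.LimitKind,
      ¬ MeanPayoff.DecidableProblem
          (MeanPayoff.ThresholdInstance.encode
            (Aut := MeanPayoff.NAut) MeanPayoff.WeightedAutomaton.encode)
          (fun I => MeanPayoff.QuantUniversal (I.aut.lang v) I.threshold) ∧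
      ¬ MeanPayoff.DecidableProblem
          (MeanPayoff.PairInstance.encode
            (Aut := MeanPayoff.NAut) MeanPayoff.WeightedAutomaton.encode)
          (fun I => MeanPayoff.QuantIncluded (I.aut₁.lang v) (I.aut₂.lang v)) ∧
      ¬ MeanPayoff.DecidableProblem
          (MeanPayoff.PairInstance.encode
            (Aut := MeanPayoff.NAut) MeanPayoff.WeightedAutomaton.encode)
          (fun I => MeanPayoff.QuantEquivalent (I.aut₁.lang v) (I.aut₂.lang v))) ∧
    -- alternating automata: emptiness, where the kind of value is part of the automaton
    ¬ MeanPayoff.DecidableProblem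
        (fun J : MeanPayoff.LimitKind × MeanPayoff.ThresholdInstance MeanPayoff.AAut =>
          (J.1.encode, J.2.encode MeanPayoff.AlternatingAutomaton.encode))
        (fun J => MeanPayoff.QuantNonempty (J.2.aut.lang J.1) J.2.threshold) ∧
    -- alternating automata: universality, inclusion, equivalence, for each kind of value
    (∀ v : MeanPayoff.LimitKind,
      ¬ MeanPayoff.DecidableProblem
          (MeanPayoff.ThresholdInstance.encode
            (Aut := MeanPayoff.AAut) MeanPayoff.AlternatingAutomaton.encode)
          (fun I => MeanPayoff.QuantUniversal (I.aut.lang v) I.threshold) ∧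
      ¬ MeanPayoff.DecidableProblem
          (MeanPayoff.PairInstance.encode
            (Aut := MeanPayoff.AAut) MeanPayoff.AlternatingAutomaton.encode)
          (fun I => MeanPayoff.QuantIncluded (I.aut₁.lang v) (I.aut₂.lang v)) ∧
      ¬ MeanPayoff.DecidableProblem
          (MeanPayoff.PairInstance.encode
            (Aut := MeanPayoff.AAut) MeanPayoff.AlternatingAutomaton.encode)
          (fun I => MeanPayoff.QuantEquivalent (I.aut₁.lang v) (I.aut₂.lang v))) := by
  obtain ⟨Q, A, _, _, F, G, H, hH, hF, hG, huniv, hempty⟩ := MeanPayoff.exists_undecidable_family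
  have hzero : Computable fun _ : ℕ => MeanPayoff.encodeRat 0 := Computable.const _
  have hU : ∀ v n, MeanPayoff.QuantUniversal ((F n).toFin.lang v) 0 ↔ ¬ H n := by
    intro v n
    rw [← huniv v n, MeanPayoff.QuantUniversal, MeanPayoff.WeightedAutomaton.forall_word_toFin]
    simp only [MeanPayoff.WeightedAutomaton.lang_toFin, Rat.cast_zero]
  -- The left automaton has language max(0, L), which is below L exactly if L is nonnegative.
  have hI : ∀ v n, MeanPayoff.QuantIncluded ((F n).withZero.toFin.lang v) ((F n).toFin.lang v)
      ↔ ¬ H n := by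
    intro v n
    rw [← huniv v n, MeanPayoff.QuantIncluded, MeanPayoff.WeightedAutomaton.forall_word_toFin]
    simp only [MeanPayoff.WeightedAutomaton.lang_toFin,
      MeanPayoff.WeightedAutomaton.lang_withZero, max_le_iff, le_refl, and_true]
  have hE : ∀ v n, MeanPayoff.QuantEquivalent ((F n).withZero.toFin.lang v) ((F n).toFin.lang v)
      ↔ ¬ H n := by
    intro v n
    rw [← huniv v n, MeanPayoff.QuantEquivalent, MeanPayoff.WeightedAutomaton.forall_word_toFin]
    simp only [MeanPayoff.WeightedAutomaton.lang_toFin,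
      MeanPayoff.WeightedAutomaton.lang_withZero, max_eq_right_iff]
  refine ⟨fun v => ⟨?_, ?_, ?_⟩, ?_, fun v => ⟨?_, ?_, ?_⟩⟩
  · exact MeanPayoff.not_decidableProblem hH (fun n => ⟨_, _, (F n).toFin, 0⟩)
      (hF.toFin.computable_encode.pair hzero) (hU v)
  · exact MeanPayoff.not_decidableProblem hH
      (fun n => ⟨_, _, _, (F n).withZero.toFin, (F n).toFin⟩)
      (hF.withZero.toFin.computable_encode.pair hF.toFin.computable_encode) (hI v)
  · exact MeanPayoff.not_decidableProblem hH
      (fun n => ⟨_, _, _, (F n).withZero.toFin, (F n).toFin⟩)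
      (hF.withZero.toFin.computable_encode.pair hF.toFin.computable_encode) (hE v)
  -- Giving all states to player 2 turns the language into the infimum over runs; instances of kind
  -- `limInfAvg` with threshold 0 suffice.
  · refine MeanPayoff.not_decidableProblem hH
      (fun n => (.limInfAvg, ⟨_, _, (G n).toFin.toAlternating false, 0⟩))
      ((Computable.const _).pair
        ((hG.toFin.computable_encode_toAlternating false).pair hzero)) fun n => ?_
    rw [← hempty n, ← not_iff_not]
    simp only [MeanPayoff.QuantNonempty, not_exists, Rat.cast_zero]
    rw [MeanPayoff.WeightedAutomaton.forall_word_toFin]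
    simp only [MeanPayoff.WeightedAutomaton.lang_toAlternating_false,
      MeanPayoff.WeightedAutomaton.toFin, MeanPayoff.WeightedAutomaton.values_reindex]
  · exact MeanPayoff.not_decidableProblem hH
      (fun n => ⟨_, _, (F n).toFin.toAlternating true, 0⟩)
      ((hF.toFin.computable_encode_toAlternating true).pair hzero) fun n => by
        simpa only [MeanPayoff.WeightedAutomaton.lang_toAlternating_true] using hU v n
  · exact MeanPayoff.not_decidableProblem hH
      (fun n => ⟨_, _, _, (F n).withZero.toFin.toAlternating true,
        (F n).toFin.toAlternating true⟩)
      ((hF.withZero.toFin.computable_encode_toAlternating true).pair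
        (hF.toFin.computable_encode_toAlternating true)) fun n => by
        simpa only [MeanPayoff.WeightedAutomaton.lang_toAlternating_true] using hI v n
  · exact MeanPayoff.not_decidableProblem hH
      (fun n => ⟨_, _, _, (F n).withZero.toFin.toAlternating true,
        (F n).toFin.toAlternating true⟩)
      ((hF.withZero.toFin.computable_encode_toAlternating true).pair
        (hF.toFin.computable_encode_toAlternating true)) fun n => by
        simpa only [MeanPayoff.WeightedAutomaton.lang_toAlternating_true] using hE v n
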